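/- There exist a program $P$ for the real random access machine described below and a constant $C\in\mathbb N$ such that the following holds. Let $G=(V,E)$ be a directed acyclic graph with vertex set $V$ of size $|V|=n\ge 1$ and with $|E|=m$ edges, let $x\in\mathbb R$, and let the edge lengths $(Y_{e})_{e\in E}$ be mutually independent random variables with the standard exponential distribution, $\Pr[Y_e\le y]=1-e^{-y}$ for $y\ge 0$ and $\Pr[Y_e\le y]=0$ for $y<0$. Let $$X_{\rm MAX}=\max_{\pi\in\Pi(G)}\ \sum_{uv\in E(\pi)}Y_{uv},$$ where $\Pi(G)$ is the set of all directed paths in $G$ from a source (a vertex without incoming edges) to a terminal (a vertex without outgoing edges); an isolated vertex counts as such a path, of length $0$. Then $P$, on input $(G,x)$, halts and outputs exactly the real number $\Pr[X_{\rm MAX}\le x]$. Moreover, if $m\ge 1$ and the underlying undirected graph of $G$ has treewidth at most $k$, then $P$ halts on input $(G,x)$ after at most $$\bigl((6k+4)\,m\,n\bigr)^{Ck}$$ steps; that is, $\Pr[X_{\rm MAX}\le x]$ is computed exactly in $((6k+4)mn)^{O(k)}$ time. Here the machine has indirectly addressable cells for natural numbers and for real numbers. The following operations cost one step each: addition, truncated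 subtraction, multiplication and comparison of natural numbers; the cast of a natural number to a real number; addition, subtraction, multiplication, division, comparison and $y\mapsto e^{y}$ for real numbers, all exact; and reading or writing a cell. Programs are built from assignments by sequencing, branching and while loops, and contain only natural numbers as constants. The graph is given by $n$ and its adjacency matrix, with the vertices numbered in an arbitrary order. Neither $k$ nor a tree decomposition is part of the input. -/

import Mathlib

open MeasureTheory ProbabilityTheory

/-! ## Longest paths in directed acyclic graphs -/

namespace LongestPath

variable {V : Type*}

/-- There is no directed closed walk (in particular no loop). -/
def Acyclic (G : Digraph V) : Prop := ∀ v, ¬ Relation.TransGen G.Adj v v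

/-- A source has no incoming edge. -/
def IsSource (G : Digraph V) (v : V) : Prop := ∀ u, ¬ G.Adj u v

/-- A terminal has no outgoing edge. -/
def IsTerminal (G : Digraph V) (v : V) : Prop := ∀ w, ¬ G.Adj v w

/-- The set of edges, as ordered pairs. -/
def edgeSet (G : Digraph V) : Set (V × V) := {e | G.Adj e.1 e.2}

/-- `p = [u₁, …, u_q]` lists the vertices of a directed path from a source to a terminal.
An isolated vertex is such a path, with `q = 1` and no edge. -/
structure IsSTPath (G : Digraph V) (p : List V) : Prop where
  nodup : p.Nodup
  chain : p.IsChain G.Adj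
  source : ∃ s, p.head? = some s ∧ IsSource G s
  terminal : ∃ t, p.getLast? = some t ∧ IsTerminal G t

/-- The sum of the edge lengths `ℓ (uᵢ, uᵢ₊₁)` along `p = [u₁, …, u_q]`. -/
def pathLength (ℓ : V × V → ℝ) (p : List V) : ℝ := ((p.zip p.tail).map ℓ).sum

/-- The set of the lengths of all paths from a source to a terminal. -/
def pathLengths (G : Digraph V) (ℓ : V × V → ℝ) : Set ℝ :=
  {r | ∃ p, IsSTPath G p ∧ pathLength ℓ p = r}

/-- The length of the longest path from a source to a terminal. For a finite nonempty acyclic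
graph it is a maximum, see `isGreatest_longestPathLength`. -/
noncomputable def longestPathLength (G : Digraph V) (ℓ : V × V → ℝ) : ℝ :=
  sSup (pathLengths G ℓ)

theorem exists_isSTPath [Finite V] [Nonempty V] {G : Digraph V} (hG : Acyclic G) :
    ∃ p, IsSTPath G p := by
  classical
  have := Fintype.ofFinite V
  have hnd : {p : List V | p.Nodup}.Finite := Finite.of_fintype {p : List V // p.Nodup}
  have hfin : {p : List V | p.Nodup ∧ p.IsChain G.Adj ∧ p ≠ []}.Finite :=
    hnd.subset fun p hp => hp.1
  have hne : {p : List V | p.Nodup ∧ p.IsChain G.Adj ∧ p ≠ []}.Nonempty :=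
    ⟨[Classical.arbitrary V], by simp⟩
  obtain ⟨p, ⟨hn, hc, h0⟩, hmax⟩ := Set.exists_max_image _ List.length hfin hne
  have hp : p.Pairwise (Relation.TransGen G.Adj) :=
    List.isChain_iff_pairwise.1 (hc.imp fun _ _ h => Relation.TransGen.single h)
  refine ⟨p, hn, hc, ⟨p.head h0, List.head?_eq_some_head h0, fun u hu => ?_⟩,
    ⟨p.getLast h0, List.getLast?_eq_some_getLast h0, fun w hw => ?_⟩⟩
  · have hup : u ∉ p := by
      intro hup
      obtain ⟨a, q, rfl⟩ := List.exists_cons_of_ne_nil h0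
      simp only [List.head_cons] at hu
      rcases List.mem_cons.1 hup with h | h
      · exact hG a (Relation.TransGen.single (h ▸ hu))
      · exact hG a (((List.pairwise_cons.1 hp).1 u h).tail hu)
    have := hmax (u :: p) ⟨List.nodup_cons.2 ⟨hup, hn⟩, by
      obtain ⟨a, q, rfl⟩ := List.exists_cons_of_ne_nil h0
      exact List.isChain_cons_cons.2 ⟨hu, hc⟩, by simp⟩
    simp at this
  · have key : p.dropLast ++ [p.getLast h0] = p := List.dropLast_append_getLast h0
    have hwp : w ∉ p := by
      intro hwp
      rw [← key] at hwp hp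
      rcases List.mem_append.1 hwp with h | h
      · exact hG w (((List.pairwise_append.1 hp).2.2 w h _ (by simp)).tail hw)
      · rw [List.mem_singleton] at h
        exact hG w (Relation.TransGen.single (by rw [← h] at hw; exact hw))
    have := hmax (p ++ [w]) ⟨by
        rw [List.nodup_append]
        refine ⟨hn, by simp, ?_⟩
        intro a ha b hb
        rw [List.mem_singleton] at hb
        rintro rfl
        exact hwp (hb ▸ ha), by
      rw [List.isChain_append]
      refine ⟨hc, by simp, ?_⟩
      intro a ha b hb
      rw [List.getLast?_eq_some_getLast h0] at ha
      simp only [Option.mem_def, Option.some.injEq, List.head?_cons] at ha hb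
      rw [← ha, ← hb]
      exact hw, by simp⟩
    simp at this

theorem isGreatest_longestPathLength [Finite V] [Nonempty V] {G : Digraph V} (hG : Acyclic G)
    (ℓ : V × V → ℝ) : IsGreatest (pathLengths G ℓ) (longestPathLength G ℓ) := by
  classical
  have := Fintype.ofFinite V
  have hfin : (pathLengths G ℓ).Finite := by
    have hnd : {p : List V | p.Nodup}.Finite := Finite.of_fintype {p : List V // p.Nodup}
    have hst : {p | IsSTPath G p}.Finite := hnd.subset fun p hp => hp.nodup
    exact hst.image (pathLength ℓ)
  have hne : (pathLengths G ℓ).Nonempty := by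
    obtain ⟨p, hp⟩ := exists_isSTPath hG
    exact ⟨_, p, hp, rfl⟩
  exact ⟨hne.csSup_mem hfin, fun r hr => le_csSup hfin.bddAbove hr⟩

end LongestPath

/-! ## Treewidth -/

/-- A tree decomposition of a graph, with bags indexed by the nodes `0, …, b - 1` of a tree. -/
structure TreeDecomposition {V : Type*} (H : SimpleGraph V) where
  b : ℕ
  tree : SimpleGraph (Fin b)
  isTree : tree.IsTree
  bag : Fin b → Finset V
  exists_mem_bag : ∀ v, ∃ i, v ∈ bag i
  exists_edge_bag : ∀ u v, H.Adj u v → ∃ i, u ∈ bag i ∧ v ∈ bag i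
  mem_bag_of_mem_path : ∀ (h j : Fin b) (p : tree.Walk h j), p.IsPath → ∀ i ∈ p.support,
    ∀ v, v ∈ bag h → v ∈ bag j → v ∈ bag i

namespace TreeDecomposition

variable {V : Type*} {H : SimpleGraph V}

/-- The maximal cardinality of a bag, minus one. -/
def width (T : TreeDecomposition H) : ℕ :=
  (Finset.univ.sup fun i => (T.bag i).card) - 1

end TreeDecomposition

/-- The minimal width of a tree decomposition. -/
noncomputable def treewidth {V : Type*} (H : SimpleGraph V) : ℕ :=
  sInf (Set.range fun T : TreeDecomposition H => T.width)

/-- A finite graph has a tree decomposition (one bag), so the minimum is over a nonempty set. -/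
theorem TreeDecomposition.nonempty {V : Type*} [Finite V] (H : SimpleGraph V) :
    Nonempty (TreeDecomposition H) := by
  have := Fintype.ofFinite V
  exact ⟨{ b := 1
           tree := ⊥
           isTree := SimpleGraph.IsTree.of_subsingleton
           bag := fun _ => Finset.univ
           exists_mem_bag := fun v => ⟨0, Finset.mem_univ v⟩
           exists_edge_bag := fun u v _ => ⟨0, Finset.mem_univ u, Finset.mem_univ v⟩
           mem_bag_of_mem_path := fun _ _ _ _ _ _ v _ _ => Finset.mem_univ v }⟩

/-! ## Real random access machines

A real random access machine has an array of natural numbers and an array of real numbers, both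
indirectly addressable. Its unit-cost operations are addition, truncated subtraction,
multiplication and comparison of natural numbers (no division, rounding or bit operation), the
field operations, `exp` and comparison on real numbers, and the cast of a natural number to a real
number (never from real numbers to natural numbers). The only constants that a program may
contain are natural numbers. -/

namespace RealRAM

/-- The memory: natural cells and real cells. -/
structure State where
  nat : ℕ → ℕ
  real : ℕ → ℝ

/-- Expressions with natural values; `cell a` is the natural cell with address `a`. -/
inductive NExp where
  | lit (c : ℕ)
  | cell (a : NExp)
  | add (a b : NExp)
  | sub (a b : NExp)
  | mul (a b : NExp)

/-- Expressions with real values; `cell a` is the real cell with address `a`. -/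
inductive RExp where
  | ofNat (a : NExp)
  | cell (a : NExp)
  | add (a b : RExp)
  | sub (a b : RExp)
  | mul (a b : RExp)
  | div (a b : RExp)
  | exp (a : RExp)

/-- Tests. -/
inductive BExp where
  | natLt (a b : NExp)
  | natEq (a b : NExp)
  | realLt (a b : RExp)
  | not (a : BExp)
  | and (a b : BExp)

def NExp.eval (s : State) : NExp → ℕ
  | lit c => c
  | cell a => s.nat (a.eval s)
  | add a b => a.eval s + b.eval s
  | sub a b => a.eval s - b.eval s
  | mul a b => a.eval s * b.eval s

/-- Division by zero returns zero. -/
noncomputable def RExp.eval (s : State) : RExp → ℝ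
  | ofNat a => (a.eval s : ℝ)
  | cell a => s.real (a.eval s)
  | add a b => a.eval s + b.eval s
  | sub a b => a.eval s - b.eval s
  | mul a b => a.eval s * b.eval s
  | div a b => a.eval s / b.eval s
  | exp a => Real.exp (a.eval s)

def BExp.eval (s : State) : BExp → Prop
  | natLt a b => a.eval s < b.eval s
  | natEq a b => a.eval s = b.eval s
  | realLt a b => a.eval s < b.eval s
  | not a => ¬ a.eval s
  | and a b => a.eval s ∧ b.eval s

/-- The number of operations in the evaluation of an expression. -/
def NExp.cost : NExp → ℕ
  | lit _ => 1
  | cell a => a.cost + 1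
  | add a b => a.cost + b.cost + 1
  | sub a b => a.cost + b.cost + 1
  | mul a b => a.cost + b.cost + 1

/-- The number of operations in the evaluation of an expression. -/
def RExp.cost : RExp → ℕ
  | ofNat a => a.cost + 1
  | cell a => a.cost + 1
  | add a b => a.cost + b.cost + 1
  | sub a b => a.cost + b.cost + 1
  | mul a b => a.cost + b.cost + 1
  | div a b => a.cost + b.cost + 1
  | exp a => a.cost + 1

/-- The number of operations in the evaluation of a test. -/
def BExp.cost : BExp → ℕ
  | natLt a b => a.cost + b.cost + 1
  | natEq a b => a.cost + b.cost + 1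
  | realLt a b => a.cost + b.cost + 1
  | not a => a.cost + 1
  | and a b => a.cost + b.cost + 1

/-- Programs. `setNat a e` and `setReal a e` write the value of `e` to the cell with address `a`. -/
inductive Program where
  | skip
  | setNat (a e : NExp)
  | setReal (a : NExp) (e : RExp)
  | seq (P Q : Program)
  | ite (c : BExp) (P Q : Program)
  | while (c : BExp) (P : Program)

/-- `Exec P s t s'`: started in the memory `s`, the program `P` halts in the memory `s'` after
exactly `t` steps. -/
inductive Exec : Program → State → ℕ → State → Prop
  | skip (s : State) : Exec .skip s 1 s
  | setNat (a e : NExp) (s : State) :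
      Exec (.setNat a e) s (a.cost + e.cost + 1)
        { s with nat := Function.update s.nat (a.eval s) (e.eval s) }
  | setReal (a : NExp) (e : RExp) (s : State) :
      Exec (.setReal a e) s (a.cost + e.cost + 1)
        { s with real := Function.update s.real (a.eval s) (e.eval s) }
  | seq {P Q : Program} {s₁ s₂ s₃ : State} {t₁ t₂ : ℕ} :
      Exec P s₁ t₁ s₂ → Exec Q s₂ t₂ s₃ → Exec (.seq P Q) s₁ (t₁ + t₂) s₃
  | iteTrue {c : BExp} {P : Program} (Q : Program) {s s' : State} {t : ℕ} :
      c.eval s → Exec P s t s' → Exec (.ite c P Q) s (c.cost + t) s'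
  | iteFalse {c : BExp} (P : Program) {Q : Program} {s s' : State} {t : ℕ} :
      ¬ c.eval s → Exec Q s t s' → Exec (.ite c P Q) s (c.cost + t) s'
  | whileFalse {c : BExp} (P : Program) {s : State} :
      ¬ c.eval s → Exec (.while c P) s c.cost s
  | whileTrue {c : BExp} {P : Program} {s₁ s₂ s₃ : State} {t₁ t₂ : ℕ} :
      c.eval s₁ → Exec P s₁ t₁ s₂ → Exec (.while c P) s₂ t₂ s₃ →
        Exec (.while c P) s₁ (c.cost + t₁ + t₂) s₃

/-- Executions are deterministic: the final memory and the number of steps are unique. -/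
theorem Exec.unique {P : Program} {s s₁ s₂ : State} {t₁ t₂ : ℕ} (h₁ : Exec P s t₁ s₁)
    (h₂ : Exec P s t₂ s₂) : t₁ = t₂ ∧ s₁ = s₂ := by
  induction h₁ generalizing t₂ s₂ with
  | skip s => cases h₂; exact ⟨rfl, rfl⟩
  | setNat a e s => cases h₂; exact ⟨rfl, rfl⟩
  | setReal a e s => cases h₂; exact ⟨rfl, rfl⟩
  | seq _ _ ih₁ ih₂ =>
    cases h₂ with
    | seq k₁ k₂ =>
      obtain ⟨rfl, rfl⟩ := ih₁ k₁
      obtain ⟨rfl, rfl⟩ := ih₂ k₂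
      exact ⟨rfl, rfl⟩
  | iteTrue Q hc _ ih =>
    cases h₂ with
    | iteTrue _ _ k => obtain ⟨rfl, rfl⟩ := ih k; exact ⟨rfl, rfl⟩
    | iteFalse _ hc' _ => exact absurd hc hc'
  | iteFalse P hc _ ih =>
    cases h₂ with
    | iteTrue _ hc' _ => exact absurd hc' hc
    | iteFalse _ _ k => obtain ⟨rfl, rfl⟩ := ih k; exact ⟨rfl, rfl⟩
  | whileFalse P hc =>
    cases h₂ with
    | whileFalse _ _ => exact ⟨rfl, rfl⟩
    | whileTrue hc' _ _ => exact absurd hc' hc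
  | whileTrue hc _ _ ih₁ ih₂ =>
    cases h₂ with
    | whileFalse _ hc' => exact absurd hc hc'
    | whileTrue _ k₁ k₂ =>
      obtain ⟨rfl, rfl⟩ := ih₁ k₁
      obtain ⟨rfl, rfl⟩ := ih₂ k₂
      exact ⟨rfl, rfl⟩

open Classical in
/-- The initial memory on the input `(G, x)`: natural cell `0` holds the number `n` of vertices,
natural cell `1 + (u * n + v)` holds the entry at `(u, v)` of the adjacency matrix, real cell `0`
holds `x`, and all other cells are zero. -/
noncomputable def input {n : ℕ} (G : Digraph (Fin n)) (x : ℝ) : State where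
  nat a :=
    if a = 0 then n
    else if ∃ u v : Fin n, G.Adj u v ∧ a = 1 + ((u : ℕ) * n + (v : ℕ)) then 1 else 0
  real a := if a = 0 then x else 0

/-- The result of a computation is found in real cell `0`. -/
def State.output (s : State) : ℝ := s.real 0

end RealRAM

/-! ## A language of terms with bounded sums and products, and its compiler -/

/-! Let `m` be the number of edges.

Discretization. If the lengths are rounded up to multiples of a step `h`, an exponential length
takes a geometric number of steps: an edge rings independently at each step, and it is finished at
its first ring after all edges into its source are finished. With `t = exp h - 1`, the probability
that all edges are finished within `N` steps is `exp (-m N h)` times the value at `t` of `ringPoly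
N`, which counts the sequences of `N` ringing sets that finish all edges by their number of rings
(`real_edgeLaw_ceil`). As `h → 0` and `N h → x`, the distribution function becomes `exp (-m x) * ∑ x
^ r / r! * wordCount r`, where `wordCount r` counts the words of `r` single rings that finish all
edges (`real_edgeLaw_eq_tsum`).

A finite formula. Word counts are read off from the powers of one operator, which adds a single
ring. Rings only enlarge the set of finished edges, so the operator is triangular, with diagonal
entries among `0, …, m`; the polynomial `(∏ j ≤ m, (X - j)) ^ (m + 1)` annihilates it
(`aeval_ringOp_eq_zero`). Hence `y ↦ exp (x y)` may be replaced by its Hermite interpolant at these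
nodes, and the series becomes a combination of the first `(m + 1) ^ 2` word counts
(`hasSum_wordCount`). A word count is an iterated difference in `N` of coefficients of `ringPoly N`
(`wordCount_eq`), and `ringPoly N`, of degree at most `N m`, is recovered from its values at natural
numbers (`eq_newton`).

Values of `ringPoly N`. That `g v` is the first time at which all edges into `v` are finished is the
difference of the same condition at `g v` and at `g v - 1`. A signed sum over one letter per vertex,
a time and a bit, therefore decouples the edges (`sum_letterWeight`, `transferOp_pow_allDone`) and
leaves a sum over assignments with one factor per edge.

Dynamic programming. Such a sum is computed by fixing the letters of at most `w` vertices, splitting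
the rest into components, and eliminating a vertex of each component (`compVal_eq`). No tree
decomposition is needed: `Feasible` decides recursively whether the elimination can be continued,
and `feasible_of_treeDecomposition` shows that `w = k + 1` suffices for treewidth `k`. The program
tries `w = 1, 2, …` until the keys suffice.

The machine. All tables are filled by terms with bounded sums and products. Under a cap `l` on all
loops these cost at most a fixed power of `l + 2` (`Cmd.exists_cost_le`), and the cap is a fixed
power of `(4 n (m + 2) ^ 3) ^ w`, which gives the time bound (`steps_le`). -/

namespace RealRAM

/-- Binary operations on natural numbers; the tests return `0` or `1`. -/
inductive NOp where
  | add | sub | mul | lt | eq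

def NOp.eval : NOp → ℕ → ℕ → ℕ
  | add, a, b => a + b
  | sub, a, b => a - b
  | mul, a, b => a * b
  | lt, a, b => if a < b then 1 else 0
  | eq, a, b => if a = b then 1 else 0

/-- Binary operations on real numbers. -/
inductive ROp where
  | add | sub | mul | div

noncomputable def ROp.eval : ROp → ℝ → ℝ → ℝ
  | add, a, b => a + b
  | sub, a, b => a - b
  | mul, a, b => a * b
  | div, a, b => a / b

/-- Terms with natural values. `cap` is the bound for all iterations, `inp a` is a cell of the
input, `tab i a` an entry of a table, `big o j b e` the sum (or the product, if `o = true`) of `e`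
over the values of variable `j` below `b` and the cap, and `app a b c f` evaluates `f` with
variables `0`, `1`, `2` bound to `a`, `b`, `c`. -/
inductive NTerm where
  | lit (c : ℕ)
  | cap
  | var (j : ℕ)
  | inp (a : NTerm)
  | tab (i : Fin 16) (a : NTerm)
  | op (o : NOp) (a b : NTerm)
  | big (o : Bool) (j : ℕ) (b e : NTerm)
  | app (a b c f : NTerm)

/-- Terms with real values, see `NTerm`. -/
inductive RTerm where
  | arg
  | ofNat (a : NTerm)
  | tab (i : Fin 16) (a : NTerm)
  | op (o : ROp) (a b : RTerm)
  | exp (a : RTerm)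
  | big (o : Bool) (j : ℕ) (b : NTerm) (e : RTerm)
  | app (a b c : NTerm) (f : RTerm)

/-- The input, the cap and the tables. -/
structure Mem where
  src : ℕ → ℕ
  arg : ℝ
  cap : ℕ
  nat : Fin 16 → ℕ → ℕ
  real : Fin 16 → ℕ → ℝ

/-- Binds the variables `0`, `1`, `2`. -/
def bind3 (V : ℕ → ℕ) (a b c : ℕ) : ℕ → ℕ :=
  Function.update (Function.update (Function.update V 0 a) 1 b) 2 c

/-- The sum or the product of the first `k` values of a function. -/
def bigOp {α : Type*} [CommSemiring α] (o : Bool) (k : ℕ) (f : ℕ → α) : α :=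
  if o then ∏ i ∈ Finset.range k, f i else ∑ i ∈ Finset.range k, f i

def NTerm.eval (M : Mem) : NTerm → (ℕ → ℕ) → ℕ
  | lit c, _ => c
  | cap, _ => M.cap
  | var j, V => V j
  | inp a, V => M.src (a.eval M V)
  | tab i a, V => M.nat i (a.eval M V)
  | op o a b, V => o.eval (a.eval M V) (b.eval M V)
  | big o j b e, V => bigOp o (min (b.eval M V) M.cap) fun i => e.eval M (Function.update V j i)
  | app a b c f, V => f.eval M (bind3 V (a.eval M V) (b.eval M V) (c.eval M V))

noncomputable def RTerm.eval (M : Mem) : RTerm → (ℕ → ℕ) → ℝ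
  | arg, _ => M.arg
  | ofNat a, V => (a.eval M V : ℝ)
  | tab i a, V => M.real i (a.eval M V)
  | op o a b, V => o.eval (a.eval M V) (b.eval M V)
  | exp a, V => Real.exp (a.eval M V)
  | big o j b e, V => bigOp o (min (b.eval M V) M.cap) fun i => e.eval M (Function.update V j i)
  | app a b c f, V => f.eval M (bind3 V (a.eval M V) (b.eval M V) (c.eval M V))

/-! ### Memory layout -/

/-- The address of entry `i` of the natural array `c`: array `0` holds temporary values, array `1`
the cap, array `2` the variables, and the arrays from `3` on the tables. -/
def natAddr (n c i : ℕ) : ℕ := n * n + 1 + (20 * i + c)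

/-- The address of entry `i` of the real array `c`: array `0` holds temporary values, and the arrays
from `1` on the tables. -/
def realAddr (c i : ℕ) : ℕ := 1 + (20 * i + c)

/-- The memory `s` holds `M`, the variables `V`, and the temporary values `τ` and `ρ`. -/
structure Rep (n : ℕ) (M : Mem) (V τ : ℕ → ℕ) (ρ : ℕ → ℝ) (s : State) : Prop where
  size : s.nat 0 = n
  src : ∀ a ≤ n * n, s.nat a = M.src a
  src_zero : ∀ a, n * n < a → M.src a = 0
  cap : s.nat (natAddr n 1 0) = M.cap
  var : ∀ j, s.nat (natAddr n 2 j) = V j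
  tmp : ∀ j, s.nat (natAddr n 0 j) = τ j
  tab : ∀ (i : Fin 16) a, s.nat (natAddr n (3 + i) a) = M.nat i a
  arg : s.real 0 = M.arg
  rtmp : ∀ j, s.real (realAddr 0 j) = ρ j
  rtab : ∀ (i : Fin 16) a, s.real (realAddr (1 + i) a) = M.real i a

/-- The arrays are interleaved with stride 20, so each is unbounded. The stride exceeds the number
of arrays in use: sixteen tables and three further arrays of naturals, or one further array of
reals. -/
theorem natAddr_inj {n c i c' i' : ℕ} (hc : c < 20) (hc' : c' < 20) :
    natAddr n c i = natAddr n c' i' ↔ c = c' ∧ i = i' := by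
  unfold natAddr; omega

theorem realAddr_inj {c i c' i' : ℕ} (hc : c < 20) (hc' : c' < 20) :
    realAddr c i = realAddr c' i' ↔ c = c' ∧ i = i' := by
  unfold realAddr; omega

theorem ne_natAddr {n a c i : ℕ} (h : a ≤ n * n) : a ≠ natAddr n c i := by
  unfold natAddr; omega

namespace Rep

variable {n : ℕ} {M : Mem} {V τ : ℕ → ℕ} {ρ : ℕ → ℝ} {s : State}

theorem setTmp (h : Rep n M V τ ρ s) (d v : ℕ) :
    Rep n M V (Function.update τ d v) ρ
      { s with nat := Function.update s.nat (natAddr n 0 d) v } where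
  size := by simp [Function.update_of_ne (ne_natAddr (Nat.zero_le _)), h.size]
  src a ha := by simp [Function.update_of_ne (ne_natAddr ha), h.src a ha]
  src_zero := h.src_zero
  cap := by simp [natAddr_inj, h.cap]
  var j := by simp [natAddr_inj, h.var]
  tmp j := by simp [Function.update_apply, natAddr_inj, h.tmp]
  tab i a := by
    have := i.2
    simp [natAddr_inj, h.tab, show 3 + (i : ℕ) < 20 by omega]
  arg := h.arg
  rtmp := h.rtmp
  rtab := h.rtab

theorem setVar (h : Rep n M V τ ρ s) (d v : ℕ) :
    Rep n M (Function.update V d v) τ ρ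
      { s with nat := Function.update s.nat (natAddr n 2 d) v } where
  size := by simp [Function.update_of_ne (ne_natAddr (Nat.zero_le _)), h.size]
  src a ha := by simp [Function.update_of_ne (ne_natAddr ha), h.src a ha]
  src_zero := h.src_zero
  cap := by simp [natAddr_inj, h.cap]
  var j := by simp [Function.update_apply, natAddr_inj, h.var]
  tmp j := by simp [natAddr_inj, h.tmp]
  tab i a := by
    have := i.2
    simp only
    rw [← h.tab, Function.update_of_ne]
    rw [Ne, natAddr_inj (by omega) (by omega)]
    omega
  arg := h.arg
  rtmp := h.rtmp
  rtab := h.rtab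

theorem setCap (h : Rep n M V τ ρ s) (v : ℕ) :
    Rep n { M with cap := v } V τ ρ
      { s with nat := Function.update s.nat (natAddr n 1 0) v } where
  size := by simp [Function.update_of_ne (ne_natAddr (Nat.zero_le _)), h.size]
  src a ha := by simp [Function.update_of_ne (ne_natAddr ha), h.src a ha]
  src_zero := h.src_zero
  cap := by simp
  var j := by simp [natAddr_inj, h.var]
  tmp j := by simp [natAddr_inj, h.tmp]
  tab i a := by
    have := i.2
    simp only
    rw [← h.tab, Function.update_of_ne]
    rw [Ne, natAddr_inj (by omega) (by omega)]
    omega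
  arg := h.arg
  rtmp := h.rtmp
  rtab := h.rtab

theorem setTab (h : Rep n M V τ ρ s) (i : Fin 16) (d v : ℕ) :
    Rep n { M with nat := Function.update M.nat i (Function.update (M.nat i) d v) } V τ ρ
      { s with nat := Function.update s.nat (natAddr n (3 + i) d) v } where
  size := by simp [Function.update_of_ne (ne_natAddr (Nat.zero_le _)), h.size]
  src a ha := by simp [Function.update_of_ne (ne_natAddr ha), h.src a ha]
  src_zero := h.src_zero
  cap := by
    have := i.2
    simp only
    rw [← h.cap, Function.update_of_ne]
    rw [Ne, natAddr_inj (by omega) (by omega)]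
    omega
  var j := by
    have := i.2
    simp only
    rw [← h.var, Function.update_of_ne]
    rw [Ne, natAddr_inj (by omega) (by omega)]
    omega
  tmp j := by
    have := i.2
    simp only
    rw [← h.tmp, Function.update_of_ne]
    rw [Ne, natAddr_inj (by omega) (by omega)]
    omega
  tab i' a := by
    have := i.2
    have := i'.2
    simp only [Function.update_apply, natAddr_inj (show 3 + (i' : ℕ) < 20 by omega)
      (show 3 + (i : ℕ) < 20 by omega), h.tab]
    by_cases hi : i' = i
    · subst hi; simp [Function.update_apply]
    · have : (i' : ℕ) ≠ i := fun h => hi (Fin.ext h)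
      simp [hi, this]
  arg := h.arg
  rtmp := h.rtmp
  rtab := h.rtab

theorem setRTmp (h : Rep n M V τ ρ s) (d : ℕ) (v : ℝ) :
    Rep n M V τ (Function.update ρ d v)
      { s with real := Function.update s.real (realAddr 0 d) v } where
  size := h.size
  src := h.src
  src_zero := h.src_zero
  cap := h.cap
  var := h.var
  tmp := h.tmp
  tab := h.tab
  arg := by
    simp only
    rw [← h.arg, Function.update_of_ne]
    unfold realAddr; omega
  rtmp j := by simp [Function.update_apply, realAddr_inj, h.rtmp]
  rtab i a := by
    have := i.2
    simp [realAddr_inj, h.rtab, show 1 + (i : ℕ) < 20 by omega]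

theorem setRTab (h : Rep n M V τ ρ s) (i : Fin 16) (d : ℕ) (v : ℝ) :
    Rep n { M with real := Function.update M.real i (Function.update (M.real i) d v) } V τ ρ
      { s with real := Function.update s.real (realAddr (1 + i) d) v } where
  size := h.size
  src := h.src
  src_zero := h.src_zero
  cap := h.cap
  var := h.var
  tmp := h.tmp
  tab := h.tab
  arg := by
    simp only
    rw [← h.arg, Function.update_of_ne]
    unfold realAddr; omega
  rtmp j := by
    have := i.2
    simp only
    rw [← h.rtmp, Function.update_of_ne]
    rw [Ne, realAddr_inj (by omega) (by omega)]
    omega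
  rtab i' a := by
    have := i.2
    have := i'.2
    simp only [Function.update_apply, realAddr_inj (show 1 + (i' : ℕ) < 20 by omega)
      (show 1 + (i : ℕ) < 20 by omega), h.rtab]
    by_cases hi : i' = i
    · subst hi; simp [Function.update_apply]
    · have : (i' : ℕ) ≠ i := fun h => hi (Fin.ext h)
      simp [hi, this]

end Rep

/-! ### Total executions with a bound on the number of steps -/

/-- `P` halts when started in `s`, after at most `T` steps and in a memory with property `Q`. -/
def Runs (P : Program) (s : State) (T : ℕ) (Q : State → Prop) : Prop :=
  ∃ t s', Exec P s t s' ∧ t ≤ T ∧ Q s'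

theorem Runs.mono {P : Program} {s : State} {T T' : ℕ} {Q Q' : State → Prop}
    (h : Runs P s T Q) (hT : T ≤ T') (hQ : ∀ s', Q s' → Q' s') : Runs P s T' Q' := by
  obtain ⟨t, s', he, ht, hq⟩ := h
  exact ⟨t, s', he, ht.trans hT, hQ _ hq⟩

theorem Runs.seq {P P' : Program} {s : State} {T T' : ℕ} {Q Q' : State → Prop}
    (h : Runs P s T Q) (h' : ∀ s', Q s' → Runs P' s' T' Q') : Runs (.seq P P') s (T + T') Q' := by
  obtain ⟨t, s', he, ht, hq⟩ := h
  obtain ⟨t', s'', he', ht', hq'⟩ := h' _ hq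
  exact ⟨_, _, he.seq he', by omega, hq'⟩

theorem Runs.setNat {a e : NExp} {s : State} {Q : State → Prop}
    (h : Q { s with nat := Function.update s.nat (a.eval s) (e.eval s) }) :
    Runs (.setNat a e) s (a.cost + e.cost + 1) Q :=
  ⟨_, _, .setNat a e s, le_rfl, h⟩

theorem Runs.setReal {a : NExp} {e : RExp} {s : State} {Q : State → Prop}
    (h : Q { s with real := Function.update s.real (a.eval s) (e.eval s) }) :
    Runs (.setReal a e) s (a.cost + e.cost + 1) Q :=
  ⟨_, _, .setReal a e s, le_rfl, h⟩

theorem Runs.ite {c : BExp} {P P' : Program} {s : State} {T : ℕ} {Q : State → Prop}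
    (h : c.eval s → Runs P s T Q) (h' : ¬ c.eval s → Runs P' s T Q) :
    Runs (.ite c P P') s (c.cost + T) Q := by
  by_cases hc : c.eval s
  · obtain ⟨t, s', he, ht, hq⟩ := h hc
    exact ⟨_, _, he.iteTrue _ hc, by omega, hq⟩
  · obtain ⟨t, s', he, ht, hq⟩ := h' hc
    exact ⟨_, _, he.iteFalse _ hc, by omega, hq⟩

/-- A loop with the invariant `I i` before iteration `i`, and `k` iterations. -/
theorem Runs.while {c : BExp} {P : Program} {T k : ℕ} {I : ℕ → State → Prop}
    (hbody : ∀ i < k, ∀ s, I i s → c.eval s ∧ Runs P s T (I (i + 1)))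
    (hend : ∀ s, I k s → ¬ c.eval s) {s : State} (h0 : I 0 s) :
    Runs (.while c P) s (k * (c.cost + T) + c.cost) (I k) := by
  suffices h : ∀ j i, i + j = k → ∀ s, I i s →
      Runs (.while c P) s (j * (c.cost + T) + c.cost) (I k) from h k 0 (by omega) s h0
  intro j
  induction j with
  | zero =>
    intro i hi s hs
    obtain rfl : i = k := by omega
    exact ⟨_, _, .whileFalse P (hend s hs), by omega, hs⟩
  | succ j ih =>
    intro i hi s hs
    obtain ⟨hc, t, s', he, ht, hs'⟩ := hbody i (by omega) s hs
    obtain ⟨t', s'', he', ht', hs''⟩ := ih (i + 1) (by omega) s' hs'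
    refine ⟨_, _, .whileTrue hc he he', ?_, hs''⟩
    rw [Nat.succ_mul]
    omega

end RealRAM

/-! ### Addresses as expressions, and single assignments -/

namespace RealRAM

/-- The address of entry `e` of the natural array `c`. -/
def natRef (c : ℕ) (e : NExp) : NExp :=
  .add (.add (.mul (.cell (.lit 0)) (.cell (.lit 0))) (.lit 1)) (.add (.mul (.lit 20) e) (.lit c))

/-- The address of entry `e` of the real array `c`. -/
def realRef (c : ℕ) (e : NExp) : NExp := .add (.lit 1) (.add (.mul (.lit 20) e) (.lit c))

abbrev getTmp (d : ℕ) : NExp := .cell (natRef 0 (.lit d))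
abbrev getVar (j : ℕ) : NExp := .cell (natRef 2 (.lit j))
abbrev getCap : NExp := .cell (natRef 1 (.lit 0))
abbrev getRTmp (d : ℕ) : RExp := .cell (realRef 0 (.lit d))
abbrev putTmp (d : ℕ) (e : NExp) : Program := .setNat (natRef 0 (.lit d)) e
abbrev putVar (j : ℕ) (e : NExp) : Program := .setNat (natRef 2 (.lit j)) e
abbrev putRTmp (d : ℕ) (e : RExp) : Program := .setReal (realRef 0 (.lit d)) e

section
variable {n : ℕ} {M : Mem} {V τ : ℕ → ℕ} {ρ : ℕ → ℝ} {s : State}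

theorem Rep.eval_natRef (h : Rep n M V τ ρ s) (c : ℕ) (e : NExp) :
    (natRef c e).eval s = natAddr n c (e.eval s) := by
  simp [natRef, NExp.eval, natAddr, h.size]

theorem eval_realRef (c : ℕ) (e : NExp) : (realRef c e).eval s = realAddr c (e.eval s) := by
  simp [realRef, NExp.eval, realAddr]

theorem Rep.eval_getTmp (h : Rep n M V τ ρ s) (d : ℕ) : (getTmp d).eval s = τ d := by
  rw [getTmp, NExp.eval, h.eval_natRef, NExp.eval, h.tmp]

theorem Rep.eval_getVar (h : Rep n M V τ ρ s) (d : ℕ) : (getVar d).eval s = V d := by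
  rw [getVar, NExp.eval, h.eval_natRef, NExp.eval, h.var]

theorem Rep.eval_getCap (h : Rep n M V τ ρ s) : getCap.eval s = M.cap := by
  rw [getCap, NExp.eval, h.eval_natRef, NExp.eval, h.cap]

theorem Rep.eval_getRTmp (h : Rep n M V τ ρ s) (d : ℕ) : (getRTmp d).eval s = ρ d := by
  rw [getRTmp, RExp.eval, eval_realRef, NExp.eval, h.rtmp]

/-- Evaluating the address takes 13 operations, and the write one more. -/
theorem Rep.runs_putTmp (h : Rep n M V τ ρ s) (d : ℕ) (e : NExp) {Q : State → Prop} {T : ℕ}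
    (hT : e.cost + 14 ≤ T)
    (hQ : ∀ s', Rep n M V (Function.update τ d (e.eval s)) ρ s' → Q s') :
    Runs (putTmp d e) s T Q := by
  refine (Runs.setNat (hQ _ ?_)).mono (T := (natRef 0 (.lit d)).cost + e.cost + 1) ?_ fun _ => id
  · rw [h.eval_natRef]; exact h.setTmp _ _
  · simp only [natRef, NExp.cost]; omega

theorem Rep.runs_putVar (h : Rep n M V τ ρ s) (d : ℕ) (e : NExp) {Q : State → Prop} {T : ℕ}
    (hT : e.cost + 14 ≤ T)
    (hQ : ∀ s', Rep n M (Function.update V d (e.eval s)) τ ρ s' → Q s') :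
    Runs (putVar d e) s T Q := by
  refine (Runs.setNat (hQ _ ?_)).mono (T := (natRef 2 (.lit d)).cost + e.cost + 1) ?_ fun _ => id
  · rw [h.eval_natRef]; exact h.setVar _ _
  · simp only [natRef, NExp.cost]; omega

theorem Rep.runs_putRTmp (h : Rep n M V τ ρ s) (d : ℕ) (e : RExp) {Q : State → Prop} {T : ℕ}
    (hT : e.cost + 14 ≤ T)
    (hQ : ∀ s', Rep n M V τ (Function.update ρ d (e.eval s)) s' → Q s') :
    Runs (putRTmp d e) s T Q := by
  refine (Runs.setReal (hQ _ ?_)).mono (T := (realRef 0 (.lit d)).cost + e.cost + 1) ?_ fun _ => id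
  · rw [eval_realRef]; exact h.setRTmp _ _
  · simp only [realRef, NExp.cost]; omega

end

/-! ### The compiler -/

/-- Applies an operation to the temporary values `d` and `d + 1`. -/
def NOp.prog (d : ℕ) : NOp → Program
  | add => putTmp d (.add (getTmp d) (getTmp (d + 1)))
  | sub => putTmp d (.sub (getTmp d) (getTmp (d + 1)))
  | mul => putTmp d (.mul (getTmp d) (getTmp (d + 1)))
  | lt => .ite (.natLt (getTmp d) (getTmp (d + 1))) (putTmp d (.lit 1)) (putTmp d (.lit 0))
  | eq => .ite (.natEq (getTmp d) (getTmp (d + 1))) (putTmp d (.lit 1)) (putTmp d (.lit 0))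

def ROp.toRExp : ROp → RExp → RExp → RExp
  | add => .add
  | sub => .sub
  | mul => .mul
  | div => .div

/-- Computes the number of iterations in `d + 1`, saves variable `j` in `d + 2` and sets it to
zero. -/
def loopInit (d j : ℕ) : Program :=
  .seq (.ite (.natLt getCap (getTmp (d + 1))) (putTmp (d + 1) getCap) .skip)
    (.seq (putTmp (d + 2) (getVar j)) (putVar j (.lit 0)))

def loopTest (d j : ℕ) : BExp := .natLt (getVar j) (getTmp (d + 1))

def loopNext (j : ℕ) : Program := putVar j (.add (getVar j) (.lit 1))

/-- Saves the variables `0`, `1`, `2` and sets them to the temporary values `d`, `d + 1`,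
`d + 2`. -/
def bindProg (d : ℕ) : Program :=
  .seq (putTmp (d + 3) (getVar 0)) (.seq (putTmp (d + 4) (getVar 1)) (.seq
    (putTmp (d + 5) (getVar 2)) (.seq (putVar 0 (getTmp d)) (.seq (putVar 1 (getTmp (d + 1)))
      (putVar 2 (getTmp (d + 2)))))))

def unbindProg (d : ℕ) : Program :=
  .seq (putVar 0 (getTmp (d + 3))) (.seq (putVar 1 (getTmp (d + 4)))
    (putVar 2 (getTmp (d + 5))))

/-- Evaluates a term into the temporary value `d`; only temporary values from `d` on change. -/
def NTerm.compile : NTerm → ℕ → Program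
  | lit c, d => putTmp d (.lit c)
  | cap, d => putTmp d getCap
  | var j, d => putTmp d (getVar j)
  -- Cells beyond `n * n` hold the working memory, whereas the input is zero there; such an address
  -- must not be read.
  | inp a, d => .seq (a.compile d)
      (.ite (.natLt (.mul (.cell (.lit 0)) (.cell (.lit 0))) (getTmp d)) (putTmp d (.lit 0))
        (putTmp d (.cell (getTmp d))))
  | tab i a, d => .seq (a.compile d) (putTmp d (.cell (natRef (3 + i) (getTmp d))))
  | op o a b, d => .seq (a.compile d) (.seq (b.compile (d + 1)) (o.prog d))
  -- Slot `d` is the accumulator, `d + 1` the number of iterations and `d + 2` the saved loop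
  -- variable, so the body starts at `d + 3`.
  | big o j b e, d => .seq (b.compile (d + 1)) (.seq (loopInit d j)
      (.seq (putTmp d (.lit (if o then 1 else 0)))
      (.seq (.while (loopTest d j) (.seq (e.compile (d + 3)) (.seq
        (putTmp d (if o then .mul (getTmp d) (getTmp (d + 3)) else
          .add (getTmp d) (getTmp (d + 3)))) (loopNext j))))
      (putVar j (getTmp (d + 2))))))
  | app a b c f, d => .seq (a.compile d) (.seq (b.compile (d + 1)) (.seq (c.compile (d + 2))
      (.seq (bindProg d) (.seq (f.compile (d + 6)) (.seq (unbindProg d)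
        (putTmp d (getTmp (d + 6))))))))

def RTerm.compile : RTerm → ℕ → Program
  | arg, d => putRTmp d (.cell (.lit 0))
  | ofNat a, d => .seq (a.compile d) (putRTmp d (.ofNat (getTmp d)))
  | tab i a, d => .seq (a.compile d) (putRTmp d (.cell (realRef (1 + i) (getTmp d))))
  | op o a b, d => .seq (a.compile d) (.seq (b.compile (d + 1))
      (putRTmp d (o.toRExp (getRTmp d) (getRTmp (d + 1)))))
  | exp a, d => .seq (a.compile d) (putRTmp d (.exp (getRTmp d)))
  | big o j b e, d => .seq (b.compile (d + 1)) (.seq (loopInit d j)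
      (.seq (putRTmp d (.ofNat (.lit (if o then 1 else 0))))
      (.seq (.while (loopTest d j) (.seq (e.compile (d + 3)) (.seq
        (putRTmp d (if o then .mul (getRTmp d) (getRTmp (d + 3)) else
          .add (getRTmp d) (getRTmp (d + 3)))) (loopNext j))))
      (putVar j (getTmp (d + 2))))))
  | app a b c f, d => .seq (a.compile d) (.seq (b.compile (d + 1)) (.seq (c.compile (d + 2))
      (.seq (bindProg d) (.seq (f.compile (d + 6)) (.seq (unbindProg d)
        (putRTmp d (getRTmp (d + 6))))))))

/-- A bound for the number of steps of the evaluation of a term under the cap `l`. -/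
def NTerm.cost : NTerm → ℕ → ℕ
  | lit _, _ => 100
  | cap, _ => 100
  | var _, _ => 100
  | inp a, l => a.cost l + 100
  | tab _ a, l => a.cost l + 100
  | op _ a b, l => a.cost l + b.cost l + 100
  | big _ _ b e, l => b.cost l + l * (e.cost l + 500) + 500
  | app a b c f, l => a.cost l + b.cost l + c.cost l + f.cost l + 500

def RTerm.cost : RTerm → ℕ → ℕ
  | arg, _ => 100
  | ofNat a, l => a.cost l + 100
  | tab _ a, l => a.cost l + 100
  | op _ a b, l => a.cost l + b.cost l + 100
  | exp a, l => a.cost l + 100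
  | big _ _ b e, l => b.cost l + l * (e.cost l + 500) + 500
  | app a b c f, l => a.cost l + b.cost l + c.cost l + f.cost l + 500

section
variable {n : ℕ} {M : Mem} {V τ : ℕ → ℕ} {ρ : ℕ → ℝ} {s : State}

theorem Rep.runs_nop (h : Rep n M V τ ρ s) (o : NOp) (d : ℕ) :
    Runs (o.prog d) s 100
      (Rep n M V (Function.update τ d (o.eval (τ d) (τ (d + 1)))) ρ) := by
  cases o
  case lt =>
    refine (Runs.ite (T := 15) (fun hc => ?_) (fun hc => ?_)).mono
      (by simp [BExp.cost, NExp.cost, natRef]) fun _ => id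
    all_goals
      simp only [BExp.eval, h.eval_getTmp] at hc
      refine h.runs_putTmp d _ (by simp [NExp.cost]) fun s' hs' => ?_
      simpa [NOp.eval, hc, NExp.eval] using hs'
  case eq =>
    refine (Runs.ite (T := 15) (fun hc => ?_) (fun hc => ?_)).mono
      (by simp [BExp.cost, NExp.cost, natRef]) fun _ => id
    all_goals
      simp only [BExp.eval, h.eval_getTmp] at hc
      refine h.runs_putTmp d _ (by simp [NExp.cost]) fun s' hs' => ?_
      simpa [NOp.eval, hc, NExp.eval] using hs'
  all_goals
    refine h.runs_putTmp d _ (by simp [NExp.cost, natRef]) fun s' hs' => ?_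
    rw [NExp.eval, h.eval_getTmp, h.eval_getTmp] at hs'
    exact hs'

theorem Rep.runs_loopInit (h : Rep n M V τ ρ s) (d j : ℕ) :
    Runs (loopInit d j) s 200
      (Rep n M (Function.update V j 0) (Function.update (Function.update τ (d + 1)
        (min (τ (d + 1)) M.cap)) (d + 2) (V j)) ρ) := by
  refine (Runs.seq (T := 70) (T' := 80)
    (Q := Rep n M V (Function.update τ (d + 1) (min (τ (d + 1)) M.cap)) ρ) ?_ ?_).mono
    (by simp) fun _ => id
  · refine (Runs.ite (T := 30) (fun hc => ?_) (fun hc => ?_)).mono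
      (by simp [BExp.cost, NExp.cost, natRef]) fun _ => id
    · simp only [BExp.eval, h.eval_getTmp, h.eval_getCap] at hc
      refine h.runs_putTmp _ _ (by simp [NExp.cost, natRef]) fun s' hs' => ?_
      rw [h.eval_getCap] at hs'
      rwa [min_eq_right hc.le]
    · simp only [BExp.eval, h.eval_getTmp, h.eval_getCap, not_lt] at hc
      refine ⟨_, _, .skip s, by simp, ?_⟩
      rw [min_eq_left hc, Function.update_eq_self]
      exact h
  · intro s' hs'
    refine (Runs.seq (T := 30) (T' := 30) (hs'.runs_putTmp _ _ (by simp [NExp.cost, natRef])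
      fun s'' hs'' => hs'') fun s'' hs'' => ?_).mono (by simp) fun _ => id
    refine hs''.runs_putVar _ _ (by simp [NExp.cost]) fun s₃ hs₃ => ?_
    rw [hs'.eval_getVar] at hs₃
    exact hs₃

theorem Rep.eval_loopTest (h : Rep n M V τ ρ s) (d j : ℕ) :
    (loopTest d j).eval s ↔ V j < τ (d + 1) := by
  rw [loopTest, BExp.eval, h.eval_getTmp, h.eval_getVar]

theorem Rep.runs_loopNext (h : Rep n M V τ ρ s) (j : ℕ) :
    Runs (loopNext j) s 100 (Rep n M (Function.update V j (V j + 1)) τ ρ) := by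
  refine h.runs_putVar _ _ (by simp [NExp.cost, natRef]) fun s' hs' => ?_
  rw [NExp.eval, h.eval_getVar] at hs'
  exact hs'

theorem Rep.runs_bindProg (h : Rep n M V τ ρ s) (d : ℕ) :
    Runs (bindProg d) s 200
      (Rep n M (bind3 V (τ d) (τ (d + 1)) (τ (d + 2)))
        (Function.update (Function.update (Function.update τ (d + 3) (V 0)) (d + 4) (V 1)) (d + 5)
          (V 2)) ρ) := by
  have c : ∀ j, (getVar j).cost ≤ 14 := fun j => by simp [NExp.cost, natRef]
  have c' : ∀ j, (getTmp j).cost ≤ 14 := fun j => by simp [NExp.cost, natRef]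
  refine (Runs.seq (T := 30) (T' := 150) (h.runs_putTmp _ _ (by linarith [c 0])
    fun s hs => hs) fun s1 h1 => ?_).mono (by simp) fun _ => id
  refine (Runs.seq (T := 30) (T' := 120) (h1.runs_putTmp _ _ (by linarith [c 1])
    fun s hs => hs) fun s2 h2 => ?_).mono (by simp) fun _ => id
  refine (Runs.seq (T := 30) (T' := 90) (h2.runs_putTmp _ _ (by linarith [c 2])
    fun s hs => hs) fun s3 h3 => ?_).mono (by simp) fun _ => id
  refine (Runs.seq (T := 30) (T' := 60) (h3.runs_putVar _ _ (by linarith [c' d])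
    fun s hs => hs) fun s4 h4 => ?_).mono (by simp) fun _ => id
  refine (Runs.seq (T := 30) (T' := 30) (h4.runs_putVar _ _ (by linarith [c' (d + 1)])
    fun s hs => hs) fun s5 h5 => ?_).mono (by simp) fun _ => id
  refine h5.runs_putVar _ _ (by linarith [c' (d + 2)]) fun s6 h6 => ?_
  rw [h.eval_getVar, h1.eval_getVar, h2.eval_getVar, h3.eval_getTmp, h4.eval_getTmp,
    h5.eval_getTmp] at h6
  simpa [bind3, Function.update_apply] using h6

theorem Rep.runs_unbindProg {a b c : ℕ} (h : Rep n M (bind3 V a b c) τ ρ s) (d : ℕ)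
    (h0 : τ (d + 3) = V 0) (h1 : τ (d + 4) = V 1) (h2 : τ (d + 5) = V 2) :
    Runs (unbindProg d) s 100 (Rep n M V τ ρ) := by
  have c' : ∀ j, (getTmp j).cost ≤ 14 := fun j => by simp [NExp.cost, natRef]
  refine (Runs.seq (T := 30) (T' := 60) (h.runs_putVar _ _ (by linarith [c' (d + 3)])
    fun s hs => hs) fun s1 h1 => ?_).mono (by simp) fun _ => id
  refine (Runs.seq (T := 30) (T' := 30) (h1.runs_putVar _ _ (by linarith [c' (d + 4)])
    fun s hs => hs) fun s2 h2 => ?_).mono (by simp) fun _ => id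
  refine h2.runs_putVar _ _ (by linarith [c' (d + 5)]) fun s3 h3 => ?_
  rw [h.eval_getTmp, h1.eval_getTmp, h2.eval_getTmp] at h3
  convert h3 using 1
  funext j
  simp only [bind3, Function.update_apply]
  split_ifs <;> simp_all

end

end RealRAM

/-! ### Correctness and running time of compiled terms -/

namespace RealRAM

theorem bigOp_zero {α : Type*} [CommSemiring α] (o : Bool) (f : ℕ → α) :
    bigOp o 0 f = if o then 1 else 0 := by
  cases o <;> simp [bigOp]

theorem bigOp_succ {α : Type*} [CommSemiring α] (o : Bool) (k : ℕ) (f : ℕ → α) :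
    bigOp o (k + 1) f = if o then bigOp o k f * f k else bigOp o k f + f k := by
  cases o <;> simp [bigOp, Finset.prod_range_succ, Finset.sum_range_succ]

variable {n : ℕ} {M : Mem}

theorem getTmp_cost (d : ℕ) : (getTmp d).cost = 14 := by simp [NExp.cost, natRef]

theorem getVar_cost (d : ℕ) : (getVar d).cost = 14 := by simp [NExp.cost, natRef]

theorem loopTest_cost (d j : ℕ) : (loopTest d j).cost = 29 := by
  simp [loopTest, BExp.cost, getTmp_cost, getVar_cost]

/-- The temporary values form a stack: slots below `d` survive, so an operand in slot `d` is still
there after the next one has been computed from `d + 1` on. Variables changed by loops and bindings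
are saved on this stack and restored, which is why the same `V` appears before and after. -/
theorem NTerm.runs_compile (e : NTerm) : ∀ (d : ℕ) (V τ : ℕ → ℕ) (ρ : ℕ → ℝ) (s : State),
    Rep n M V τ ρ s → Runs (e.compile d) s (e.cost M.cap) fun s' =>
      ∃ τ', Rep n M V τ' ρ s' ∧ (∀ i < d, τ' i = τ i) ∧ τ' d = e.eval M V := by
  have keep : ∀ (d : ℕ) (V τ : ℕ → ℕ) (ρ : ℕ → ℝ) (v : ℕ) (s' : State),
      Rep n M V (Function.update τ d v) ρ s' →
      ∃ τ', Rep n M V τ' ρ s' ∧ (∀ i < d, τ' i = τ i) ∧ τ' d = v := fun d V τ ρ v s' h =>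
    ⟨_, h, fun i hi => Function.update_of_ne hi.ne _ _, Function.update_self _ _ _⟩
  induction e with
  | lit c =>
    intro d V τ ρ s h
    exact h.runs_putTmp d _ (by simp [NExp.cost, cost]) fun s' hs' => keep _ _ _ _ _ _ hs'
  | cap =>
    intro d V τ ρ s h
    refine h.runs_putTmp d _ (by simp [NExp.cost, cost, natRef]) fun s' hs' => ?_
    rw [h.eval_getCap] at hs'
    exact keep _ _ _ _ _ _ hs'
  | var j =>
    intro d V τ ρ s h
    refine h.runs_putTmp d _ (by simp [NExp.cost, cost, natRef]) fun s' hs' => ?_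
    rw [h.eval_getVar] at hs'
    exact keep _ _ _ _ _ _ hs'
  | inp a iha =>
    intro d V τ ρ s h
    refine Runs.seq (iha d V τ ρ s h) ?_
    rintro s1 ⟨τ1, h1, k1, e1⟩
    refine (Runs.ite (T := 30) (fun hc => ?_) (fun hc => ?_)).mono
      (by simp [BExp.cost, NExp.cost, natRef]) fun _ => id
    all_goals
      rw [BExp.eval, h1.eval_getTmp, e1, NExp.eval, NExp.eval, NExp.eval, h1.size] at hc
    · refine h1.runs_putTmp d _ (by simp [NExp.cost]) fun s' hs' => ?_
      obtain ⟨τ', a, b, c⟩ := keep _ _ _ _ _ _ hs'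
      refine ⟨τ', a, fun i hi => (b i hi).trans (k1 i hi), c.trans ?_⟩
      rw [eval, h1.src_zero _ hc]
      rfl
    · refine h1.runs_putTmp d _ (by simp [NExp.cost, natRef]) fun s' hs' => ?_
      obtain ⟨τ', a, b, c⟩ := keep _ _ _ _ _ _ hs'
      refine ⟨τ', a, fun i hi => (b i hi).trans (k1 i hi), c.trans ?_⟩
      rw [eval, NExp.eval, h1.eval_getTmp, e1, h1.src _ (not_lt.1 hc)]
  | tab i a iha =>
    intro d V τ ρ s h
    refine Runs.seq (iha d V τ ρ s h) ?_
    rintro s1 ⟨τ1, h1, k1, e1⟩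
    refine h1.runs_putTmp d _ (by simp [NExp.cost, natRef]) fun s' hs' => ?_
    obtain ⟨τ', a, b, c⟩ := keep _ _ _ _ _ _ hs'
    refine ⟨τ', a, fun i hi => (b i hi).trans (k1 i hi), c.trans ?_⟩
    rw [eval, NExp.eval, h1.eval_natRef, h1.eval_getTmp, e1, h1.tab]
  | op o a b iha ihb =>
    intro d V τ ρ s h
    rw [cost, add_assoc]
    refine Runs.seq (iha d V τ ρ s h) ?_
    rintro s1 ⟨τ1, h1, k1, e1⟩
    refine Runs.seq (ihb (d + 1) V τ1 ρ s1 h1) ?_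
    rintro s2 ⟨τ2, h2, k2, e2⟩
    refine (h2.runs_nop o d).mono le_rfl fun s' hs' => ?_
    rw [e2, k2 d (by omega), e1] at hs'
    obtain ⟨τ', a, b, c⟩ := keep _ _ _ _ _ _ hs'
    exact ⟨τ', a, fun i hi => (b i hi).trans ((k2 i (by omega)).trans (k1 i hi)), c⟩
  | big o j b e ihb ihe =>
    intro d V τ ρ s h
    have hcost : (big o j b e).cost M.cap =
      b.cost M.cap + (200 + (15 + ((M.cap * (e.cost M.cap + 500) + 200) + 85))) := by
      rw [cost]; omega
    rw [hcost]
    refine Runs.seq (ihb (d + 1) V τ ρ s h) ?_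
    rintro s1 ⟨τ1, h1, k1, e1⟩
    refine Runs.seq (h1.runs_loopInit d j) fun s2 h2 => ?_
    refine Runs.seq (h2.runs_putTmp _ _ (by simp [NExp.cost]) fun s h => h) fun s3 h3 => ?_
    set k := min (τ1 (d + 1)) M.cap with hk
    refine Runs.seq (Q := fun s' => ∃ τ', Rep n M (Function.update V j k) τ' ρ s' ∧
      (∀ i < d, τ' i = τ i) ∧ τ' d = (big o j b e).eval M V ∧ τ' (d + 1) = k ∧
      τ' (d + 2) = V j) ?_ ?_
    · refine (Runs.while (k := k) (T := e.cost M.cap + (50 + 100)) (I := fun i s' => ∃ τ',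
        Rep n M (Function.update V j i) τ' ρ s' ∧ (∀ i < d, τ' i = τ i) ∧
        τ' d = bigOp o i (fun i => e.eval M (Function.update V j i)) ∧ τ' (d + 1) = k ∧
        τ' (d + 2) = V j) ?_ ?_ ?_).mono ?_ ?_
      · rintro i hi s ⟨τ', r, q, q0, q1, q2⟩
        refine ⟨by rw [r.eval_loopTest, q1]; simpa using hi, ?_⟩
        refine Runs.seq (ihe (d + 3) _ _ _ _ r) ?_
        rintro s4 ⟨τ4, h4, k4, e4⟩
        refine Runs.seq (h4.runs_putTmp _ _ ?_ fun s h => h) fun s5 h5 => ?_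
        · split_ifs <;> simp [NExp.cost, natRef]
        refine (h5.runs_loopNext j).mono le_rfl fun s6 h6 => ⟨Function.update τ4 d _,
          by simpa only [Function.update_self, Function.update_idem] using h6, ?_, ?_, ?_, ?_⟩
        · intro i hi
          rw [Function.update_of_ne hi.ne, k4 i (by omega), q i hi]
        · rw [Function.update_self, bigOp_succ]
          split_ifs
          all_goals
            rw [NExp.eval, h4.eval_getTmp, h4.eval_getTmp, e4, k4 d (by omega), q0]
        · rw [Function.update_of_ne (by omega), k4 _ (by omega), q1]
        · rw [Function.update_of_ne (by omega), k4 _ (by omega), q2]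
      · rintro s ⟨τ', r, q, q0, q1, q2⟩
        rw [r.eval_loopTest, q1]
        simp
      · refine ⟨_, h3, ?_, ?_, ?_, ?_⟩
        · intro i hi
          rw [Function.update_of_ne hi.ne, Function.update_of_ne (by omega),
            Function.update_of_ne (by omega), k1 i (by omega)]
        · rw [Function.update_self, bigOp_zero, NExp.eval]
        · rw [Function.update_of_ne (by omega), Function.update_of_ne (by omega),
            Function.update_self]
        · rw [Function.update_of_ne (by omega), Function.update_self]
      · rw [loopTest_cost]
        have : k ≤ M.cap := min_le_right _ _
        nlinarith
      · rintro s ⟨τ', r, q, q0, q1, q2⟩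
        refine ⟨τ', r, q, ?_, q1, q2⟩
        rw [q0, hk, e1]
        rfl
    · rintro s4 ⟨τ4, r, q, q0, q1, q2⟩
      refine r.runs_putVar _ _ (by simp [NExp.cost, natRef]) fun s5 h5 => ?_
      rw [r.eval_getTmp, q2] at h5
      exact ⟨τ4, by simpa using h5, q, q0⟩
  | app a b c f iha ihb ihc ihf =>
    intro d V τ ρ s h
    have hcost : (app a b c f).cost M.cap = a.cost M.cap + (b.cost M.cap + (c.cost M.cap +
        (200 + (f.cost M.cap + (100 + 200))))) := by
      rw [cost]; omega
    rw [hcost]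
    refine Runs.seq (iha d V τ ρ s h) ?_
    rintro s1 ⟨τ1, h1, k1, e1⟩
    refine Runs.seq (ihb (d + 1) V τ1 ρ s1 h1) ?_
    rintro s2 ⟨τ2, h2, k2, e2⟩
    refine Runs.seq (ihc (d + 2) V τ2 ρ s2 h2) ?_
    rintro s3 ⟨τ3, h3, k3, e3⟩
    refine Runs.seq (h3.runs_bindProg d) fun s4 h4 => ?_
    refine Runs.seq (ihf (d + 6) _ _ _ _ h4) ?_
    rintro s5 ⟨τ5, h5, k5, e5⟩
    refine Runs.seq (h5.runs_unbindProg d ?_ ?_ ?_) fun s6 h6 => ?_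
    · rw [k5 _ (by omega)]; simp
    · rw [k5 _ (by omega)]; simp
    · rw [k5 _ (by omega)]; simp
    refine h6.runs_putTmp _ _ (by simp [NExp.cost, natRef]) fun s7 h7 => ?_
    rw [h6.eval_getTmp] at h7
    refine ⟨_, h7, fun i hi => ?_, ?_⟩
    · rw [Function.update_of_ne hi.ne, k5 i (by omega), Function.update_of_ne (by omega),
        Function.update_of_ne (by omega), Function.update_of_ne (by omega), k3 i (by omega),
        k2 i (by omega), k1 i hi]
    · rw [Function.update_self, e5, e3, k3 (d + 1) (by omega), e2, k3 d (by omega),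
        k2 d (by omega), e1]
      rfl

theorem RTerm.runs_compile (e : RTerm) : ∀ (d : ℕ) (V τ : ℕ → ℕ) (ρ : ℕ → ℝ) (s : State),
    Rep n M V τ ρ s → Runs (e.compile d) s (e.cost M.cap) fun s' =>
      ∃ τ' ρ', Rep n M V τ' ρ' s' ∧ (∀ i < d, τ' i = τ i) ∧ (∀ i < d, ρ' i = ρ i) ∧
        ρ' d = e.eval M V := by
  have keep : ∀ (d : ℕ) (V τ τ' : ℕ → ℕ) (ρ ρ' : ℕ → ℝ) (v : ℝ) (s' : State),
      (∀ i < d, τ' i = τ i) → (∀ i < d, ρ' i = ρ i) →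
      Rep n M V τ' (Function.update ρ' d v) s' →
      ∃ τ' ρ', Rep n M V τ' ρ' s' ∧ (∀ i < d, τ' i = τ i) ∧ (∀ i < d, ρ' i = ρ i) ∧ ρ' d = v :=
    fun d V τ τ' ρ ρ' v s' h₁ h₂ h => ⟨_, _, h, h₁,
      fun i hi => (Function.update_of_ne hi.ne _ _).trans (h₂ i hi), Function.update_self _ _ _⟩
  induction e with
  | arg =>
    intro d V τ ρ s h
    refine h.runs_putRTmp d _ (by simp [RExp.cost, NExp.cost, cost]) fun s' hs' => ?_
    rw [RExp.eval, NExp.eval, h.arg] at hs'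
    exact keep _ _ _ _ _ _ _ _ (fun _ _ => rfl) (fun _ _ => rfl) hs'
  | ofNat a =>
    intro d V τ ρ s h
    refine Runs.seq (a.runs_compile d V τ ρ s h) ?_
    rintro s1 ⟨τ1, h1, k1, e1⟩
    refine h1.runs_putRTmp d _ (by simp [RExp.cost, NExp.cost, natRef]) fun s' hs' => ?_
    rw [RExp.eval, h1.eval_getTmp, e1] at hs'
    exact keep _ _ _ _ _ _ _ _ k1 (fun _ _ => rfl) hs'
  | tab i a =>
    intro d V τ ρ s h
    refine Runs.seq (a.runs_compile d V τ ρ s h) ?_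
    rintro s1 ⟨τ1, h1, k1, e1⟩
    refine h1.runs_putRTmp d _ (by simp [RExp.cost, NExp.cost, natRef, realRef]) fun s' hs' => ?_
    rw [RExp.eval, eval_realRef, h1.eval_getTmp, e1, h1.rtab] at hs'
    exact keep _ _ _ _ _ _ _ _ k1 (fun _ _ => rfl) hs'
  | op o a b iha ihb =>
    intro d V τ ρ s h
    rw [cost, add_assoc]
    refine Runs.seq (iha d V τ ρ s h) ?_
    rintro s1 ⟨τ1, ρ1, h1, k1, l1, e1⟩
    refine Runs.seq (ihb (d + 1) V τ1 ρ1 s1 h1) ?_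
    rintro s2 ⟨τ2, ρ2, h2, k2, l2, e2⟩
    refine h2.runs_putRTmp d _ ?_ fun s' hs' => ?_
    · cases o <;> simp [ROp.toRExp, RExp.cost, NExp.cost, realRef]
    have : (o.toRExp (getRTmp d) (getRTmp (d + 1))).eval s2 = (op o a b).eval M V := by
      rw [eval, ← e2, ← e1, ← l2 d (by omega)]
      cases o <;> simp only [ROp.toRExp, ROp.eval, RExp.eval] <;>
        rw [← h2.eval_getRTmp, ← h2.eval_getRTmp] <;> rfl
    rw [this] at hs'
    exact keep _ _ _ _ _ _ _ _ (fun i hi => (k2 i (by omega)).trans (k1 i hi))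
      (fun i hi => (l2 i (by omega)).trans (l1 i hi)) hs'
  | exp a iha =>
    intro d V τ ρ s h
    refine Runs.seq (iha d V τ ρ s h) ?_
    rintro s1 ⟨τ1, ρ1, h1, k1, l1, e1⟩
    refine h1.runs_putRTmp d _ (by simp [RExp.cost, NExp.cost, realRef]) fun s' hs' => ?_
    rw [RExp.eval, h1.eval_getRTmp, e1] at hs'
    exact keep _ _ _ _ _ _ _ _ k1 l1 hs'
  | big o j b e ihe =>
    intro d V τ ρ s h
    have hcost : (big o j b e).cost M.cap =
      b.cost M.cap + (200 + (16 + ((M.cap * (e.cost M.cap + 500) + 200) + 84))) := by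
      rw [cost]; omega
    rw [hcost]
    refine Runs.seq (b.runs_compile (d + 1) V τ ρ s h) ?_
    rintro s1 ⟨τ1, h1, k1, e1⟩
    refine Runs.seq (h1.runs_loopInit d j) fun s2 h2 => ?_
    refine Runs.seq (h2.runs_putRTmp _ _ (by simp [RExp.cost, NExp.cost]) fun s h => h)
      fun s3 h3 => ?_
    set k := min (τ1 (d + 1)) M.cap with hk
    refine Runs.seq (Q := fun s' => ∃ τ' ρ', Rep n M (Function.update V j k) τ' ρ' s' ∧
      (∀ i < d, τ' i = τ i) ∧ (∀ i < d, ρ' i = ρ i) ∧ ρ' d = (big o j b e).eval M V ∧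
      τ' (d + 2) = V j) ?_ ?_
    · refine (Runs.while (k := k) (T := e.cost M.cap + (50 + 100)) (I := fun i s' => ∃ τ' ρ',
        Rep n M (Function.update V j i) τ' ρ' s' ∧ (∀ i < d, τ' i = τ i) ∧
        (∀ i < d, ρ' i = ρ i) ∧
        ρ' d = bigOp o i (fun i => e.eval M (Function.update V j i)) ∧ τ' (d + 1) = k ∧
        τ' (d + 2) = V j) ?_ ?_ ?_).mono ?_ ?_
      · rintro i hi s ⟨τ', ρ', r, q, p, q0, q1, q2⟩
        refine ⟨by rw [r.eval_loopTest, q1]; simpa using hi, ?_⟩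
        refine Runs.seq (ihe (d + 3) _ _ _ _ r) ?_
        rintro s4 ⟨τ4, ρ4, h4, k4, l4, e4⟩
        refine Runs.seq (h4.runs_putRTmp _ _ ?_ fun s h => h) fun s5 h5 => ?_
        · split_ifs <;> simp [RExp.cost, NExp.cost, realRef]
        refine (h5.runs_loopNext j).mono le_rfl fun s6 h6 => ⟨τ4, Function.update ρ4 d
          _, by simpa only [Function.update_self, Function.update_idem] using h6,
          ?_, ?_, ?_, ?_, ?_⟩
        · intro i hi
          rw [k4 i (by omega), q i hi]
        · intro i hi
          rw [Function.update_of_ne hi.ne, l4 i (by omega), p i hi]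
        · rw [Function.update_self, bigOp_succ]
          split_ifs
          all_goals
            rw [RExp.eval, h4.eval_getRTmp, h4.eval_getRTmp, e4, l4 d (by omega), q0]
        · rw [k4 _ (by omega), q1]
        · rw [k4 _ (by omega), q2]
      · rintro s ⟨τ', ρ', r, q, p, q0, q1, q2⟩
        rw [r.eval_loopTest, q1]
        simp
      · refine ⟨_, _, h3, ?_, ?_, ?_, ?_, ?_⟩
        · intro i hi
          rw [Function.update_of_ne (by omega), Function.update_of_ne (by omega), k1 i (by omega)]
        · exact fun i hi => Function.update_of_ne hi.ne _ _
        · rw [Function.update_self, bigOp_zero, RExp.eval, NExp.eval]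
          split_ifs <;> simp
        · rw [Function.update_of_ne (by omega), Function.update_self]
        · rw [Function.update_self]
      · rw [loopTest_cost]
        have : k ≤ M.cap := min_le_right _ _
        nlinarith
      · rintro s ⟨τ', ρ', r, q, p, q0, q1, q2⟩
        refine ⟨τ', ρ', r, q, p, ?_, q2⟩
        rw [q0, hk, e1]
        rfl
    · rintro s4 ⟨τ4, ρ4, r, q, p, q0, q2⟩
      refine r.runs_putVar _ _ (by simp [NExp.cost, natRef]) fun s5 h5 => ?_
      rw [r.eval_getTmp, q2] at h5
      exact ⟨τ4, ρ4, by simpa using h5, q, p, q0⟩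
  | app a b c f ihf =>
    intro d V τ ρ s h
    have hcost : (app a b c f).cost M.cap = a.cost M.cap + (b.cost M.cap + (c.cost M.cap +
        (200 + (f.cost M.cap + (100 + 200))))) := by
      rw [cost]; omega
    rw [hcost]
    refine Runs.seq (a.runs_compile d V τ ρ s h) ?_
    rintro s1 ⟨τ1, h1, k1, e1⟩
    refine Runs.seq (b.runs_compile (d + 1) V τ1 ρ s1 h1) ?_
    rintro s2 ⟨τ2, h2, k2, e2⟩
    refine Runs.seq (c.runs_compile (d + 2) V τ2 ρ s2 h2) ?_
    rintro s3 ⟨τ3, h3, k3, e3⟩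
    refine Runs.seq (h3.runs_bindProg d) fun s4 h4 => ?_
    refine Runs.seq (ihf (d + 6) _ _ _ _ h4) ?_
    rintro s5 ⟨τ5, ρ5, h5, k5, l5, e5⟩
    refine Runs.seq (h5.runs_unbindProg d ?_ ?_ ?_) fun s6 h6 => ?_
    · rw [k5 _ (by omega)]; simp
    · rw [k5 _ (by omega)]; simp
    · rw [k5 _ (by omega)]; simp
    refine h6.runs_putRTmp _ _ (by simp [RExp.cost, NExp.cost, realRef]) fun s7 h7 => ?_
    rw [h6.eval_getRTmp, e5, e3, k3 (d + 1) (by omega), e2, k3 d (by omega),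
        k2 d (by omega), e1] at h7
    refine keep _ _ _ _ _ _ _ _ (fun i hi => ?_) (fun i hi => l5 i (by omega)) h7
    rw [k5 i (by omega), Function.update_of_ne (by omega),
        Function.update_of_ne (by omega), Function.update_of_ne (by omega), k3 i (by omega),
        k2 i (by omega), k1 i hi]

/-! ### Commands -/

/-- Straight-line commands: assignments to variables, and filling the entries of a table with
indices below the cap, where variable `0` is the index. -/
inductive Cmd where
  | setVar (j : ℕ) (e : NTerm)
  | fillNat (i : Fin 16) (e : NTerm)
  | fillReal (i : Fin 16) (e : RTerm)
  | seq (c d : Cmd)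

/-- The memory after filling the first entries of a natural table. -/
def Mem.fillNat (M : Mem) (V : ℕ → ℕ) (i : Fin 16) (e : NTerm) : ℕ → Mem
  | 0 => M
  | k + 1 => { M.fillNat V i e k with
      nat := Function.update (M.fillNat V i e k).nat i
        (Function.update ((M.fillNat V i e k).nat i) k
          (e.eval (M.fillNat V i e k) (Function.update V 0 k))) }

/-- The memory after filling the first entries of a real table. -/
noncomputable def Mem.fillReal (M : Mem) (V : ℕ → ℕ) (i : Fin 16) (e : RTerm) : ℕ → Mem
  | 0 => M
  | k + 1 => { M.fillReal V i e k with
      real := Function.update (M.fillReal V i e k).real i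
        (Function.update ((M.fillReal V i e k).real i) k
          (e.eval (M.fillReal V i e k) (Function.update V 0 k))) }

noncomputable def Cmd.run : Cmd → Mem × (ℕ → ℕ) → Mem × (ℕ → ℕ)
  | setVar j e, p => (p.1, Function.update p.2 j (e.eval p.1 p.2))
  | fillNat i e, p => (p.1.fillNat p.2 i e p.1.cap, p.2)
  | fillReal i e, p => (p.1.fillReal p.2 i e p.1.cap, p.2)
  | seq c d, p => d.run (c.run p)

def fillLoop (P : Program) : Program :=
  .seq (putTmp 0 (getVar 0)) (.seq (putVar 0 (.lit 0)) (.seq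
    (.while (.natLt (getVar 0) getCap) (.seq P (loopNext 0))) (putVar 0 (getTmp 0))))

def Cmd.compile : Cmd → Program
  | setVar j e => .seq (e.compile 0) (putVar j (getTmp 0))
  | fillNat i e => fillLoop (.seq (e.compile 1) (.setNat (natRef (3 + i) (getVar 0)) (getTmp 1)))
  | fillReal i e =>
    fillLoop (.seq (e.compile 1) (.setReal (realRef (1 + i) (getVar 0)) (getRTmp 1)))
  | seq c d => .seq c.compile d.compile

def Cmd.cost : Cmd → ℕ → ℕ
  | setVar _ e, l => e.cost l + 100
  | fillNat _ e, l => l * (e.cost l + 500) + 500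
  | fillReal _ e, l => l * (e.cost l + 500) + 500
  | seq c d, l => c.cost l + d.cost l

theorem Mem.fillNat_cap (V : ℕ → ℕ) (i : Fin 16) (e : NTerm) (k : ℕ) :
    (M.fillNat V i e k).cap = M.cap := by
  induction k <;> simp_all [fillNat]

theorem Mem.fillReal_cap (V : ℕ → ℕ) (i : Fin 16) (e : RTerm) (k : ℕ) :
    (M.fillReal V i e k).cap = M.cap := by
  induction k <;> simp_all [fillReal]

theorem Cmd.run_cap (c : Cmd) (p : Mem × (ℕ → ℕ)) : (c.run p).1.cap = p.1.cap := by
  induction c generalizing p <;> simp_all [run, Mem.fillNat_cap, Mem.fillReal_cap]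

/-- `F k` is the memory after `k` entries. Variable `0` is saved in temporary slot `0`, which the
body keeps because its terms are compiled from slot `1` on. -/
theorem runs_fillLoop {P : Program} {V τ : ℕ → ℕ} {ρ : ℕ → ℝ} {s : State} {T : ℕ}
    (F : ℕ → Mem) (hF : F 0 = M) (hcap : ∀ k, (F k).cap = M.cap)
    (hP : ∀ k τ ρ s, Rep n (F k) (Function.update V 0 k) τ ρ s → Runs P s T fun s' =>
      ∃ τ' ρ', Rep n (F (k + 1)) (Function.update V 0 k) τ' ρ' s' ∧ τ' 0 = τ 0)
    (h : Rep n M V τ ρ s) :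
    Runs (fillLoop P) s (M.cap * (T + 400) + 500) fun s' =>
      ∃ τ' ρ', Rep n (F M.cap) V τ' ρ' s' := by
  have hcost : M.cap * (T + 400) + 500 = 100 + (100 + ((M.cap * (T + 400) + 100) + 200)) := by
    omega
  rw [hcost]
  refine Runs.seq (h.runs_putTmp _ _ (by simp [NExp.cost, natRef]) fun s h => h) fun s1 h1 => ?_
  rw [h.eval_getVar] at h1
  refine Runs.seq (h1.runs_putVar _ _ (by simp [NExp.cost]) fun s h => h) fun s2 h2 => ?_
  have hc : BExp.cost (.natLt (getVar 0) getCap) ≤ 50 := by simp [BExp.cost, NExp.cost, natRef]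
  refine Runs.seq (Q := fun s' => ∃ τ' ρ', Rep n (F M.cap) (Function.update V 0 M.cap) τ' ρ' s' ∧
    τ' 0 = V 0) ?_ ?_
  · refine (Runs.while (k := M.cap) (T := T + 100) (I := fun i s' => ∃ τ' ρ',
      Rep n (F i) (Function.update V 0 i) τ' ρ' s' ∧ τ' 0 = V 0) ?_ ?_ ?_).mono ?_ fun _ => id
    · rintro i hi s ⟨τ', ρ', r, q⟩
      refine ⟨?_, ?_⟩
      · rw [BExp.eval, r.eval_getVar, r.eval_getCap, hcap]
        simpa using hi
      refine Runs.seq (hP i _ _ _ r) ?_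
      rintro s3 ⟨τ3, ρ3, r3, q3⟩
      refine (r3.runs_loopNext 0).mono le_rfl fun s4 h4 => ⟨τ3, ρ3, ?_, q3.trans q⟩
      simpa using h4
    · rintro s ⟨τ', ρ', r, q⟩
      rw [BExp.eval, r.eval_getVar, r.eval_getCap, hcap]
      simp
    · exact ⟨_, _, by simpa [NExp.eval, hF] using h2, by simp⟩
    · gcongr ?_ * ?_ + ?_ <;> omega
  · rintro s3 ⟨τ3, ρ3, r, q⟩
    refine r.runs_putVar _ _ (by simp [NExp.cost, natRef]) fun s4 h4 => ?_
    rw [r.eval_getTmp, q] at h4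
    exact ⟨τ3, ρ3, by simpa using h4⟩

theorem Cmd.runs_compile (c : Cmd) : ∀ (M : Mem) (V τ : ℕ → ℕ) (ρ : ℕ → ℝ) (s : State),
    Rep n M V τ ρ s → Runs c.compile s (c.cost M.cap) fun s' =>
      ∃ τ' ρ', Rep n (c.run (M, V)).1 (c.run (M, V)).2 τ' ρ' s' := by
  induction c with
  | setVar j e =>
    intro M V τ ρ s h
    refine Runs.seq (e.runs_compile 0 V τ ρ s h) ?_
    rintro s1 ⟨τ1, h1, -, e1⟩
    refine h1.runs_putVar _ _ (by simp [NExp.cost, natRef]) fun s2 h2 => ⟨τ1, ρ, ?_⟩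
    rw [h1.eval_getTmp, e1] at h2
    exact h2
  | fillNat i e =>
    intro M V τ ρ s h
    refine (runs_fillLoop (T := e.cost M.cap + 100) (fun k => M.fillNat V i e k) rfl
      (Mem.fillNat_cap V i e) ?_ h).mono le_rfl fun _ => id
    intro k τ ρ s r
    refine Runs.seq ((e.runs_compile 1 _ τ ρ s r).mono (by rw [Mem.fillNat_cap]) fun _ => id) ?_
    rintro s1 ⟨τ1, h1, k1, e1⟩
    refine (Runs.setNat ?_).mono (by simp [NExp.cost, natRef]) fun _ => id
    rw [h1.eval_natRef, h1.eval_getVar, h1.eval_getTmp, e1, Function.update_self]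
    exact ⟨τ1, ρ, h1.setTab i k _, k1 0 (by omega)⟩
  | fillReal i e =>
    intro M V τ ρ s h
    refine (runs_fillLoop (T := e.cost M.cap + 100) (fun k => M.fillReal V i e k) rfl
      (Mem.fillReal_cap V i e) ?_ h).mono le_rfl fun _ => id
    intro k τ ρ s r
    refine Runs.seq ((e.runs_compile 1 _ τ ρ s r).mono (by rw [Mem.fillReal_cap]) fun _ => id) ?_
    rintro s1 ⟨τ1, ρ1, h1, k1, l1, e1⟩
    refine (Runs.setReal ?_).mono (by simp [RExp.cost, NExp.cost, natRef, realRef]) fun _ => id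
    rw [eval_realRef, h1.eval_getVar, h1.eval_getRTmp, e1, Function.update_self]
    exact ⟨τ1, ρ1, h1.setRTab i k _, k1 0 (by omega)⟩
  | seq c d ihc ihd =>
    intro M V τ ρ s h
    rw [cost]
    refine Runs.seq (ihc M V τ ρ s h) ?_
    rintro s1 ⟨τ1, ρ1, h1⟩
    have := ihd _ _ _ _ _ h1
    rw [run_cap] at this
    exact this

end RealRAM

/-! ## Sums over assignments with pairwise factors -/

namespace PairwiseSum

open Finset

variable {V : Type*} [Fintype V] [DecidableEq V]

/-- The product of the pair factors `f u v (a u) (a v)` over all ordered pairs that meet `C`. -/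
def pairProd (f : V → V → ℕ → ℕ → ℝ) (C : Finset V) (a : V → ℕ) : ℝ :=
  ∏ u, ∏ v, if u ∈ C ∨ v ∈ C then f u v (a u) (a v) else 1

/-- The assignments with values below `A` on `C` that agree with `β` outside `C`. -/
def assignments (A : ℕ) (C : Finset V) (β : V → ℕ) : Finset (V → ℕ) :=
  Fintype.piFinset fun v => if v ∈ C then range A else {β v}

/-- The sum over the assignments on `C` of the products of the weights and the pair factors that
involve `C`. -/
def partSum (A : ℕ) (wt : ℕ → ℝ) (f : V → V → ℕ → ℕ → ℝ) (C : Finset V) (β : V → ℕ) : ℝ :=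
  ∑ a ∈ assignments A C β, (∏ v ∈ C, wt (a v)) * pairProd f C a

variable {A : ℕ} {wt : ℕ → ℝ} {f : V → V → ℕ → ℕ → ℝ}

theorem mem_assignments {C : Finset V} {β a : V → ℕ} :
    a ∈ assignments A C β ↔ (∀ v ∈ C, a v < A) ∧ ∀ v ∉ C, a v = β v := by
  simp only [assignments, Fintype.mem_piFinset]
  constructor
  · intro h
    exact ⟨fun v hv => by simpa [hv] using h v, fun v hv => by simpa [hv] using h v⟩
  · rintro ⟨h, h'⟩ v
    split_ifs with hv
    · simpa using h v hv
    · simpa using h' v hv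

theorem partSum_empty (β : V → ℕ) : partSum A wt f ∅ β = 1 := by
  have : assignments A (∅ : Finset V) β = {β} := by
    ext a
    simp [mem_assignments, funext_iff]
  simp [partSum, this, pairProd]

/-- The new pairs are those of `v` with a vertex outside `C`, in both orders. The pair `(v, v)` is
counted twice on the right, which is harmless because its factor is one. -/
theorem pairProd_insert (hf : ∀ u x y, f u u x y = 1) {C : Finset V} {v : V} (hv : v ∉ C)
    (a : V → ℕ) :
    pairProd f (insert v C) a =
      (∏ u, if u ∉ C then f u v (a u) (a v) * f v u (a v) (a u) else 1) * pairProd f C a := by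
  -- The single product is spread over the row and the column of `v` in a double product, so that
  -- both sides can be compared pair by pair.
  have h1 : (∏ u, if u ∉ C then f u v (a u) (a v) * f v u (a v) (a u) else 1) =
      ∏ u, ∏ w, (if w = v then (if u ∉ C then f u v (a u) (a v) else 1) else 1) *
        (if u = v then (if w ∉ C then f v w (a v) (a w) else 1) else 1) := by
    simp only [prod_mul_distrib, prod_ite_eq', mem_univ, if_true]
    rw [prod_comm (f := fun u w => if u = v then (if w ∉ C then f v w (a v) (a w) else 1) else 1)]
    simp only [prod_ite_eq', mem_univ, if_true]
    rw [← prod_mul_distrib]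
    refine prod_congr rfl fun u _ => ?_
    split_ifs <;> simp
  rw [h1, pairProd, pairProd]
  simp only [← prod_mul_distrib]
  refine prod_congr rfl fun u _ => prod_congr rfl fun w _ => ?_
  by_cases hu : u = v <;> by_cases hw : w = v <;> by_cases hu' : u ∈ C <;> by_cases hw' : w ∈ C <;>
    simp_all

/-- The elimination step of the dynamic program: assignments are sorted by their value at `v`. Then
`v` belongs to the boundary of `C`, and only its pairs with vertices outside `C` have to be
accounted for. -/
theorem partSum_insert (hf : ∀ u x y, f u u x y = 1) {C : Finset V} {v : V} (hv : v ∉ C)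
    (β : V → ℕ) :
    partSum A wt f (insert v C) β = ∑ x ∈ range A, wt x *
      (∏ u, if u ∉ insert v C then f u v (β u) x * f v u x (β u) else 1) *
        partSum A wt f C (Function.update β v x) := by
  rw [partSum, ← sum_fiberwise_of_maps_to (g := fun a => a v) (t := range A)
    (fun a ha => by simpa using (mem_assignments.1 ha).1 v (mem_insert_self _ _))]
  refine sum_congr rfl fun x hx => ?_
  have hset : (assignments A (insert v C) β).filter (fun a => a v = x) =
      assignments A C (Function.update β v x) := by
    ext a
    simp only [mem_filter, mem_assignments, mem_insert]
    constructor
    · rintro ⟨⟨h1, h2⟩, h3⟩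
      refine ⟨fun u hu => h1 u (.inr hu), fun u hu => ?_⟩
      by_cases huv : u = v
      · subst huv; simpa using h3
      · rw [Function.update_of_ne huv]
        exact h2 u (by tauto)
    · rintro ⟨h1, h2⟩
      have h3 : a v = x := by simpa using h2 v hv
      refine ⟨⟨?_, fun u hu => ?_⟩, h3⟩
      · rintro u (rfl | hu)
        · rw [h3]; exact mem_range.1 hx
        · exact h1 u hu
      · rw [h2 u (by tauto), Function.update_of_ne (by tauto)]
  rw [hset, partSum, mul_sum]
  refine sum_congr rfl fun a ha => ?_
  obtain ⟨ha1, ha2⟩ := mem_assignments.1 ha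
  have hav : a v = x := by simpa using ha2 v hv
  rw [prod_insert hv, pairProd_insert hf hv, hav]
  have : (∏ u, if u ∉ C then f u v (a u) x * f v u x (a u) else 1) =
      ∏ u, if u ∉ insert v C then f u v (β u) x * f v u x (β u) else 1 := by
    refine prod_congr rfl fun u _ => ?_
    by_cases huv : u = v
    · subst huv; simp [hv, hf]
    · by_cases hu : u ∈ C
      · simp [hu]
      · rw [ha2 u hu, Function.update_of_ne huv]
        simp [hu, huv]
  rw [this]
  ring

variable {H : SimpleGraph V}

/-- A factor different from one joins adjacent vertices, so boundary values matter only at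
neighbours of `C`. This is why the values on a separator are a sufficient state. -/
theorem partSum_congr (hf : ∀ u v, ¬ H.Adj u v → ∀ x y, f u v x y = 1) {C : Finset V}
    {β β' : V → ℕ} (h : ∀ u ∉ C, (∃ v ∈ C, H.Adj u v) → β u = β' u) :
    partSum A wt f C β = partSum A wt f C β' := by
  have key : ∀ β β' : V → ℕ, ∀ a ∈ assignments A C β,
      (fun v => if v ∈ C then a v else β' v) ∈ assignments A C β' := by
    intro β β' a ha
    rw [mem_assignments] at ha ⊢
    exact ⟨fun v hv => by simpa [hv] using ha.1 v hv, fun v hv => by simp [hv]⟩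
  have inv : ∀ β β' : V → ℕ, ∀ a ∈ assignments A C β,
      (fun v => if v ∈ C then (if v ∈ C then a v else β' v) else β v) = a := by
    intro β β' a ha
    funext v
    by_cases hv : v ∈ C
    · simp [hv]
    · simp [hv, (mem_assignments.1 ha).2 v hv]
  refine sum_nbij' (fun a v => if v ∈ C then a v else β' v) (fun a v => if v ∈ C then a v else β v)
    (key β β') (key β' β) (inv β β') (inv β' β) ?_
  intro a ha
  congr 1
  · exact prod_congr rfl fun v hv => by simp [hv]
  · refine prod_congr rfl fun u _ => prod_congr rfl fun v _ => ?_
    have ha2 := (mem_assignments.1 ha).2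
    by_cases hu : u ∈ C <;> by_cases hv : v ∈ C <;> simp only [hu, hv, or_true, true_or, or_self,
      if_true, if_false]
    · by_cases e : H.Adj u v
      · rw [ha2 v hv, h v hv ⟨u, hu, e.symm⟩]
      · rw [hf u v e, hf u v e]
    · by_cases e : H.Adj u v
      · rw [ha2 u hu, h u hu ⟨v, hv, e⟩]
      · rw [hf u v e, hf u v e]

/-- No factor joins `C` to `D`, so the vertices of `C` can be eliminated one by one while the sum
over `D` stays the same. -/
theorem partSum_union (hf : ∀ u v, ¬ H.Adj u v → ∀ x y, f u v x y = 1) {C D : Finset V}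
    (hCD : Disjoint C D) (hadj : ∀ u ∈ C, ∀ v ∈ D, ¬ H.Adj u v) (β : V → ℕ) :
    partSum A wt f (C ∪ D) β = partSum A wt f C β * partSum A wt f D β := by
  have hf0 : ∀ u x y, f u u x y = 1 := fun u => hf u u (SimpleGraph.irrefl _)
  induction C using Finset.induction_on generalizing β with
  | empty => simp [partSum_empty]
  | insert v C hv ih =>
    have hvD : v ∉ D := disjoint_left.1 hCD (mem_insert_self _ _)
    have hCD' : Disjoint C D := hCD.mono_left (subset_insert _ _)
    rw [insert_union, partSum_insert hf0 (by simp [hv, hvD]), partSum_insert hf0 hv, sum_mul]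
    refine sum_congr rfl fun x _ => ?_
    rw [ih hCD' fun u hu => hadj u (mem_insert_of_mem hu)]
    have h1 : partSum A wt f D (Function.update β v x) = partSum A wt f D β := by
      refine partSum_congr hf fun u _ hu => ?_
      obtain ⟨w, hw, huw⟩ := hu
      rw [Function.update_of_ne]
      rintro rfl
      exact hadj u (mem_insert_self _ _) w hw huw
    have h2 : (∏ u, if u ∉ insert v (C ∪ D) then f u v (β u) x * f v u x (β u) else 1) =
        ∏ u, if u ∉ insert v C then f u v (β u) x * f v u x (β u) else 1 := by
      refine prod_congr rfl fun u _ => ?_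
      by_cases hu : u ∈ D
      · have := hadj v (mem_insert_self _ _) u hu
        rw [hf _ _ this, hf _ _ fun h => this h.symm]
        simp
      · simp [hu]
    rw [h1, h2]
    ring

theorem partSum_biUnion (hf : ∀ u v, ¬ H.Adj u v → ∀ x y, f u v x y = 1) {ι : Type*}
    [DecidableEq ι] (I : Finset ι) (D : ι → Finset V)
    (hD : ∀ i ∈ I, ∀ j ∈ I, i ≠ j → Disjoint (D i) (D j) ∧ ∀ u ∈ D i, ∀ v ∈ D j, ¬ H.Adj u v)
    (β : V → ℕ) : partSum A wt f (I.biUnion D) β = ∏ i ∈ I, partSum A wt f (D i) β := by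
  induction I using Finset.induction_on with
  | empty => simp [partSum_empty]
  | insert i I hi ih =>
    have h : ∀ j ∈ I, Disjoint (D i) (D j) ∧ ∀ u ∈ D i, ∀ v ∈ D j, ¬ H.Adj u v := fun j hj =>
      hD i (mem_insert_self _ _) j (mem_insert_of_mem hj) (by rintro rfl; exact hi hj)
    rw [biUnion_insert, partSum_union hf, prod_insert hi, ih]
    · exact fun i hi j hj => hD i (mem_insert_of_mem hi) j (mem_insert_of_mem hj)
    · rw [disjoint_biUnion_right]
      exact fun j hj => (h j hj).1
    · intro u hu v hv
      obtain ⟨j, hj, hv⟩ := mem_biUnion.1 hv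
      exact (h j hj).2 u hu v hv

/-! ### Components of the complement of a set of vertices -/

/-- The subgraph of the edges with both ends outside `S`. -/
def avoid (H : SimpleGraph V) (S : Finset V) : SimpleGraph V where
  Adj u v := H.Adj u v ∧ u ∉ S ∧ v ∉ S
  symm := ⟨fun _ _ h => ⟨h.1.symm, h.2.2, h.2.1⟩⟩
  loopless := ⟨fun _ h => H.irrefl h.1⟩

open Classical in
/-- The component of `c` in the complement of `S`, which is empty if `c ∈ S`. -/
noncomputable def component (H : SimpleGraph V) (S : Finset V) (c : V) : Finset V :=
  univ.filter fun v => c ∉ S ∧ (avoid H S).Reachable c v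

variable {S : Finset V} {c c' u v : V}

theorem mem_component : v ∈ component H S c ↔ c ∉ S ∧ (avoid H S).Reachable c v := by
  simp [component]

theorem mem_component_self (hc : c ∉ S) : c ∈ component H S c :=
  mem_component.2 ⟨hc, .refl _⟩

theorem notMem_of_mem_component (h : v ∈ component H S c) : v ∉ S := by
  obtain ⟨hc, ⟨p⟩⟩ := mem_component.1 h
  induction p with
  | nil => exact hc
  | cons e _ ih => exact ih (mem_component.2 ⟨e.2.2, ⟨‹_›⟩⟩) e.2.2

theorem component_eq (h : v ∈ component H S c) : component H S v = component H S c := by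
  ext w
  rw [mem_component, mem_component]
  have := (mem_component.1 h)
  exact ⟨fun hw => ⟨this.1, this.2.trans hw.2⟩,
    fun hw => ⟨notMem_of_mem_component h, this.2.symm.trans hw.2⟩⟩

theorem mem_component_of_adj (hu : u ∈ component H S c) (huv : H.Adj u v) (hv : v ∉ S) :
    v ∈ component H S c :=
  mem_component.2 ⟨(mem_component.1 hu).1, (mem_component.1 hu).2.trans
    (SimpleGraph.Adj.reachable (G := avoid H S) ⟨huv, notMem_of_mem_component hu, hv⟩)⟩

theorem component_subset_of_closed {D : Finset V} (hc : c ∈ D)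
    (hD : ∀ u ∈ D, ∀ v, H.Adj u v → v ∉ S → v ∈ D) : component H S c ⊆ D := by
  intro v hv
  obtain ⟨-, ⟨p⟩⟩ := mem_component.1 hv
  clear hv
  induction p with
  | nil => exact hc
  | cons e _ ih => exact ih (hD _ hc _ e.1 e.2.2)

end PairwiseSum

namespace PairwiseSum

open Finset

/-! ### Dynamic programming over separators -/

section
variable {n A w : ℕ}

/-- A partial assignment, given by `w` pairs of a vertex and a value. If a vertex occurs repeatedly,
then its first occurrence counts. -/
abbrev Key (n A w : ℕ) := Fin w → Fin n × Fin A

variable (H : SimpleGraph (Fin n)) (wt : ℕ → ℝ) (f : Fin n → Fin n → ℕ → ℕ → ℝ)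

def keySet (κ : Key n A w) : Finset (Fin n) := univ.image fun i => (κ i).1

def IsFirst (κ : Key n A w) (u : Fin n) (i : Fin w) : Prop := (κ i).1 = u ∧ ∀ j < i, (κ j).1 ≠ u

open Classical in
/-- The value that `κ` assigns to `u`. -/
noncomputable def keyVal (κ : Key n A w) (u : Fin n) : ℕ :=
  ∑ i, if IsFirst κ u i then ((κ i).2 : ℕ) else 0

noncomputable abbrev keyComponent (κ : Key n A w) (c : Fin n) : Finset (Fin n) :=
  component H (keySet κ) c

def IsLeast (S : Finset (Fin n)) (c : Fin n) : Prop := ∀ v < c, v ∉ component H S c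

/-- Slot `i` of `κ` may be overwritten by the vertex `v` of the component of `c`, and `R` holds for
all resulting components. -/
def Usable (R : Key n A w → Fin n → Prop) (κ : Key n A w) (c : Fin n) (i : Fin w) (v : Fin n) :
    Prop :=
  v ∈ keyComponent H κ c ∧
    (∀ u, IsFirst κ u i → ∀ v' ∈ keyComponent H κ c, ¬ H.Adj u v') ∧
    ∀ c' ∈ keyComponent H κ c, c' ≠ v → ∀ x, R (Function.update κ i (v, x)) c'

/-- The component of `c` can be eliminated in `r` rounds. -/
def Feasible : ℕ → Key n A w → Fin n → Prop
  | 0, _, _ => False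
  | r + 1, κ, c => ∃ i v, Usable H (Feasible r) κ c i v

open Classical in
/-- The contribution of the component of `c` if slot `i` is overwritten by `v`, where `g` gives the
contributions of the smaller components. -/
noncomputable def stepVal (g : Key n A w → Fin n → ℝ) (κ : Key n A w) (c : Fin n) (i : Fin w)
    (v : Fin n) : ℝ :=
  ∑ x : Fin A, wt x *
    (∏ u, if u ∈ keySet κ then f u v (keyVal κ u) x * f v u x (keyVal κ u) else 1) *
    ∏ c', if c' ∈ keyComponent H κ c ∧ c' ≠ v ∧
      IsLeast H (keySet (Function.update κ i (v, x))) c' then g (Function.update κ i (v, x)) c'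
      else 1

open Classical in
/-- The contribution of the component of `c`, averaged over all choices of a slot and a vertex. -/
noncomputable def compVal : ℕ → Key n A w → Fin n → ℝ
  | 0, _, _ => 0
  | r + 1, κ, c =>
    (∑ i, ∑ v, if Usable H (Feasible H r) κ c i v then stepVal H wt f (compVal r) κ c i v else 0) /
      ∑ i, ∑ v, if Usable H (Feasible H r) κ c i v then 1 else 0

end

section
variable {n A w : ℕ} {H : SimpleGraph (Fin n)} {wt : ℕ → ℝ} {f : Fin n → Fin n → ℕ → ℕ → ℝ}

theorem mem_keySet {κ : Key n A w} {u : Fin n} : u ∈ keySet κ ↔ ∃ i, (κ i).1 = u := by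
  simp [keySet]

theorem exists_isFirst {κ : Key n A w} {u : Fin n} (h : u ∈ keySet κ) : ∃ i, IsFirst κ u i := by
  classical
  obtain ⟨i, hi⟩ := mem_keySet.1 h
  let F := univ.filter fun i => (κ i).1 = u
  have hF : F.Nonempty := ⟨i, by simp [F, hi]⟩
  refine ⟨F.min' hF, (mem_filter.1 (F.min'_mem hF)).2, fun j hj hju => ?_⟩
  exact absurd (F.min'_le j (by simp [F, hju])) (not_le.2 hj)

theorem IsFirst.eq {κ : Key n A w} {u : Fin n} {i j : Fin w} (hi : IsFirst κ u i)
    (hj : IsFirst κ u j) : i = j := by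
  rcases lt_trichotomy i j with h | h | h
  · exact absurd hi.1 (hj.2 i h)
  · exact h
  · exact absurd hj.1 (hi.2 j h)

theorem keyVal_eq {κ : Key n A w} {u : Fin n} {i : Fin w} (h : IsFirst κ u i) :
    keyVal κ u = (κ i).2 := by
  classical
  rw [keyVal, sum_eq_single i (fun j _ hj => if_neg fun h' => hj (h'.eq h)) (by simp), if_pos h]

theorem isFirst_update_self {κ : Key n A w} {i : Fin w} {v : Fin n} {x : Fin A}
    (hv : v ∉ keySet κ) : IsFirst (Function.update κ i (v, x)) v i := by
  refine ⟨by simp, fun j hj h => hv ?_⟩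
  rw [Function.update_of_ne hj.ne] at h
  exact mem_keySet.2 ⟨j, h⟩

theorem isFirst_update {κ : Key n A w} {i j : Fin w} {u v : Fin n} {x : Fin A}
    (h : IsFirst κ u j) (hij : i ≠ j) (huv : u ≠ v) : IsFirst (Function.update κ i (v, x)) u j := by
  refine ⟨by rw [Function.update_of_ne hij.symm]; exact h.1, fun k hk => ?_⟩
  by_cases hki : k = i
  · subst hki; simpa using huv.symm
  · rw [Function.update_of_ne hki]; exact h.2 k hk

theorem keySet_update_subset {κ : Key n A w} {i : Fin w} {u v : Fin n} {x : Fin A}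
    (h : u ∈ keySet (Function.update κ i (v, x))) : u = v ∨ u ∈ keySet κ := by
  obtain ⟨j, hj⟩ := mem_keySet.1 h
  by_cases hji : j = i
  · subst hji; left; simpa using hj.symm
  · rw [Function.update_of_ne hji] at hj
    exact .inr (mem_keySet.2 ⟨j, hj⟩)

theorem mem_keySet_of_isFirst {κ : Key n A w} {i : Fin w} {u : Fin n} (h : IsFirst κ u i) :
    u ∈ keySet κ := mem_keySet.2 ⟨i, h.1⟩

/-- Neighbours of the component keep their slots. -/
theorem exists_isFirst_update {κ : Key n A w} {i : Fin w} {c v : Fin n} {x : Fin A}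
    (hv : v ∈ keyComponent H κ c)
    (hi : ∀ u, IsFirst κ u i → ∀ v' ∈ keyComponent H κ c, ¬ H.Adj u v') :
    ∀ u, u ∉ keyComponent H κ c → ∀ v' ∈ keyComponent H κ c, H.Adj v' u →
      ∃ j, IsFirst κ u j ∧ IsFirst (Function.update κ i (v, x)) u j := by
  intro u hu v' hv' e
  have huκ : u ∈ keySet κ := by
    by_contra h
    exact hu (mem_component_of_adj hv' e h)
  obtain ⟨j, hj⟩ := exists_isFirst huκ
  refine ⟨j, hj, isFirst_update hj ?_ fun h => hu (h ▸ hv)⟩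
  rintro rfl
  exact hi u hj v' hv' e.symm

theorem notMem_keySet_update {κ : Key n A w} {i : Fin w} {c v : Fin n} {x : Fin A}
    (hv : v ∈ keyComponent H κ c) :
    ∀ u ∈ (keyComponent H κ c).erase v, u ∉ keySet (Function.update κ i (v, x)) := by
  have hvκ : v ∉ keySet κ := notMem_of_mem_component hv
  intro u hu hu'
  obtain ⟨h1, h2⟩ := mem_erase.1 hu
  rcases keySet_update_subset hu' with h | h
  · exact h1 h
  · exact notMem_of_mem_component h2 h

/-- An edge that leaves the component without `v` leads to `v`, which is now in the key, or to a
neighbour of the old component, which kept its slot. Hence the components for the new key split the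
old one without `v`. -/
theorem closed_update {κ : Key n A w} {i : Fin w} {c v : Fin n} {x : Fin A}
    (hv : v ∈ keyComponent H κ c)
    (hi : ∀ u, IsFirst κ u i → ∀ v' ∈ keyComponent H κ c, ¬ H.Adj u v') :
    ∀ u ∈ (keyComponent H κ c).erase v, ∀ u', H.Adj u u' →
      u' ∉ keySet (Function.update κ i (v, x)) → u' ∈ (keyComponent H κ c).erase v := by
  have hvκ : v ∉ keySet κ := notMem_of_mem_component hv
  intro u hu u' e hu'
  have hvκ' : v ∈ keySet (Function.update κ i (v, x)) :=
    mem_keySet_of_isFirst (isFirst_update_self hvκ)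
  refine mem_erase.2 ⟨fun h => hu' (h ▸ hvκ'), ?_⟩
  by_contra h
  obtain ⟨j, -, hj⟩ := exists_isFirst_update hv hi u' h u (mem_erase.1 hu).2 e
  exact hu' (mem_keySet_of_isFirst hj)

open Classical in
/-- The sum over a union of components is the product over the components. -/
theorem partSum_eq_prod_component (hf : ∀ u v, ¬ H.Adj u v → ∀ x y, f u v x y = 1)
    {S D : Finset (Fin n)} (hDS : ∀ u ∈ D, u ∉ S)
    (hD : ∀ u ∈ D, ∀ v, H.Adj u v → v ∉ S → v ∈ D) (β : Fin n → ℕ) :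
    partSum A wt f D β =
      ∏ c, if c ∈ D ∧ IsLeast H S c then partSum A wt f (component H S c) β else 1 := by
  rw [prod_ite, prod_const_one, mul_one, ← partSum_biUnion (H := H) hf]
  · congr 1
    ext v
    simp only [mem_biUnion, mem_filter, mem_univ, true_and]
    constructor
    · intro hv
      have hne : (component H S v).Nonempty := ⟨v, mem_component_self (hDS v hv)⟩
      set c := (component H S v).min' hne
      have hc : c ∈ component H S v := min'_mem _ _
      have hcv := component_eq hc
      refine ⟨c, ⟨component_subset_of_closed hv hD hc, fun u hu hu' => ?_⟩, ?_⟩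
      · exact absurd (min'_le _ u (by rwa [hcv] at hu')) (not_le.2 hu)
      · rw [hcv]; exact mem_component_self (hDS v hv)
    · rintro ⟨c, ⟨hc, -⟩, hv⟩
      exact component_subset_of_closed hc hD hv
  · intro c hc d hd hcd
    simp only [mem_filter, mem_univ, true_and] at hc hd
    have hne : ∀ u ∈ component H S c, u ∉ component H S d := by
      intro u hu hu'
      have h1 := component_eq hu
      rw [component_eq hu'] at h1
      have hc' : c ∈ component H S d := h1 ▸ mem_component_self (hDS c hc.1)
      have hd' : d ∈ component H S c := h1 ▸ mem_component_self (hDS d hd.1)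
      exact hcd (le_antisymm (not_lt.1 fun h => hc.2 d h hd') (not_lt.1 fun h => hd.2 c h hc'))
    refine ⟨disjoint_left.2 hne, fun u hu v hv e => ?_⟩
    exact hne v (mem_component_of_adj hu e (notMem_of_mem_component hv)) hv

/-- Every usable pair of a slot and a vertex yields the same value, namely the partial sum. Dividing
the total by the number of usable pairs therefore returns it, and feasibility makes that number
nonzero. Averaging replaces the choice of a pair. -/
theorem compVal_eq (hf : ∀ u v, ¬ H.Adj u v → ∀ x y, f u v x y = 1) (r : ℕ) :
    ∀ (κ : Key n A w) (c : Fin n), Feasible H r κ c →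
      compVal H wt f r κ c = partSum A wt f (keyComponent H κ c) (keyVal κ) := by
  classical
  have hf0 : ∀ u x y, f u u x y = 1 := fun u => hf u u (SimpleGraph.irrefl _)
  induction r with
  | zero => exact fun κ c h => h.elim
  | succ r ih =>
    intro κ c hfeas
    have key : ∀ i v, Usable H (Feasible H r) κ c i v →
        stepVal H wt f (compVal H wt f r) κ c i v =
          partSum A wt f (keyComponent H κ c) (keyVal κ) := by
      rintro i v ⟨hv, hi, hR⟩
      have hvκ : v ∉ keySet κ := notMem_of_mem_component hv
      rw [← insert_erase hv, partSum_insert hf0 (notMem_erase _ _), stepVal,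
        Finset.sum_range fun x => wt x * (∏ u, if u ∉ insert v ((keyComponent H κ c).erase v) then
          f u v (keyVal κ u) x * f v u x (keyVal κ u) else 1) *
          partSum A wt f ((keyComponent H κ c).erase v) (Function.update (keyVal κ) v x)]
      refine sum_congr rfl fun x _ => ?_
      set κ' := Function.update κ i (v, x) with hκ'
      have hN := exists_isFirst_update (x := x) hv hi
      have hDS := notMem_keySet_update (x := x) (i := i) hv
      have hD := closed_update (x := x) hv hi
      rw [partSum_eq_prod_component hf hDS hD]
      congr 1
      · congr 1
        refine prod_congr rfl fun u _ => ?_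
        rw [insert_erase hv]
        by_cases huκ : u ∈ keySet κ
        · rw [if_pos huκ, if_pos fun h => notMem_of_mem_component h huκ]
        · rw [if_neg huκ]
          by_cases h : u ∈ keyComponent H κ c
          · rw [if_neg (not_not.2 h)]
          · have : ¬ H.Adj v u := fun e => h (mem_component_of_adj hv e huκ)
            rw [hf _ _ this, hf _ _ fun e => this e.symm, mul_one, ite_self]
      · refine prod_congr rfl fun c' _ => ?_
        simp only [mem_erase, and_assoc, and_left_comm (b := c' ∈ keyComponent H κ c)]
        split_ifs with h
        · rw [ih κ' c' (hR c' h.1 h.2.1 x)]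
          -- The two assignments need to agree only on neighbours of the new component. Such a
          -- neighbour is `v`, whose value is the new entry, or a neighbour of the old component,
          -- which kept its slot and its value.
          refine partSum_congr hf ?_
          rintro u hu ⟨v', hv', e⟩
          have hsub : keyComponent H κ' c' ⊆ (keyComponent H κ c).erase v :=
            component_subset_of_closed (mem_erase.2 ⟨h.2.1, h.1⟩) hD
          by_cases huv : u = v
          · subst huv
            rw [Function.update_self, keyVal_eq (isFirst_update_self hvκ)]
            simp
          · rw [Function.update_of_ne huv]
            have huC : u ∉ keyComponent H κ c := by
              intro huC
              have h1 := hDS u (mem_erase.2 ⟨huv, huC⟩)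
              exact hu (mem_component_of_adj hv' e.symm h1)
            obtain ⟨j, hj, hj'⟩ := hN u huC v' (mem_erase.1 (hsub hv')).2 e.symm
            rw [keyVal_eq hj, keyVal_eq hj', Function.update_of_ne]
            rintro rfl
            have := hj'.1
            rw [Function.update_self] at this
            exact huv this.symm
        · rfl
    rw [compVal]
    have h1 : (∑ i, ∑ v, if Usable H (Feasible H r) κ c i v then
        stepVal H wt f (compVal H wt f r) κ c i v else 0) =
        (∑ i, ∑ v, if Usable H (Feasible H r) κ c i v then (1 : ℝ) else 0) *
          partSum A wt f (keyComponent H κ c) (keyVal κ) := by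
      simp only [sum_mul, ite_mul, one_mul, zero_mul]
      refine sum_congr rfl fun i _ => sum_congr rfl fun v _ => ?_
      split_ifs with h
      · exact key i v h
      · rfl
    rw [h1, mul_div_assoc, mul_comm, div_mul_cancel₀]
    obtain ⟨i, v, h⟩ := hfeas
    exact ne_of_gt (sum_pos' (fun i _ => sum_nonneg fun v _ => by positivity)
      ⟨i, mem_univ _, sum_pos' (fun v _ => by positivity) ⟨v, mem_univ _, by simp [h]⟩⟩)

/-- The key that assigns `x` to `v` in all slots. -/
def constKey (w : ℕ) (v : Fin n) (x : Fin A) : Key n A w := fun _ => (v, x)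

-- The start of the recursion. A key with `w > 0` cannot be empty, so one vertex is fixed in all
-- slots and the sum over its values is taken outside.
open Classical in
theorem partSum_univ_eq (hw : 0 < w) (hf : ∀ u v, ¬ H.Adj u v → ∀ x y, f u v x y = 1) (r : ℕ)
    (v : Fin n) (hfeas : ∀ x c, c ≠ v → Feasible H r (constKey (A := A) w v x) c)
    (β : Fin n → ℕ) :
    partSum A wt f univ β = ∑ x : Fin A, wt x *
      ∏ c, if c ≠ v ∧ IsLeast H (keySet (constKey w v x)) c then
        compVal H wt f r (constKey w v x) c else 1 := by
  have hf0 : ∀ u x y, f u u x y = 1 := fun u => hf u u (SimpleGraph.irrefl _)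
  rw [← insert_erase (mem_univ v), partSum_insert hf0 (notMem_erase _ _),
    Finset.sum_range fun x => wt x * (∏ u, if u ∉ insert v (univ.erase v) then
      f u v (β u) x * f v u x (β u) else 1) *
      partSum A wt f (univ.erase v) (Function.update β v x)]
  refine sum_congr rfl fun x _ => ?_
  set κ : Key n A w := constKey w v x with hκ
  have hS : ∀ u, u ∈ keySet κ ↔ u = v := by
    intro u
    rw [mem_keySet]
    exact ⟨fun ⟨i, hi⟩ => hi.symm, fun h => ⟨⟨0, hw⟩, h.symm⟩⟩
  rw [insert_erase (mem_univ v), partSum_eq_prod_component (H := H) (S := keySet κ) hf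
    (fun u hu => by simpa [hS] using hu) (fun u _ u' _ hu' => by simpa [hS] using hu')]
  simp only [mem_univ, not_true_eq_false, if_false, prod_const_one, mul_one, mem_erase, and_true]
  congr 1
  refine prod_congr rfl fun c _ => ?_
  split_ifs with h
  · rw [compVal_eq hf r _ _ (hfeas x c h.1)]
    refine partSum_congr hf ?_
    rintro u hu ⟨v', hv', e⟩
    have huS : u ∈ keySet κ := by
      by_contra h
      exact hu (mem_component_of_adj hv' e.symm h)
    obtain rfl := (hS u).1 huS
    have h0 : IsFirst κ u ⟨0, hw⟩ := ⟨rfl, fun j hj => absurd hj (Nat.not_lt_zero _)⟩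
    rw [Function.update_self]
    exact (keyVal_eq h0).symm
  · rfl

end

end PairwiseSum

/-! ## Tree decompositions and feasibility -/

namespace PairwiseSum

open Finset

section Tree
variable {ι : Type*} {G : SimpleGraph ι} {r : ι} {P : ∀ i, G.Walk i r}

theorem eq_rootPath (hG : G.IsAcyclic) (hP : ∀ i, (P i).IsPath) {i : ι}
    {p : G.Walk i r} (hp : p.IsPath) : p = P i :=
  congrArg Subtype.val ((hG.subsingleton_path i r).elim ⟨p, hp⟩ ⟨P i, hP i⟩)

theorem length_rootPath_lt [DecidableEq ι] (hG : G.IsAcyclic) (hP : ∀ i, (P i).IsPath)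
    {i j : ι} (h : j ∈ (P i).support) (hij : i ≠ j) :
    (P j).length < (P i).length := by
  rw [← eq_rootPath hG hP ((hP i).dropUntil h)]
  exact SimpleGraph.Walk.length_dropUntil_lt_length h hij.symm

theorem rootPath_of_adj [DecidableEq ι] (hG : G.IsAcyclic) (hP : ∀ i, (P i).IsPath)
    {i j : ι} (h : G.Adj i j) :
    ((P i).support = i :: (P j).support ∧ (P i).length = (P j).length + 1) ∨
      ((P j).support = j :: (P i).support ∧ (P j).length = (P i).length + 1) := by
  by_cases hi : i ∈ (P j).support
  · right
    have hj : j ∉ (P i).support := fun hj =>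
      lt_asymm (length_rootPath_lt hG hP hi h.ne.symm) (length_rootPath_lt hG hP hj h.ne)
    have := eq_rootPath hG hP (SimpleGraph.Walk.IsPath.cons (h := h.symm) (hP i) hj)
    rw [← this]
    simp
  · left
    have := eq_rootPath hG hP (SimpleGraph.Walk.IsPath.cons (h := h) (hP j) hi)
    rw [← this]
    simp

/-- Along an edge of the tree the root path gains or loses its first node. So a walk can enter or
leave the subtree below `t` only between `t` and its parent, and the parent is nearer to the root
than the walk ever comes. -/
theorem mem_rootPath_of_walk [DecidableEq ι] (hG : G.IsAcyclic) (hP : ∀ i, (P i).IsPath)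
    {t s s' : ι} (p : G.Walk s s')
    (hp : ∀ i ∈ p.support, (P t).length ≤ (P i).length) (ht : t ∈ (P s').support) :
    t ∈ (P s).support := by
  induction p with
  | nil => exact ht
  | @cons u v _ e p ih =>
    have h := ih (fun i hi => hp i (by simp [hi])) ht
    rcases rootPath_of_adj hG hP e with h' | h'
    · rw [h'.1]; exact List.mem_cons_of_mem _ h
    · rw [h'.1, List.mem_cons] at h
      rcases h with rfl | h
      · have := hp u (by simp)
        omega
      · exact h

/-- The subtree below `t` can be left only through `t`, and `t` is its only node that is no deeper
than `t`. -/
theorem mem_walk_of_mem_rootPath [DecidableEq ι] (hG : G.IsAcyclic) (hP : ∀ i, (P i).IsPath)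
    {t s s' : ι} (p : G.Walk s s') (hs : t ∈ (P s).support)
    (hs' : (P s').length ≤ (P t).length) : t ∈ p.support := by
  induction p with
  | nil =>
    by_contra h
    simp only [SimpleGraph.Walk.support_nil, List.mem_singleton] at h
    exact absurd (length_rootPath_lt hG hP hs (Ne.symm h)) (not_lt.2 hs')
  | @cons u v _ e p ih =>
    rw [SimpleGraph.Walk.support_cons, List.mem_cons]
    by_cases htu : t = u
    · exact .inl htu
    · refine .inr (ih ?_ hs')
      rcases rootPath_of_adj hG hP e with h' | h'
      · rw [h'.1, List.mem_cons] at hs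
        exact hs.resolve_left htu
      · rw [h'.1]; exact List.mem_cons_of_mem _ hs

end Tree

variable {n A w : ℕ} {H : SimpleGraph (Fin n)}

/-- Root the tree at `r`. The hypothesis provides a bag `t` that contains all neighbours of the
component `C`, such that no bag meeting `C` is nearer to the root. Let `t'` be a bag meeting `C`
nearest to the root, in a vertex `v` of `C`. All bags meeting `C` lie below `t'`, since `C` is
connected; the walk from such a bag to `t` passes `t'`, so `t'` contains the neighbours of `C` as
well as `v`. At most `w - 1` slots are thus in use by neighbours, another slot can be given to `v`,
and `t'` plays the role of `t` for the components of `C` without `v`. -/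
theorem feasible_of_treeDecomposition (T : TreeDecomposition H) (hT : ∀ i, (T.bag i).card ≤ w)
    {r : Fin T.b} {P : ∀ i, T.tree.Walk i r} (hP : ∀ i, (P i).IsPath) (ρ : ℕ) :
    ∀ (κ : Key n A w) (c : Fin n), c ∉ keySet κ → (keyComponent H κ c).card ≤ ρ →
      (∃ t, (∀ u ∉ keyComponent H κ c, ∀ v ∈ keyComponent H κ c, H.Adj u v → u ∈ T.bag t) ∧
        ∀ v ∈ keyComponent H κ c, ∀ i, v ∈ T.bag i → (P t).length ≤ (P i).length) →
      Feasible H ρ κ c := by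
  have hG := T.isTree.isAcyclic
  induction ρ with
  | zero =>
    intro κ c hc hcard _
    exact absurd hcard (not_le.2 (card_pos.2 ⟨c, mem_component_self hc⟩))
  | succ ρ ih =>
    rintro κ c hc hcard ⟨t, ht, htd⟩
    set C := keyComponent H κ c with hC
    have hcC : c ∈ C := mem_component_self hc
    -- the bag of the component that is nearest to the root
    let F := (C ×ˢ univ).filter fun q : Fin n × Fin T.b => q.1 ∈ T.bag q.2
    have hF : F.Nonempty := by
      obtain ⟨i, hi⟩ := T.exists_mem_bag c
      exact ⟨(c, i), by simp [F, hcC, hi]⟩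
    obtain ⟨⟨v, t'⟩, hvt, hmin⟩ := F.exists_min_image (fun q => (P q.2).length) hF
    simp only [F, mem_filter, mem_product, mem_univ, and_true] at hvt hmin
    obtain ⟨hv, hvt⟩ := hvt
    replace hmin : ∀ u ∈ C, ∀ i, u ∈ T.bag i → (P t').length ≤ (P i).length :=
      fun u hu i hi => hmin (u, i) ⟨hu, hi⟩
    have hwalk : ∀ u ∈ C, ∀ s s', u ∈ T.bag s → u ∈ T.bag s' → t' ∈ (P s').support →
        t' ∈ (P s).support := by
      intro u hu s s' hs hs' h
      obtain ⟨p, hp⟩ := (T.isTree.connected s s').exists_isPath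
      exact mem_rootPath_of_walk hG hP p
        (fun i hi => hmin u hu i (T.mem_bag_of_mem_path s s' p hp i hi u hs hs')) h
    have hbelow : ∀ u ∈ C, ∀ s, u ∈ T.bag s → t' ∈ (P s).support := by
      intro u hu s hs
      -- Being below `t'` is passed along the walk from `v` to `u` inside `C`: consecutive vertices
      -- share a bag, and the bags of one vertex are connected by paths that stay no nearer to the
      -- root than `t'`.
      have hvu : u ∈ component H (keySet κ) v := by rwa [component_eq hv]
      obtain ⟨hvκ, ⟨p⟩⟩ := mem_component.1 hvu
      suffices h : ∀ (a b : Fin n) (p : (avoid H (keySet κ)).Walk a b), a ∈ C →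
          (∀ s, a ∈ T.bag s → t' ∈ (P s).support) →
          ∀ s, b ∈ T.bag s → t' ∈ (P s).support from
        h v u p hv (fun s hs => hwalk v hv s t' hs hvt (SimpleGraph.Walk.start_mem_support _)) s hs
      intro a b p
      induction p with
      | nil => exact fun _ h => h
      | @cons a a' b e p ih =>
        intro ha h
        have ha' : a' ∈ C := mem_component_of_adj ha e.1 e.2.2
        refine ih ha' fun s hs => ?_
        obtain ⟨s₀, h1, h2⟩ := T.exists_edge_bag a a' e.1
        exact hwalk a' ha' s s₀ hs h2 (h s₀ h1)
    have hbag : ∀ u ∉ C, ∀ v' ∈ C, H.Adj u v' → u ∈ T.bag t' := by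
      intro u hu v' hv' e
      obtain ⟨s, h1, h2⟩ := T.exists_edge_bag u v' e
      obtain ⟨p, hp⟩ := (T.isTree.connected s t).exists_isPath
      exact T.mem_bag_of_mem_path s t p hp t'
        (mem_walk_of_mem_rootPath hG hP p (hbelow v' hv' s h2) (htd v hv t' hvt)) u h1
        (ht u hu v' hv' e)
    obtain ⟨i, hi⟩ : ∃ i, ∀ u, IsFirst κ u i → ∀ v' ∈ C, ¬ H.Adj u v' := by
      -- Otherwise every slot is the first slot of a neighbour of `C`, which gives `w` distinct
      -- vertices in the bag of `t'` besides `v`.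
      by_contra! hcon
      have hmaps : ∀ i, (κ i).1 ∈ (T.bag t').erase v := by
        intro i
        obtain ⟨u, hu, v', hv', e⟩ := hcon i
        rw [hu.1]
        have huκ := mem_keySet_of_isFirst hu
        refine mem_erase.2 ⟨?_, hbag u (fun h => notMem_of_mem_component h huκ) v' hv' e⟩
        rintro rfl
        exact notMem_of_mem_component hv huκ
      have hinj : Function.Injective fun i => (κ i).1 := by
        intro i j hij
        obtain ⟨u, hu, -⟩ := hcon i
        obtain ⟨u', hu', -⟩ := hcon j
        have : u = u' := hu.1.symm.trans (hij.trans hu'.1)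
        subst this
        exact hu.eq hu'
      have h1 := card_le_card_of_injOn (s := univ) _ (fun i _ => hmaps i) hinj.injOn
      rw [card_univ, Fintype.card_fin, card_erase_of_mem hvt] at h1
      have h2 := hT t'
      have h3 := card_pos.2 ⟨v, hvt⟩
      omega
    refine ⟨i, v, hv, hi, fun c' hc' hcv x => ?_⟩
    have hDS := notMem_keySet_update (i := i) (x := x) hv
    have hD := closed_update (x := x) hv hi
    have hc'' := mem_erase.2 ⟨hcv, hc'⟩
    have hsub : keyComponent H (Function.update κ i (v, x)) c' ⊆ C.erase v :=
      component_subset_of_closed hc'' hD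
    refine ih _ c' (hDS c' hc'') ?_ ⟨t', ?_, ?_⟩
    · have := card_le_card hsub
      rw [card_erase_of_mem hv] at this
      omega
    · intro u hu v' hv' e
      by_cases huv : u = v
      · exact huv ▸ hvt
      · refine hbag u (fun huC => hu ?_) v' (mem_erase.1 (hsub hv')).2 e
        exact mem_component_of_adj hv' e.symm (hDS u (mem_erase.2 ⟨huv, huC⟩))
    · exact fun u hu => hmin u (mem_erase.1 (hsub hu)).2

/-- Rooting the tree at a bag of `v` makes the depth of `t` zero. Each round removes a vertex from
the component, so `n` rounds are enough. -/
theorem feasible_constKey (T : TreeDecomposition H) (hT : ∀ i, (T.bag i).card ≤ w) (hw : 0 < w)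
    (v : Fin n) (x : Fin A) (c : Fin n) (hc : c ≠ v) : Feasible H n (constKey w v x) c := by
  obtain ⟨r, hr⟩ := T.exists_mem_bag v
  choose P hP using fun i => (T.isTree.connected i r).exists_isPath
  have hS : ∀ u, u ∈ keySet (constKey w v x) ↔ u = v := fun u =>
    mem_keySet.trans ⟨fun ⟨i, hi⟩ => hi.symm, fun h => ⟨⟨0, hw⟩, h.symm⟩⟩
  refine feasible_of_treeDecomposition T hT hP n _ c (by rwa [hS]) ?_ ⟨r, ?_, ?_⟩
  · exact (card_le_univ _).trans_eq (Fintype.card_fin n)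
  · intro u hu v' hv' e
    have : u ∈ keySet (constKey w v x) := by
      by_contra h
      exact hu (mem_component_of_adj hv' e.symm h)
    rwa [(hS u).1 this]
  · intro u _ i _
    have : P r = .nil := eq_rootPath T.isTree.isAcyclic hP SimpleGraph.Walk.IsPath.nil |>.symm
    simp [this]

/-- A tree decomposition with bags of cardinality at most `k + 1`. -/
theorem exists_treeDecomposition_of_treewidth_le {k : ℕ} (h : treewidth H ≤ k) :
    ∃ T : TreeDecomposition H, ∀ i, (T.bag i).card ≤ k + 1 := by
  have hne : (Set.range fun T : TreeDecomposition H => T.width).Nonempty := by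
    obtain ⟨T⟩ := TreeDecomposition.nonempty H
    exact ⟨_, T, rfl⟩
  obtain ⟨T, hT⟩ := Nat.sInf_mem hne
  refine ⟨T, fun i => ?_⟩
  have h1 : T.width ≤ k := hT.trans_le h
  have h2 : (T.bag i).card ≤ univ.sup fun i => (T.bag i).card :=
    le_sup (f := fun i => (T.bag i).card) (mem_univ i)
  unfold TreeDecomposition.width at h1
  omega

/-- Some bag contains both ends of the edge. Positivity matters for the time bound, whose exponent
is a multiple of `k`. -/
theorem pos_of_treewidth_le {k : ℕ} (h : treewidth H ≤ k) {u v : Fin n} (e : H.Adj u v) :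
    0 < k := by
  obtain ⟨T, hT⟩ := exists_treeDecomposition_of_treewidth_le h
  obtain ⟨i, hu, hv⟩ := T.exists_edge_bag u v e
  have := (card_pair e.ne).symm.trans_le
    ((card_le_card (by simp [insert_subset_iff, hu, hv])).trans (hT i))
  omega

end PairwiseSum

/-! ## Completion times in discrete time -/

namespace CompletionTime

open Finset

section
variable {V E : Type*} (src tgt : E → V)

/-- There is no directed closed walk. -/
def EdgeAcyclic : Prop := ∀ v, ¬ Relation.TransGen (fun u w => ∃ e, src e = u ∧ tgt e = w) v v

/-- Given that edge `e`, when started at time `s`, is finished at time `s'` if `fin e s s'`, the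
function `g` gives the first times at which all incoming edges are finished. -/
def IsCompletion (fin : E → ℕ → ℕ → Prop) (g : V → ℕ) : Prop :=
  ∀ v, (∀ e, tgt e = v → fin e (g (src e)) (g v)) ∧
    ∀ s < g v, ¬ ∀ e, tgt e = v → fin e (g (src e)) s

/-- The starting time of the outgoing edges encoded by `a`. -/
def outTime (a : ℕ) : ℕ := a / 2

/-- The time bound for the incoming edges encoded by `a`. -/
def inTime (a : ℕ) : ℕ := a / 2 - a % 2

/-- The sign of the letter `a`; letters that are not allowed have weight zero. -/
def letterWeight (N a : ℕ) : ℝ :=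
  if a / 2 ≤ N ∧ a % 2 ≤ a / 2 then (if a % 2 = 0 then 1 else -1) else 0

variable {src tgt}

theorem wellFounded_of_edgeAcyclic [Finite V] (h : EdgeAcyclic src tgt) :
    WellFounded (Relation.TransGen fun u w => ∃ e, src e = u ∧ tgt e = w) := by
  have : Std.Irrefl (Relation.TransGen fun u w => ∃ e, src e = u ∧ tgt e = w) := ⟨h⟩
  exact Finite.wellFounded_of_trans_of_irrefl _

/-- The times at the tails of the edges into `v` determine the first time at `v`, so induction along
the edges applies. Uniqueness leaves at most one nonzero term in the signed sum over letters. -/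
theorem IsCompletion.eq [Finite V] (h : EdgeAcyclic src tgt) {fin : E → ℕ → ℕ → Prop}
    {g g' : V → ℕ} (hg : IsCompletion src tgt fin g) (hg' : IsCompletion src tgt fin g') :
    g = g' := by
  funext v
  induction v using (wellFounded_of_edgeAcyclic h).induction with
  | _ v ih =>
    have hs : ∀ e, tgt e = v → g (src e) = g' (src e) := fun e he =>
      ih _ (.single ⟨e, rfl, he⟩)
    rcases lt_trichotomy (g v) (g' v) with hlt | heq | hlt
    · exact absurd (fun e he => hs e he ▸ (hg v).1 e he) ((hg' v).2 _ hlt)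
    · exact heq
    · exact absurd (fun e he => (hs e he).symm ▸ (hg' v).1 e he) ((hg v).2 _ hlt)

variable [Fintype V] [DecidableEq V] [Fintype E]

/-- A letter is `2 * g + s` with a time `g` and a bit `s`; the bit tells whether the incoming edges
are tested at `g` or one step earlier. -/
theorem sum_letters (M : ℕ) (F : (V → ℕ) → ℝ) :
    ∑ a ∈ Fintype.piFinset (fun _ : V => range (2 * M)), F a =
      ∑ g ∈ Fintype.piFinset (fun _ : V => range M),
        ∑ s ∈ Fintype.piFinset (fun _ : V => range 2), F fun v => 2 * g v + s v := by
  rw [← sum_product']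
  refine sum_nbij' (fun a => (fun v => a v / 2, fun v => a v % 2))
    (fun p v => 2 * p.1 v + p.2 v) ?_ ?_ ?_ ?_ ?_
  · intro a ha
    simp only [Fintype.mem_piFinset, mem_range, mem_product] at ha ⊢
    exact ⟨fun v => by have := ha v; omega, fun v => by omega⟩
  · rintro ⟨g, s⟩ ha
    simp only [Fintype.mem_piFinset, mem_range, mem_product] at ha ⊢
    intro v
    have := ha.1 v; have := ha.2 v; omega
  · intro a _
    funext v
    exact Nat.div_add_mod _ _
  · rintro ⟨g, s⟩ ha
    simp only [Fintype.mem_piFinset, mem_range, mem_product] at ha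
    refine Prod.ext (funext fun v => ?_) (funext fun v => ?_)
    · have := ha.2 v
      simp only
      omega
    · have := ha.2 v
      simp only
      omega
  · intro a _
    congr 1
    funext v
    exact (Nat.div_add_mod _ _).symm

open Classical in
/-- A signed sum over all pairs of a starting time and a time bound for each vertex decides whether
all vertices are completed by time `N`. -/
theorem sum_letterWeight (h : EdgeAcyclic src tgt) {fin : E → ℕ → ℕ → Prop}
    (hmono : ∀ e s s' s'', fin e s s' → s' ≤ s'' → fin e s s'') {N M : ℕ} (hM : N < M) :
    ∑ a ∈ Fintype.piFinset (fun _ : V => range (2 * M)), (∏ v, letterWeight N (a v)) *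
        ∏ e, (if fin e (outTime (a (src e))) (inTime (a (tgt e))) then (1 : ℝ) else 0) =
      if ∃ g, (∀ v, g v ≤ N) ∧ IsCompletion src tgt fin g then 1 else 0 := by
  rw [sum_letters]
  have key : ∀ g ∈ Fintype.piFinset (fun _ : V => range M),
      (∑ s ∈ Fintype.piFinset (fun _ : V => range 2), (∏ v, letterWeight N (2 * g v + s v)) *
        ∏ e, (if fin e (outTime (2 * g (src e) + s (src e))) (inTime (2 * g (tgt e) + s (tgt e)))
          then (1 : ℝ) else 0)) =
      if (∀ v, g v ≤ N) ∧ IsCompletion src tgt fin g then 1 else 0 := by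
    intro g _
    -- For fixed `g` and `s`, grouping the edges by their targets turns the summand into a product
    -- over the vertices, so the sum over the bits can be taken at each vertex separately.
    have h1 : ∀ s ∈ Fintype.piFinset (fun _ : V => range 2),
        (∏ v, letterWeight N (2 * g v + s v)) *
        (∏ e, (if fin e (outTime (2 * g (src e) + s (src e))) (inTime (2 * g (tgt e) + s (tgt e)))
          then (1 : ℝ) else 0)) =
        ∏ v, (letterWeight N (2 * g v + s v) *
          if ∀ e, tgt e = v → fin e (g (src e)) (g v - s v) then 1 else 0) := by
      intro s hs
      simp only [Fintype.mem_piFinset, mem_range] at hs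
      have ho : ∀ v, outTime (2 * g v + s v) = g v := fun v => by
        have := hs v; unfold outTime; omega
      have hi : ∀ v, inTime (2 * g v + s v) = g v - s v := fun v => by
        have := hs v; unfold inTime; omega
      rw [prod_mul_distrib, ← prod_fiberwise_of_maps_to (s := univ) (t := univ) (g := tgt)
        (fun _ _ => mem_univ _)]
      congr 1
      refine prod_congr rfl fun v _ => ?_
      rw [prod_ite_zero]
      simp only [prod_const_one, mem_filter, mem_univ, true_and, ho, hi]
      refine if_congr (forall_congr' fun e => ?_) rfl rfl
      constructor <;> (intro h' he; have := h' he; simp_all)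
    rw [sum_congr rfl h1, ← prod_univ_sum (fun _ : V => range 2) fun v s =>
      letterWeight N (2 * g v + s) *
        if ∀ e, tgt e = v → fin e (g (src e)) (g v - s) then 1 else 0]
    -- The two bits give the condition at `g v` minus the condition at `g v - 1`. By monotonicity
    -- this is the indicator that `g v` is the first time; for `g v = 0` the second letter has
    -- weight zero.
    have h2 : ∀ v, (∑ s ∈ range 2, letterWeight N (2 * g v + s) *
        if ∀ e, tgt e = v → fin e (g (src e)) (g v - s) then (1 : ℝ) else 0) =
        if g v ≤ N ∧ (∀ e, tgt e = v → fin e (g (src e)) (g v)) ∧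
          ∀ s < g v, ¬ ∀ e, tgt e = v → fin e (g (src e)) s then 1 else 0 := by
      intro v
      have e0 : letterWeight N (2 * g v + 0) = if g v ≤ N then 1 else 0 := by
        unfold letterWeight
        rw [show (2 * g v + 0) / 2 = g v by omega, show (2 * g v + 0) % 2 = 0 by omega]
        simp
      have e1 : letterWeight N (2 * g v + 1) = if g v ≤ N ∧ 1 ≤ g v then -1 else 0 := by
        unfold letterWeight
        rw [show (2 * g v + 1) / 2 = g v by omega, show (2 * g v + 1) % 2 = 1 by omega]
        simp
      rw [sum_range_succ, sum_range_one, e0, e1, Nat.sub_zero]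
      by_cases hN : g v ≤ N
      swap
      · simp [hN]
      by_cases hg : 1 ≤ g v
      swap
      · have : g v = 0 := by omega
        simp [this]
      have hlt : (∀ s < g v, ¬ ∀ e, tgt e = v → fin e (g (src e)) s) ↔
          ¬ ∀ e, tgt e = v → fin e (g (src e)) (g v - 1) :=
        ⟨fun h' => h' _ (by omega), fun h' s hs h'' =>
          h' fun e he => hmono e _ _ _ (h'' e he) (by omega)⟩
      simp only [hN, hg, true_and, if_true, one_mul]
      by_cases hp : ∀ e, tgt e = v → fin e (g (src e)) (g v - 1)
      · have hq : ∀ e, tgt e = v → fin e (g (src e)) (g v) := fun e he =>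
          hmono e _ _ _ (hp e he) (by omega)
        rw [if_pos hp, if_pos hq, if_neg fun h' => hlt.1 h'.2 hp]
        norm_num
      · rw [if_neg hp, mul_zero, add_zero]
        exact if_congr ⟨fun h' => ⟨h', hlt.2 hp⟩, fun h' => h'.1⟩ rfl rfl
    rw [prod_congr rfl fun v _ => h2 v, prod_ite_zero]
    simp only [mem_univ, true_imp_iff, prod_const_one]
    refine if_congr ⟨fun h' => ⟨fun v => (h' v).1, fun v => (h' v).2⟩,
      fun h' v => ⟨h'.1 v, h'.2 v⟩⟩ rfl rfl
  rw [sum_congr rfl key]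
  split_ifs with hex
  · obtain ⟨g, hg, hg'⟩ := hex
    rw [sum_eq_single g]
    · rw [if_pos ⟨hg, hg'⟩]
    · exact fun g' _ hne => if_neg fun h' => hne (h'.2.eq h hg')
    · intro hg''
      refine absurd ?_ hg''
      simp only [Fintype.mem_piFinset, mem_range]
      exact fun v => (hg v).trans_lt hM
  · exact sum_eq_zero fun g _ => if_neg fun h' => hex ⟨g, h'⟩

end

end CompletionTime

/-! ### Sequences of ringing edges and the transfer operator -/

namespace CompletionTime

open Finset

section
variable {V E : Type*} [DecidableEq V] [Fintype E] [DecidableEq E] (src tgt : E → V)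

/-- The set of finished edges, if the edges in `A` ring when those in `D` are finished: a ringing
edge becomes finished if all incoming edges of its source are finished. -/
def step (D : Finset E) (A : E → Bool) : Finset E :=
  univ.filter fun e => e ∈ D ∨ A e ∧ ∀ e', tgt e' = src e → e' ∈ D

def ringCount (A : E → Bool) : ℕ := (univ.filter fun e => A e = true).card

/-- The sum over all nonempty sets of ringing edges, where a set with `j` elements has weight
`t ^ (j - 1)`. -/
def ringOp {R : Type*} [CommRing R] (t : R) : Module.End R (Finset E → R) :=
  ∑ A : E → Bool, (if ringCount A = 0 then 0 else t ^ (ringCount A - 1)) •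
    LinearMap.funLeft R R fun D => step src tgt D A

/-- The sum over all sets of ringing edges, where a set with `j` elements has weight `t ^ j`. -/
def transferOp {R : Type*} [CommRing R] (t : R) : Module.End R (Finset E → R) :=
  1 + t • ringOp src tgt t

def allDone (R : Type*) [CommRing R] (D : Finset E) : R := if D = univ then 1 else 0

/-- The set of finished edges at time `p`. -/
def doneAt (ω : ℕ → E → Bool) : ℕ → Finset E
  | 0 => ∅
  | p + 1 => step src tgt (doneAt ω p) (ω p)

variable {src tgt}

theorem mem_step {D : Finset E} {A : E → Bool} {e : E} :
    e ∈ step src tgt D A ↔ e ∈ D ∨ A e ∧ ∀ e', tgt e' = src e → e' ∈ D := by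
  simp [step]

theorem subset_step (D : Finset E) (A : E → Bool) : D ⊆ step src tgt D A := fun _ h =>
  mem_step.2 (.inl h)

theorem ringOp_apply {R : Type*} [CommRing R] (t : R) (f : Finset E → R) (D : Finset E) :
    ringOp src tgt t f D = ∑ A : E → Bool,
      (if ringCount A = 0 then 0 else t ^ (ringCount A - 1)) * f (step src tgt D A) := by
  simp only [ringOp, LinearMap.sum_apply, Finset.sum_apply, LinearMap.smul_apply, Pi.smul_apply,
    LinearMap.funLeft_apply, smul_eq_mul]

/-- The empty set of ringing edges contributes the identity, and every other set has at least one
factor `t`; hence the shifted exponent in `ringOp`. -/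
theorem transferOp_apply {R : Type*} [CommRing R] (t : R) (f : Finset E → R) (D : Finset E) :
    transferOp src tgt t f D = ∑ A : E → Bool, t ^ ringCount A * f (step src tgt D A) := by
  have h0 : ∀ A : E → Bool, ringCount A = 0 ↔ A = fun _ => false := by
    intro A
    simp [ringCount, card_eq_zero, filter_eq_empty_iff, funext_iff]
  have hs : step src tgt D (fun _ => false) = D := by
    ext e; simp [mem_step]
  have h1 : f D = ∑ A : E → Bool, if ringCount A = 0 then f (step src tgt D A) else 0 := by
    simp only [h0]
    rw [sum_ite_eq']
    simp [hs]
  rw [transferOp, LinearMap.add_apply, Pi.add_apply, LinearMap.smul_apply, Pi.smul_apply,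
    ringOp_apply, Module.End.one_apply, h1, smul_eq_mul, mul_sum, ← sum_add_distrib]
  refine sum_congr rfl fun A _ => ?_
  split_ifs with h
  · rw [h]; simp
  · obtain ⟨j, hj⟩ := Nat.exists_eq_succ_of_ne_zero h
    rw [hj]
    simp only [Nat.succ_eq_add_one, Nat.add_sub_cancel]
    ring

/-- The operators are defined over any commutative ring: over polynomials with `t = X` they yield
generating polynomials, which evaluation at a real number takes to the operators for that number. -/
theorem map_ringOp {R S : Type*} [CommRing R] [CommRing S] (φ : R →+* S) (t : R)
    (f : Finset E → R) (D : Finset E) :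
    φ (ringOp src tgt t f D) = ringOp src tgt (φ t) (fun D => φ (f D)) D := by
  rw [ringOp_apply, ringOp_apply, map_sum]
  refine sum_congr rfl fun A _ => ?_
  rw [map_mul]
  split_ifs <;> simp

theorem map_ringOp_pow {R S : Type*} [CommRing R] [CommRing S] (φ : R →+* S) (t : R) (j : ℕ)
    (f : Finset E → R) (D : Finset E) :
    φ ((ringOp src tgt t ^ j) f D) = (ringOp src tgt (φ t) ^ j) (fun D => φ (f D)) D := by
  induction j generalizing D with
  | zero => rfl
  | succ j ih =>
    rw [pow_succ', pow_succ', Module.End.mul_apply, Module.End.mul_apply, map_ringOp,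
      funext ih]

theorem map_transferOp {R S : Type*} [CommRing R] [CommRing S] (φ : R →+* S) (t : R)
    (f : Finset E → R) (D : Finset E) :
    φ (transferOp src tgt t f D) = transferOp src tgt (φ t) (fun D => φ (f D)) D := by
  rw [transferOp_apply, transferOp_apply, map_sum]
  simp only [map_mul, map_pow]

theorem map_transferOp_pow {R S : Type*} [CommRing R] [CommRing S] (φ : R →+* S) (t : R) (j : ℕ)
    (f : Finset E → R) (D : Finset E) :
    φ ((transferOp src tgt t ^ j) f D) = (transferOp src tgt (φ t) ^ j) (fun D => φ (f D)) D := by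
  induction j generalizing D with
  | zero => rfl
  | succ j ih =>
    rw [pow_succ', pow_succ', Module.End.mul_apply, Module.End.mul_apply, map_transferOp,
      funext ih]

theorem map_allDone {R S : Type*} [CommRing R] [CommRing S] (φ : R →+* S) :
    (fun D : Finset E => φ (allDone R D)) = allDone S := by
  funext D
  unfold allDone
  split_ifs <;> simp

/-- By the binomial theorem `N` enters only through binomial coefficients. Both the limit and the
inversion formula for the word counts use this form. -/
theorem transferOp_pow {R : Type*} [CommRing R] (t : R) (N : ℕ) (f : Finset E → R) (D : Finset E) :
    (transferOp src tgt t ^ N) f D =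
      ∑ j ∈ range (N + 1), (N.choose j : R) * (t ^ j * (ringOp src tgt t ^ j) f D) := by
  have h : (transferOp src tgt t) ^ N =
      ∑ j ∈ range (N + 1), (N.choose j : R) • (t ^ j • ringOp src tgt t ^ j) := by
    rw [transferOp, add_comm, (Commute.one_right _).add_pow]
    refine sum_congr rfl fun j _ => ?_
    rw [one_pow, mul_one, smul_pow, Nat.cast_smul_eq_nsmul, nsmul_eq_mul, Nat.cast_comm]
  rw [h]
  simp only [LinearMap.sum_apply, Finset.sum_apply, LinearMap.smul_apply, Pi.smul_apply,
    smul_eq_mul]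

/-! ### Sums over all sequences of rings -/

def extend {N : ℕ} (ω : Fin N → E → Bool) (p : ℕ) (e : E) : Bool :=
  if h : p < N then ω ⟨p, h⟩ e else false

theorem doneAt_congr {ω ω' : ℕ → E → Bool} {N : ℕ} (h : ∀ p < N, ω p = ω' p) :
    doneAt src tgt ω N = doneAt src tgt ω' N := by
  induction N with
  | zero => rfl
  | succ N ih => rw [doneAt, doneAt, ih fun p hp => h p (by omega), h N (by omega)]

theorem transferOp_pow_empty {R : Type*} [CommRing R] (t : R) (N : ℕ) (f : Finset E → R) :
    (transferOp src tgt t ^ N) f ∅ =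
      ∑ ω : Fin N → E → Bool, (∏ p, t ^ ringCount (ω p)) * f (doneAt src tgt (extend ω) N) := by
  induction N generalizing f with
  | zero => simp [doneAt]
  | succ N ih =>
    -- The operator nearest to `f` belongs to the last step in time, so sequences are extended at
    -- their end.
    rw [pow_succ, Module.End.mul_apply, ih, ← (Fin.snocEquiv fun _ : Fin (N + 1) => E → Bool).sum_comp,
      Fintype.sum_prod_type, sum_comm]
    refine sum_congr rfl fun ω _ => ?_
    rw [transferOp_apply, mul_sum]
    refine sum_congr rfl fun A _ => ?_
    set ω' := (Fin.snocEquiv fun _ : Fin (N + 1) => E → Bool) (A, ω) with hω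
    have h1 : ∀ p < N, extend ω' p = extend ω p := by
      intro p hp
      funext e
      simp [hω, extend, hp, Fin.snoc, show p < N + 1 by omega]
    have h2 : extend ω' N = A := by
      funext e
      simp [hω, extend, Fin.snoc]
    rw [doneAt, h2, doneAt_congr h1, Fin.prod_univ_castSucc]
    simp only [hω, Fin.snocEquiv_apply, Fin.snoc_castSucc, Fin.snoc_last]
    ring

/-- Edge `e` rings at a time from `s` on and before `s'`. -/
def Rings (ω : ℕ → E → Bool) (e : E) (s s' : ℕ) : Prop := ∃ p, s ≤ p ∧ p < s' ∧ ω p e = true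

theorem doneAt_mono (ω : ℕ → E → Bool) : Monotone (doneAt src tgt ω) :=
  monotone_nat_of_le_succ fun _ => subset_step _ _

theorem mem_doneAt {ω : ℕ → E → Bool} {e : E} {s : ℕ} : e ∈ doneAt src tgt ω s ↔
    ∃ p < s, ω p e = true ∧ ∀ e', tgt e' = src e → e' ∈ doneAt src tgt ω p := by
  induction s with
  | zero => simp [doneAt]
  | succ s ih =>
    rw [doneAt, mem_step, ih]
    constructor
    · rintro (⟨p, hp, h⟩ | h)
      · exact ⟨p, by omega, h⟩
      · exact ⟨s, by omega, h⟩
    · rintro ⟨p, hp, h⟩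
      rcases Nat.lt_succ_iff_lt_or_eq.1 hp with hp | rfl
      · exact .inl ⟨p, hp, h⟩
      · exact .inr h

/-- With `g v` as the first time at which all edges into `v` are finished, an edge is finished at
time `s` exactly if it rings from `g (src e)` on and before `s`. Conversely, a completion determines
these times, by induction along the edges. -/
theorem doneAt_eq_univ_iff [Finite V] (h : EdgeAcyclic src tgt) (ω : ℕ → E → Bool) (N : ℕ) :
    doneAt src tgt ω N = univ ↔
      ∃ g, (∀ v, g v ≤ N) ∧ IsCompletion src tgt (Rings ω) g := by
  constructor
  · intro hN
    have hex : ∀ v, ∃ m, ∀ s, (∀ e, tgt e = v → e ∈ doneAt src tgt ω s) ↔ m ≤ s := by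
      classical
      intro v
      have h0 : ∃ s, ∀ e, tgt e = v → e ∈ doneAt src tgt ω s := ⟨N, fun e _ => hN ▸ mem_univ e⟩
      exact ⟨Nat.find h0, fun s => ⟨fun h => Nat.find_min' _ h, fun h e he =>
        doneAt_mono ω h (Nat.find_spec h0 e he)⟩⟩
    choose g hle using hex
    have hr : ∀ e s, Rings ω e (g (src e)) s ↔ e ∈ doneAt src tgt ω s := by
      intro e s
      rw [mem_doneAt]
      simp only [hle]
      exact ⟨fun ⟨p, h1, h2, h3⟩ => ⟨p, h2, h3, h1⟩, fun ⟨p, h2, h3, h1⟩ => ⟨p, h1, h2, h3⟩⟩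
    refine ⟨g, fun v => (hle v N).1 fun e _ => hN ▸ mem_univ e,
      fun v => ⟨fun e he => (hr _ _).2 ((hle v _).2 le_rfl e he), fun s hs h' => ?_⟩⟩
    exact not_le.2 hs ((hle v s).1 fun e he => (hr _ _).1 (h' e he))
  · rintro ⟨g, hg, hc⟩
    have key : ∀ v s, (∀ e, tgt e = v → e ∈ doneAt src tgt ω s) ↔ g v ≤ s := by
      intro v
      induction v using (wellFounded_of_edgeAcyclic h).induction with
      | _ v ih =>
        intro s
        have hr : ∀ e, tgt e = v → (e ∈ doneAt src tgt ω s ↔ Rings ω e (g (src e)) s) := by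
          intro e he
          rw [mem_doneAt]
          simp only [ih (src e) (.single ⟨e, rfl, he⟩)]
          exact ⟨fun ⟨p, h2, h3, h1⟩ => ⟨p, h1, h2, h3⟩, fun ⟨p, h1, h2, h3⟩ => ⟨p, h2, h3, h1⟩⟩
        constructor
        · intro h'
          by_contra hs
          exact (hc v).2 s (not_le.1 hs) fun e he => (hr e he).1 (h' e he)
        · intro hs e he
          obtain ⟨p, h1, h2, h3⟩ := (hc v).1 e he
          exact (hr e he).2 ⟨p, h1, by omega, h3⟩
    refine eq_univ_of_forall fun e => ?_
    exact doneAt_mono ω (hg (tgt e)) ((key (tgt e) _).2 le_rfl e rfl)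

-- All sequences have total weight `(1 + t) ^ N`. In those that are silent from `s` on and before
-- `s'`, each of these `s' - s` positions contributes `1` instead of `1 + t`.
open Classical in
theorem sum_rings (t : ℝ) {N s s' : ℕ} (hs' : s' ≤ N) :
    ∑ η : Fin N → Bool, (∏ p, if η p then t else 1) *
        (if ∃ p : Fin N, s ≤ p ∧ p < s' ∧ η p = true then (1 : ℝ) else 0) =
      (1 + t) ^ N - (1 + t) ^ (N - (s' - s)) := by
  have h1 : ∀ η : Fin N → Bool, (∏ p, if η p then t else 1) *
        (if ∃ p : Fin N, s ≤ p ∧ p < s' ∧ η p = true then (1 : ℝ) else 0) =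
      (∏ p, if η p then t else 1) - ∏ p : Fin N, if η p then
        (if s ≤ p ∧ p < s' then 0 else t) else 1 := by
    intro η
    split_ifs with h
    · obtain ⟨p, h1, h2, h3⟩ := h
      rw [mul_one, eq_comm, sub_eq_self]
      exact prod_eq_zero (mem_univ p) (by simp [h1, h2, h3])
    · rw [mul_zero, eq_comm, sub_eq_zero]
      refine prod_congr rfl fun p _ => ?_
      by_cases hp : η p = true
      · rw [if_pos hp, if_pos hp, if_neg fun h' => h ⟨p, h'.1, h'.2, hp⟩]
      · rw [if_neg hp, if_neg hp]
  have h2 : ∀ F : Fin N → ℝ, ∑ η : Fin N → Bool, (∏ p, if η p then F p else 1) =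
      ∏ p, (1 + F p) := by
    intro F
    rw [← Fintype.piFinset_univ, ← prod_univ_sum (fun _ : Fin N => (univ : Finset Bool))
      fun p b => if b then F p else 1]
    refine prod_congr rfl fun p _ => ?_
    simp [add_comm]
  rw [sum_congr rfl fun η _ => h1 η, sum_sub_distrib, h2, h2]
  congr 1
  · simp
  · have h3 : ∀ p : Fin N, (1 + if s ≤ (p : ℕ) ∧ (p : ℕ) < s' then 0 else t) =
        if s ≤ (p : ℕ) ∧ (p : ℕ) < s' then 1 else 1 + t := fun p => by split_ifs <;> simp
    rw [prod_congr rfl fun p _ => h3 p, Fin.prod_univ_eq_prod_range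
      (fun p => if s ≤ p ∧ p < s' then (1 : ℝ) else 1 + t) N, prod_ite, prod_const_one, one_mul,
      prod_const]
    congr 1
    have h4 : (range N).filter (fun p => ¬ (s ≤ p ∧ p < s')) = range N \ Finset.Ico s s' := by
      ext p; simp
    rw [h4, card_sdiff_of_subset, card_range, Nat.card_Ico]
    intro p hp
    simp only [mem_Ico, mem_range] at hp ⊢
    omega

theorem letterWeight_eq_zero {N a : ℕ} (h : N < inTime a) : letterWeight N a = 0 := by
  unfold letterWeight inTime at *
  rw [if_neg]
  omega

/-- The number of sequences of `N` rings after which all edges are finished, where a sequence with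
`j` rings has weight `t ^ j`, as a sum over all letters. -/
theorem transferOp_pow_allDone [Fintype V] (h : EdgeAcyclic src tgt) (t : ℝ) {N M : ℕ}
    (hM : N < M) :
    (transferOp src tgt t ^ N) (allDone ℝ) ∅ =
      ∑ a ∈ Fintype.piFinset (fun _ : V => range (2 * M)), (∏ v, letterWeight N (a v)) *
        ∏ e, ((1 + t) ^ N - (1 + t) ^ (N - (inTime (a (tgt e)) - outTime (a (src e))))) := by
  classical
  rw [transferOp_pow_empty]
  have h1 : ∀ ω : Fin N → E → Bool, allDone ℝ (doneAt src tgt (extend ω) N) =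
      ∑ a ∈ Fintype.piFinset (fun _ : V => range (2 * M)), (∏ v, letterWeight N (a v)) *
        ∏ e, (if Rings (extend ω) e (outTime (a (src e))) (inTime (a (tgt e)))
          then (1 : ℝ) else 0) := by
    intro ω
    rw [sum_letterWeight h (fun e s s' s'' ⟨p, h1, h2, h3⟩ hs => ⟨p, h1, by omega, h3⟩) hM, allDone]
    exact if_congr (doneAt_eq_univ_iff h _ _) rfl rfl
  simp only [h1, mul_sum]
  rw [sum_comm]
  refine sum_congr rfl fun a _ => ?_
  by_cases hz : ∃ v, N < inTime (a v)
  · obtain ⟨v, hv⟩ := hz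
    rw [prod_eq_zero (mem_univ v) (letterWeight_eq_zero hv)]
    simp
  push Not at hz
  simp only [mul_left_comm _ (∏ v, letterWeight N (a v)), ← mul_sum]
  congr 1
  -- A sequence of sets of edges is a family of sequences, one for each edge, so the sum over all of
  -- them is a product over the edges.
  rw [← prod_congr rfl fun e _ => sum_rings t (s := outTime (a (src e))) (hz (tgt e)),
    prod_univ_sum, ← (Equiv.piComm fun (_ : E) (_ : Fin N) => Bool).sum_comp, Fintype.piFinset_univ]
  refine sum_congr rfl fun η _ => ?_
  have h2 : ∀ A : E → Bool, t ^ ringCount A = ∏ e, if A e then t else 1 := by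
    intro A
    rw [prod_ite, prod_const_one, mul_one, prod_const]
    rfl
  rw [prod_congr rfl fun p _ => h2 _, prod_comm, ← prod_mul_distrib]
  refine prod_congr rfl fun e _ => ?_
  congr 1
  refine if_congr ?_ rfl rfl
  constructor
  · rintro ⟨p, h1, h2, h3⟩
    have : p < N := by have := hz (tgt e); omega
    exact ⟨⟨p, this⟩, h1, h2, by simpa [extend, this] using h3⟩
  · rintro ⟨p, h1, h2, h3⟩
    exact ⟨p, h1, h2, by simpa [extend] using h3⟩

end

end CompletionTime

/-! ## Hermite interpolation in Newton form -/

namespace HermiteInterpolation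

open Polynomial

/-- The product of `X - s / μ` over all `s < k`. -/
noncomputable def nodePoly (μ : ℕ) : ℕ → ℝ[X]
  | 0 => 1
  | s + 1 => nodePoly μ s * (X - C ((s / μ : ℕ) : ℝ))

/-- The interpolation polynomial for the first conditions: `dat s` prescribes the derivative of order
`s % μ` at the point `s / μ`. -/
noncomputable def newton (μ : ℕ) (dat : ℕ → ℝ) : ℕ → ℝ[X]
  | 0 => 0
  | s + 1 => newton μ dat s +
      C ((dat s - (derivative^[s % μ] (newton μ dat s)).eval ((s / μ : ℕ) : ℝ)) /
        (derivative^[s % μ] (nodePoly μ s)).eval ((s / μ : ℕ) : ℝ)) * nodePoly μ s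

variable {μ : ℕ}

theorem natDegree_nodePoly_le (s : ℕ) : (nodePoly μ s).natDegree ≤ s := by
  induction s with
  | zero => simp [nodePoly]
  | succ s ih =>
    rw [nodePoly]
    refine natDegree_mul_le.trans ?_
    rw [natDegree_X_sub_C]
    omega

theorem natDegree_newton_le (dat : ℕ → ℝ) (s : ℕ) : (newton μ dat s).natDegree ≤ s - 1 := by
  induction s with
  | zero => simp [newton]
  | succ s ih =>
    rw [newton]
    refine natDegree_add_le_of_degree_le (ih.trans (by omega)) ?_
    exact (natDegree_C_mul_le _ _).trans (natDegree_nodePoly_le s)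

theorem nodePoly_mul (a : ℕ) (hμ : 0 < μ) :
    nodePoly μ (a * μ) = (∏ j ∈ Finset.range a, (X - C (j : ℝ))) ^ μ := by
  have h : ∀ s, nodePoly μ s = ∏ u ∈ Finset.range s, (X - C ((u / μ : ℕ) : ℝ)) := by
    intro s
    induction s with
    | zero => simp [nodePoly]
    | succ s ih => rw [nodePoly, ih, Finset.prod_range_succ]
  rw [h]
  induction a with
  | zero => simp
  | succ a ih =>
    rw [Nat.succ_mul, Finset.prod_range_add, ih, Finset.prod_range_succ, mul_pow]
    congr 1
    rw [Finset.prod_congr rfl (g := fun _ => X - C (a : ℝ)), Finset.prod_const, Finset.card_range]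
    intro u hu
    rw [mul_comm, Nat.mul_add_div hμ, Nat.div_eq_of_lt (Finset.mem_range.1 hu), add_zero]

/-- Splits off the factors at the current node. The rest does not vanish there, so the derivative by
which `newton` divides is nonzero. -/
theorem nodePoly_eq (hμ : 0 < μ) (s : ℕ) : ∃ η : ℝ[X], η.eval ((s / μ : ℕ) : ℝ) ≠ 0 ∧
    nodePoly μ s = (X - C ((s / μ : ℕ) : ℝ)) ^ (s % μ) * η := by
  have h : ∀ i < μ, nodePoly μ (s / μ * μ + i) =
      (X - C ((s / μ : ℕ) : ℝ)) ^ i * nodePoly μ (s / μ * μ) := by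
    intro i hi
    induction i with
    | zero => simp
    | succ i ih =>
      rw [← add_assoc, nodePoly, ih (by omega), pow_succ, mul_comm (s / μ) μ, Nat.mul_add_div hμ,
        Nat.div_eq_of_lt (by omega : i < μ), add_zero]
      ring
  refine ⟨nodePoly μ (s / μ * μ), ?_, ?_⟩
  · rw [nodePoly_mul _ hμ, eval_pow, eval_prod]
    refine pow_ne_zero _ (Finset.prod_ne_zero_iff.2 fun j hj => ?_)
    rw [eval_sub, eval_X, eval_C, sub_ne_zero]
    exact_mod_cast (Finset.mem_range.1 hj).ne'
  · rw [← h _ (Nat.mod_lt _ hμ), mul_comm, Nat.div_add_mod]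

theorem eval_derivative_mul (a : ℝ) (i : ℕ) (g : ℝ[X]) :
    (derivative^[i] ((X - C a) ^ i * g)).eval a = i.factorial * g.eval a := by
  have := aeval_iterate_derivative_self ((X - C a) ^ i * g) i a (p' := g) (by simp)
  rw [coe_aeval_eq_eval] at this
  rw [this, nsmul_eq_mul]

/-- If the error after `s` conditions is `nodePoly μ s * g`, then the next Newton coefficient is the
value of `g` at the node. What remains of `g` has a root there, which supplies the next factor. -/
theorem nodePoly_dvd (hμ : 0 < μ) {q : ℝ[X]} {dat : ℕ → ℝ}
    (h : ∀ s, dat s = (derivative^[s % μ] q).eval ((s / μ : ℕ) : ℝ)) (s : ℕ) :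
    nodePoly μ s ∣ q - newton μ dat s := by
  induction s with
  | zero => simp [nodePoly]
  | succ s ih =>
    obtain ⟨g, hg⟩ := ih
    obtain ⟨η, h0, hη⟩ := nodePoly_eq hμ s
    set a : ℝ := ((s / μ : ℕ) : ℝ) with ha
    have hf : ((s % μ).factorial : ℝ) ≠ 0 := by positivity
    have hc : (dat s - (derivative^[s % μ] (newton μ dat s)).eval a) /
        (derivative^[s % μ] (nodePoly μ s)).eval a = g.eval a := by
      rw [h, ← ha, ← eval_sub, ← iterate_derivative_sub, hg, hη, mul_assoc, eval_derivative_mul,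
        eval_derivative_mul, eval_mul]
      field_simp
    obtain ⟨r, hr⟩ : X - C a ∣ g - C (g.eval a) := by
      rw [dvd_iff_isRoot]; simp
    refine ⟨r, ?_⟩
    rw [newton, nodePoly, ← ha, hc, mul_assoc, ← hr, mul_sub, ← hg]
    ring

/-- The error is divisible by a monic polynomial of degree `K` and has smaller degree itself. -/
theorem eq_newton {q : ℝ[X]} {K : ℕ} (hq : q.natDegree < K) :
    newton 1 (fun s => q.eval (s : ℝ)) K = q := by
  have h := nodePoly_dvd one_pos (q := q) (dat := fun s => q.eval (s : ℝ)) (by simp [Nat.mod_one]) K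
  have hm : (nodePoly 1 K).Monic := by
    have := nodePoly_mul K one_pos
    rw [mul_one, pow_one] at this
    rw [this]
    exact monic_prod_of_monic _ _ fun j _ => monic_X_sub_C _
  have hd : (nodePoly 1 K).natDegree = K := by
    have := nodePoly_mul K one_pos
    rw [mul_one, pow_one] at this
    rw [this, natDegree_prod_of_monic _ _ fun j _ => monic_X_sub_C _]
    simp only [natDegree_X_sub_C, Finset.sum_const, Finset.card_range, smul_eq_mul, mul_one]
  symm
  rw [← sub_eq_zero]
  by_contra hne
  have h1 := natDegree_le_of_dvd h hne
  have h2 := natDegree_sub_le q (newton 1 (fun s => q.eval (s : ℝ)) K)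
  have h3 := natDegree_newton_le (μ := 1) (fun s => q.eval (s : ℝ)) K
  omega

/-- The interpolant depends linearly on the data, so it commutes with infinite sums. All functionals
`Λ` are treated at once because the induction also needs the functional that evaluates the
derivative at the current node. -/
theorem hasSum_newton {a : ℕ → ℝ} {dats : ℕ → ℕ → ℝ} {dat : ℕ → ℝ}
    (h : ∀ s, HasSum (fun r => a r * dats r s) (dat s)) (s : ℕ) (Λ : ℝ[X] →ₗ[ℝ] ℝ) :
    HasSum (fun r => a r * Λ (newton μ (dats r) s)) (Λ (newton μ dat s)) := by
  induction s generalizing Λ with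
  | zero => simp [newton]
  | succ s ih =>
    have h1 := ih Λ
    have h2 := ih ((leval ((s / μ : ℕ) : ℝ)).comp (derivative ^ (s % μ)))
    have h3 := h1.add (((h s).sub h2).mul_right
      (Λ (nodePoly μ s) / (derivative^[s % μ] (nodePoly μ s)).eval ((s / μ : ℕ) : ℝ)))
    have e : ∀ d : ℕ → ℝ, Λ (newton μ d (s + 1)) = Λ (newton μ d s) +
        (d s - (derivative^[s % μ] (newton μ d s)).eval ((s / μ : ℕ) : ℝ)) *
        (Λ (nodePoly μ s) / (derivative^[s % μ] (nodePoly μ s)).eval ((s / μ : ℕ) : ℝ)) := by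
      intro d
      rw [newton, map_add, ← smul_eq_C_mul, map_smul, smul_eq_mul]
      ring
    rw [e]
    simp only [LinearMap.comp_apply, Module.End.pow_apply, leval_apply] at h3
    refine h3.congr_fun fun r => ?_
    rw [e]
    ring

/-- The power series of `exp (y * x)`, differentiated `i` times in `y`; the terms with `r < i`
vanish. -/
theorem hasSum_exp_derivative (x y : ℝ) (i : ℕ) :
    HasSum (fun r : ℕ => x ^ r / r.factorial * (derivative^[i] (X ^ r : ℝ[X])).eval y)
      (x ^ i * Real.exp (y * x)) := by
  have h0 : ∀ r < i, (derivative^[i] (X ^ r : ℝ[X])).eval y = 0 := fun r hr => by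
    rw [iterate_derivative_X_pow_eq_natCast_mul, Nat.descFactorial_of_lt hr]; simp
  rw [← hasSum_nat_add_iff' i, Finset.sum_eq_zero fun r hr => by
    rw [h0 r (Finset.mem_range.1 hr), mul_zero], sub_zero]
  have h1 := (NormedSpace.expSeries_div_hasSum_exp (𝔸 := ℝ) (y * x)).mul_left (x ^ i)
  rw [← Real.exp_eq_exp_ℝ] at h1
  refine h1.congr_fun fun r => ?_
  rw [iterate_derivative_X_pow_eq_natCast_mul]
  simp only [eval_mul, eval_natCast, eval_pow, eval_X, Nat.add_sub_cancel]
  have h2 : ((r + i).factorial : ℝ) = r.factorial * (r + i).descFactorial i := by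
    have := Nat.factorial_mul_descFactorial (show i ≤ r + i by omega)
    rw [Nat.add_sub_cancel] at this
    exact_mod_cast this.symm
  have h3 : ((r + i).descFactorial i : ℝ) ≠ 0 := by
    have := Nat.pow_sub_le_descFactorial (r + i) i
    have : (r + i).descFactorial i ≠ 0 := by
      rw [Ne, Nat.descFactorial_eq_zero_iff_lt]; omega
    exact_mod_cast this
  have h4 : (r.factorial : ℝ) ≠ 0 := by positivity
  rw [h2]
  field_simp
  ring

end HermiteInterpolation

/-! ### Word counts and a finite formula for their exponential generating function -/

namespace CompletionTime

open Finset Polynomial HermiteInterpolation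

section
variable {V E : Type*} [DecidableEq V] [Fintype E] [DecidableEq E] (src tgt : E → V)

/-- The generating polynomial of the sequences of `N` rings after which all edges are finished. -/
noncomputable def ringPoly (N : ℕ) : ℝ[X] := (transferOp src tgt X ^ N) (allDone ℝ[X]) ∅

/-- The number of sequences of `r` single rings after which all edges are finished. -/
noncomputable def wordCount (r : ℕ) : ℝ := (ringOp src tgt 0 ^ r) (allDone ℝ) ∅

variable {src tgt}

theorem eval_ringPoly (N : ℕ) (t : ℝ) :
    (ringPoly src tgt N).eval t = (transferOp src tgt t ^ N) (allDone ℝ) ∅ := by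
  rw [← coe_evalRingHom, ringPoly, map_transferOp_pow, map_allDone, coe_evalRingHom, eval_X]

theorem ringCount_le {E : Type*} [Fintype E] (A : E → Bool) : ringCount A ≤ Fintype.card E := card_filter_le _ _

theorem natDegree_ringPoly_le (N : ℕ) : (ringPoly src tgt N).natDegree ≤ N * Fintype.card E := by
  rw [ringPoly, transferOp_pow_empty]
  refine natDegree_sum_le_of_forall_le _ _ fun ω _ => ?_
  refine natDegree_mul_le.trans ?_
  have h1 : (allDone ℝ[X] (doneAt src tgt (extend ω) N)).natDegree = 0 := by
    unfold allDone; split_ifs <;> simp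
  rw [h1, add_zero]
  refine (natDegree_prod_le _ _).trans ?_
  refine (sum_le_card_nsmul _ _ (Fintype.card E) fun p _ => ?_).trans (by simp)
  rw [natDegree_X_pow]
  exact ringCount_le _

/-- Binomial coefficients with `j > N` vanish, so the range of summation can be chosen independently
of `N`, as differences in `N` require. -/
theorem coeff_ringPoly {N r : ℕ} (h : N ≤ r) : (ringPoly src tgt N).coeff r =
    ∑ j ∈ range (r + 1), (N.choose j : ℝ) *
      ((ringOp src tgt X ^ j) (allDone ℝ[X]) ∅).coeff (r - j) := by
  rw [ringPoly, transferOp_pow, finsetSum_coeff]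
  rw [← sum_subset (range_mono (by omega : N + 1 ≤ r + 1))]
  · refine sum_congr rfl fun j hj => ?_
    have hj' := mem_range.1 hj
    rw [← C_eq_natCast, coeff_C_mul]
    congr 1
    conv_lhs => rw [show r = (r - j) + j by omega, coeff_X_pow_mul]
  · intro j _ hj
    rw [mem_range] at hj
    rw [Nat.choose_eq_zero_of_lt (by omega)]
    simp

/-- In the coefficient of `X ^ r`, the number `N` occurs only in `N.choose j`. The `r`-th difference
at zero selects the term `j = r`, which is the constant coefficient of the `r`-th power of `ringOp`,
that is, its value at `t = 0`. -/
theorem wordCount_eq (r : ℕ) : wordCount src tgt r =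
    ∑ N ∈ range (r + 1), (-1) ^ (r - N) * (r.choose N : ℝ) * (ringPoly src tgt N).coeff r := by
  have h1 : ∀ N ∈ range (r + 1), (-1) ^ (r - N) * (r.choose N : ℝ) * (ringPoly src tgt N).coeff r =
      ∑ j ∈ range (r + 1), ((-1) ^ (r - N) * (r.choose N : ℝ) * N.choose j) *
      ((ringOp src tgt X ^ j) (allDone ℝ[X]) ∅).coeff (r - j) := by
    intro N hN
    rw [coeff_ringPoly (by have := mem_range.1 hN; omega), mul_sum]
    exact sum_congr rfl fun j _ => (mul_assoc _ _ _).symm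
  rw [sum_congr rfl h1, sum_comm]
  simp only [← sum_mul]
  have h2 : ∀ j, ∑ N ∈ range (r + 1), (-1) ^ (r - N) * (r.choose N : ℝ) * N.choose j =
      if r = j then 1 else 0 := by
    intro j
    have := fwdDiff_iter_choose_zero j r
    rw [fwdDiff_iter_eq_sum_shift] at this
    have := congrArg (fun z : ℤ => (z : ℝ)) this
    simpa using this
  simp only [h2, ite_mul, one_mul, zero_mul, sum_ite_eq, mem_range, Nat.lt_succ_self, if_true,
    Nat.sub_self]
  rw [coeff_zero_eq_eval_zero, ← coe_evalRingHom, map_ringOp_pow, map_allDone, coe_evalRingHom,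
    eval_X, wordCount]

/-! ### The annihilating polynomial -/

/-- A set of `j` ringing edges has weight `0 ^ (j - 1)`, so exactly the singletons survive. -/
theorem ringOp_zero_apply (f : Finset E → ℝ) (D : Finset E) :
    ringOp src tgt 0 f D = ∑ e, f (step src tgt D fun e' => decide (e' = e)) := by
  rw [ringOp_apply]
  have h : ∀ A : E → Bool, ((if ringCount A = 0 then 0 else (0 : ℝ) ^ (ringCount A - 1)) =
      if ringCount A = 1 then 1 else 0) := by
    intro A
    split_ifs with h1 h2 h2
    · omega
    · rfl
    · rw [h2]; simp
    · exact zero_pow (by omega)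
  simp only [h, ite_mul, one_mul, zero_mul]
  rw [← sum_filter]
  symm
  refine sum_bij (fun e _ e' => decide (e' = e)) ?_ ?_ ?_ ?_
  · intro e _
    simp [ringCount, card_eq_one, Finset.ext_iff]
  · intro e _ e' _ hee
    simpa using congrFun hee e
  · intro A hA
    rw [mem_filter, ringCount, card_eq_one] at hA
    obtain ⟨e, he⟩ := hA.2
    refine ⟨e, mem_univ _, funext fun e' => ?_⟩
    have := congrArg (e' ∈ ·) he
    simp only [mem_filter, mem_univ, true_and, mem_singleton, eq_iff_iff] at this
    by_cases h' : e' = e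
    · simpa [h'] using h'.symm ▸ (this.2 h')
    · have : A e' ≠ true := fun h'' => h' (this.1 h'')
      simpa [h'] using this
  · intro e _
    rfl

-- A ring that changes `D` leads to a larger set, where `f` vanishes together with its images. So at
-- `D` the operator acts as the number of edges whose ring changes nothing; this is the triangular
-- structure.
open Classical in
theorem aeval_ringOp_apply {s : ℕ} {f : Finset E → ℝ} (hf : ∀ D, s ≤ D.card → f D = 0) (q : ℝ[X])
    {D : Finset E} (hD : s ≤ D.card + 1) : aeval (ringOp src tgt (0 : ℝ)) q f D =
      q.eval (((univ.filter fun e => step src tgt D (fun e' => decide (e' = e)) = D).card : ℕ) : ℝ) *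
        f D := by
  induction q using Polynomial.induction_on generalizing D with
  | C a => simp [Module.algebraMap_end_apply]
  | add p q hp hq => rw [map_add, LinearMap.add_apply, Pi.add_apply, hp hD, hq hD, eval_add, add_mul]
  | monomial n a ih =>
    rw [pow_succ, ← mul_assoc, mul_comm _ X, map_mul, Module.End.mul_apply, aeval_X,
      ringOp_zero_apply, eval_mul, eval_X, mul_assoc, ← ih hD]
    have : ∀ e, aeval (ringOp src tgt (0 : ℝ)) (C a * X ^ n) f (step src tgt D fun e' => decide (e' = e)) =
        if step src tgt D (fun e' => decide (e' = e)) = D then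
          aeval (ringOp src tgt (0 : ℝ)) (C a * X ^ n) f D else 0 := by
      intro e
      split_ifs with h
      · rw [h]
      · have : D.card < (step src tgt D fun e' => decide (e' = e)).card :=
          card_lt_card ((subset_step _ _).ssubset_of_ne (Ne.symm h))
        rw [ih (by omega), hf _ (by omega), mul_zero]
    rw [sum_congr rfl fun e _ => this e, ← sum_filter, sum_const, nsmul_eq_mul]

/-- The diagonal entry at `D` is one of `0, …, m`, with `m` the number of edges, hence a root of the
product. Each factor of the power thus lowers by one the size from which on the function vanishes,
and after `m + 1` factors nothing is left. -/
theorem aeval_ringOp_eq_zero {q : ℝ[X]}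
    (h : (∏ j ∈ range (Fintype.card E + 1), (X - C (j : ℝ))) ^ (Fintype.card E + 1) ∣ q) :
    aeval (ringOp src tgt (0 : ℝ)) q = 0 := by
  obtain ⟨g, rfl⟩ := h
  rw [mul_comm (_ ^ _) g, map_mul]
  suffices hs : ∀ s (f : Finset E → ℝ), (∀ D, s ≤ D.card → f D = 0) →
      aeval (ringOp src tgt (0 : ℝ)) ((∏ j ∈ range (Fintype.card E + 1), (X - C (j : ℝ))) ^ s) f = 0 by
    refine LinearMap.ext fun f => ?_
    rw [Module.End.mul_apply, hs _ f, map_zero, LinearMap.zero_apply]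
    intro D hD
    have := card_le_univ D
    omega
  intro s
  induction s with
  | zero => intro f hf; funext D; simpa using hf D (Nat.zero_le _)
  | succ s ih =>
    intro f hf
    rw [pow_succ, map_mul, Module.End.mul_apply]
    refine ih _ fun D hD => ?_
    classical
    rw [aeval_ringOp_apply hf _ (by omega), eval_prod]
    refine mul_eq_zero_of_left (prod_eq_zero (i := (univ.filter fun e =>
      step src tgt D (fun e' => decide (e' = e)) = D).card) ?_ (by simp)) _
    rw [mem_range, Nat.lt_succ_iff]
    exact card_filter_le _ _

variable (src tgt) in
/-- The linear functional that takes `X ^ r` to `wordCount r`. -/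
noncomputable def wordFunctional : ℝ[X] →ₗ[ℝ] ℝ :=
  (LinearMap.proj (∅ : Finset E)).comp
    ((LinearMap.applyₗ (allDone ℝ)).comp (aeval (ringOp src tgt (0 : ℝ))).toLinearMap)

theorem wordFunctional_apply (q : ℝ[X]) :
    wordFunctional src tgt q = aeval (ringOp src tgt (0 : ℝ)) q (allDone ℝ) ∅ := rfl

theorem wordFunctional_eq_sum {q : ℝ[X]} {R : ℕ} (hq : q.natDegree < R) :
    wordFunctional src tgt q = ∑ r ∈ range R, q.coeff r * wordCount src tgt r := by
  conv_lhs => rw [q.as_sum_range' R hq, map_sum]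
  refine sum_congr rfl fun r _ => ?_
  rw [← C_mul_X_pow_eq_monomial, ← smul_eq_C_mul, map_smul, smul_eq_mul, wordFunctional_apply,
    map_pow, aeval_X]
  rfl

/-- The exponential generating function of the word counts, by interpolation. -/
theorem hasSum_wordCount (x : ℝ) :
    HasSum (fun r : ℕ => x ^ r / r.factorial * wordCount src tgt r)
      (∑ r ∈ range ((Fintype.card E + 1) * (Fintype.card E + 1)),
        (newton (Fintype.card E + 1) (fun s => x ^ (s % (Fintype.card E + 1)) *
          Real.exp ((s / (Fintype.card E + 1) : ℕ) * x))
          ((Fintype.card E + 1) * (Fintype.card E + 1))).coeff r * wordCount src tgt r) := by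
  set μ := Fintype.card E + 1 with hμ
  rw [← wordFunctional_eq_sum ((natDegree_newton_le _ _).trans_lt
    (by have : 0 < μ * μ := by positivity
        omega))]
  refine (hasSum_newton (a := fun r : ℕ => x ^ r / r.factorial) (dats := fun r s =>
    (derivative^[s % μ] (X ^ r : ℝ[X])).eval ((s / μ : ℕ) : ℝ))
    (fun s => hasSum_exp_derivative x _ _) (μ * μ) (wordFunctional src tgt)).congr_fun fun r => ?_
  -- The monomial `X ^ r` and its interpolant differ by a multiple of the annihilating polynomial,
  -- so the functional takes both to the word count.
  congr 1
  have h := nodePoly_dvd (μ := μ) (by omega) (q := X ^ r) (dat := fun s =>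
    (derivative^[s % μ] (X ^ r : ℝ[X])).eval ((s / μ : ℕ) : ℝ)) (fun _ => rfl) (μ * μ)
  rw [nodePoly_mul _ (by omega)] at h
  have h0 := aeval_ringOp_eq_zero (src := src) (tgt := tgt) h
  have h1 : wordFunctional src tgt (X ^ r - newton μ (fun s =>
    (derivative^[s % μ] (X ^ r : ℝ[X])).eval ((s / μ : ℕ) : ℝ)) (μ * μ)) = 0 := by
    rw [wordFunctional_apply, h0]
    rfl
  rw [map_sub, sub_eq_zero] at h1
  rw [← h1, wordFunctional_apply, map_pow, aeval_X]
  rfl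

end

end CompletionTime

/-! ### The limit of short time steps -/

namespace CompletionTime

open Finset Polynomial Filter Topology

section
variable {V E : Type*} [DecidableEq V] [Fintype E] [DecidableEq E] {src tgt : E → V}

/-- There are `2 ^ m` sets of ringing edges, each of weight at most one. This provides the
dominating series for the limit. -/
theorem abs_ringOp_pow_le {t : ℝ} (h0 : 0 ≤ t) (h1 : t ≤ 1) (j : ℕ) (D : Finset E) :
    |(ringOp src tgt t ^ j) (allDone ℝ) D| ≤ (2 ^ Fintype.card E : ℝ) ^ j := by
  induction j generalizing D with
  | zero =>
    simp only [pow_zero, Module.End.one_apply, allDone]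
    split_ifs <;> simp
  | succ j ih =>
    rw [pow_succ', Module.End.mul_apply, ringOp_apply]
    refine (abs_sum_le_sum_abs _ _).trans ((sum_le_card_nsmul _ _
      ((2 ^ Fintype.card E : ℝ) ^ j) fun A _ => ?_).trans (le_of_eq ?_))
    · have h2 : |(if ringCount A = 0 then 0 else t ^ (ringCount A - 1))| ≤ 1 := by
        split_ifs
        · simp
        · rw [abs_of_nonneg (pow_nonneg h0 _)]
          exact pow_le_one₀ h0 h1
      rw [abs_mul]
      exact (mul_le_of_le_one_left (abs_nonneg _) h2).trans (ih _)
    · simp [pow_succ']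

/-- The Poisson limit of binomial terms: each of the `j` factors `(N i - a) * t i` of the falling
factorial tends to `x`, since a fixed shift `a` disappears with `t i`. -/
theorem tendsto_choose_mul_pow {x : ℝ} {t : ℕ → ℝ} {N : ℕ → ℕ} (ht : Tendsto t atTop (𝓝 0))
    (hN : Tendsto (fun i => N i * t i) atTop (𝓝 x)) (h0 : ∀ᶠ i in atTop, 0 ≤ t i) (j : ℕ) :
    Tendsto (fun i => ((N i).choose j : ℝ) * t i ^ j) atTop (𝓝 (x ^ j / j.factorial)) := by
  have h : Tendsto (fun i => ((N i).descFactorial j : ℝ) * t i ^ j) atTop (𝓝 (x ^ j)) := by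
    induction j with
    | zero => simp
    | succ j ih =>
      have h1 : Tendsto (fun i => ((N i - j : ℕ) : ℝ) * t i) atTop (𝓝 x) := by
        have h2 : Tendsto (fun i => (N i * t i) - j * t i) atTop (𝓝 (x - j * 0)) :=
          hN.sub (ht.const_mul _)
        rw [mul_zero, sub_zero] at h2
        refine tendsto_of_tendsto_of_tendsto_of_le_of_le' h2 hN ?_ ?_
        · filter_upwards [h0] with i hi
          rw [← sub_mul]
          refine mul_le_mul_of_nonneg_right ?_ hi
          have : N i ≤ N i - j + j := by omega
          have : (N i : ℝ) ≤ ((N i - j : ℕ) : ℝ) + j := by exact_mod_cast this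
          linarith
        · filter_upwards [h0] with i hi
          exact mul_le_mul_of_nonneg_right (by exact_mod_cast Nat.sub_le _ _) hi
      refine (h1.mul ih).congr (fun i => ?_) |>.trans (by rw [pow_succ'])
      rw [Nat.descFactorial_succ]
      push_cast
      ring
  refine (h.div_const _).congr fun i => ?_
  rw [Nat.descFactorial_eq_factorial_mul_choose]
  have : (j.factorial : ℝ) ≠ 0 := by positivity
  push_cast
  field_simp

/-- Dominated convergence in the binomial expansion: the binomial terms tend to `x ^ j / j!`, and
the powers of `ringOp` are polynomials in `t`, hence continuous at zero. Eventually `N i * t i ≤ x +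
1` and `t i ≤ 1`, which explains the bound. -/
theorem tendsto_eval_ringPoly {x : ℝ} {t : ℕ → ℝ} {N : ℕ → ℕ} (ht : Tendsto t atTop (𝓝 0))
    (hN : Tendsto (fun i => N i * t i) atTop (𝓝 x)) (h0 : ∀ᶠ i in atTop, 0 ≤ t i) :
    Tendsto (fun i => (ringPoly src tgt (N i)).eval (t i)) atTop
      (𝓝 (∑' r : ℕ, x ^ r / r.factorial * wordCount src tgt r)) := by
  have h1 : ∀ i, (ringPoly src tgt (N i)).eval (t i) = ∑' j : ℕ, ((N i).choose j : ℝ) * t i ^ j *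
      (ringOp src tgt (t i) ^ j) (allDone ℝ) ∅ := by
    intro i
    rw [eval_ringPoly, transferOp_pow, tsum_eq_sum (s := range (N i + 1))]
    · exact sum_congr rfl fun j _ => (mul_assoc _ _ _).symm
    · intro j hj
      rw [mem_range] at hj
      rw [Nat.choose_eq_zero_of_lt (by omega)]
      simp
  simp only [h1]
  refine tendsto_tsum_of_dominated_convergence
    (bound := fun j => ((x + 1) * 2 ^ Fintype.card E) ^ j / j.factorial)
    (Real.summable_pow_div_factorial _) (fun j => ?_) ?_
  · refine (tendsto_choose_mul_pow ht hN h0 j).mul ?_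
    have h2 : ∀ s : ℝ, (ringOp src tgt s ^ j) (allDone ℝ) ∅ =
        ((ringOp src tgt X ^ j) (allDone ℝ[X]) ∅).eval s := by
      intro s
      rw [← coe_evalRingHom, map_ringOp_pow, map_allDone, coe_evalRingHom, eval_X]
    simp only [wordCount, h2]
    exact ((Polynomial.continuous _).tendsto 0).comp ht
  · filter_upwards [h0, ht.eventually_le_const one_pos, hN.eventually_le_const (lt_add_one x)]
      with i hi hi1 hiN j
    rw [norm_mul, Real.norm_eq_abs, Real.norm_eq_abs]
    have h3 : |((N i).choose j : ℝ) * t i ^ j| ≤ (x + 1) ^ j / j.factorial := by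
      rw [abs_of_nonneg (by positivity)]
      calc ((N i).choose j : ℝ) * t i ^ j ≤ (N i : ℝ) ^ j / j.factorial * t i ^ j :=
            mul_le_mul_of_nonneg_right (Nat.choose_le_pow_div _ _) (by positivity)
        _ = (N i * t i) ^ j / j.factorial := by rw [mul_pow]; ring
        _ ≤ (x + 1) ^ j / j.factorial := by gcongr
    refine (mul_le_mul h3 (abs_ringOp_pow_le hi hi1 j ∅) (abs_nonneg _) ?_).trans (le_of_eq ?_)
    · exact (abs_nonneg _).trans h3
    · rw [mul_pow]; ring

end

end CompletionTime

/-! ## Longest paths and potentials -/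

namespace LongestPath

variable {V : Type*} {G : Digraph V} {ℓ : V × V → ℝ}

/-- There is a walk of length `r` from `u` to `v`. -/
inductive WalkLength (G : Digraph V) (ℓ : V × V → ℝ) (u : V) : V → ℝ → Prop
  | refl : WalkLength G ℓ u u 0
  | tail {v w : V} {r : ℝ} : WalkLength G ℓ u v r → G.Adj v w → WalkLength G ℓ u w (r + ℓ (v, w))

theorem WalkLength.trans {u v w : V} {r r' : ℝ} (h : WalkLength G ℓ u v r)
    (h' : WalkLength G ℓ v w r') : WalkLength G ℓ u w (r + r') := by
  induction h' with
  | refl => rwa [add_zero]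
  | tail _ e ih => rw [← add_assoc]; exact ih.tail e

theorem pathLength_append_singleton (p : List V) (v w : V) (h : p.getLast? = some v) :
    pathLength ℓ (p ++ [w]) = pathLength ℓ p + ℓ (v, w) := by
  induction p with
  | nil => simp at h
  | cons a p ih =>
    cases p with
    | nil =>
      simp only [List.getLast?_singleton, Option.some.injEq] at h
      subst h
      simp [pathLength]
    | cons b p =>
      rw [List.getLast?_cons_cons] at h
      have := ih h
      simp only [pathLength, List.cons_append, List.tail_cons, List.zip_cons_cons, List.map_cons,
        List.sum_cons] at this ⊢
      rw [this, add_assoc]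

theorem WalkLength.exists_list {u v : V} {r : ℝ} (h : WalkLength G ℓ u v r) :
    ∃ p : List V, p.IsChain G.Adj ∧ p.head? = some u ∧ p.getLast? = some v ∧
      pathLength ℓ p = r := by
  induction h with
  | refl => exact ⟨[u], by simp, rfl, rfl, by simp [pathLength]⟩
  | @tail v w r _ e ih =>
    obtain ⟨p, hp, hh, hl, rfl⟩ := ih
    refine ⟨p ++ [w], ?_, ?_, by simp, pathLength_append_singleton p v w hl⟩
    · rw [List.isChain_append]
      refine ⟨hp, by simp, ?_⟩
      intro a ha b hb
      rw [hl] at ha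
      simp only [Option.mem_def, Option.some.injEq, List.head?_cons] at ha hb
      rw [← ha, ← hb]
      exact e
    · cases p with
      | nil => simp at hh
      | cons a p => simpa using hh

theorem nodup_of_isChain (hG : Acyclic G) {p : List V} (hp : p.IsChain G.Adj) : p.Nodup := by
  have h : p.Pairwise (Relation.TransGen G.Adj) :=
    List.isChain_iff_pairwise.1 (hp.imp fun _ _ h => Relation.TransGen.single h)
  exact h.imp fun {a b} hab => by
    rintro rfl
    exact hG a hab

theorem wellFounded_transGen [Finite V] (hG : Acyclic G) :
    WellFounded (Relation.TransGen G.Adj) := by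
  have : Std.Irrefl (Relation.TransGen G.Adj) := ⟨hG⟩
  exact Finite.wellFounded_of_trans_of_irrefl _

theorem wellFounded_swap_transGen [Finite V] (hG : Acyclic G) :
    WellFounded (Function.swap (Relation.TransGen G.Adj)) := by
  have : Std.Irrefl (Function.swap (Relation.TransGen G.Adj)) := ⟨hG⟩
  have : IsTrans V (Function.swap (Relation.TransGen G.Adj)) := ⟨fun _ _ _ h h' => h'.trans h⟩
  exact Finite.wellFounded_of_trans_of_irrefl _

theorem exists_walkLength_source [Finite V] (hG : Acyclic G) (hℓ : ∀ e ∈ edgeSet G, 0 ≤ ℓ e)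
    (v : V) : ∃ s r, IsSource G s ∧ 0 ≤ r ∧ WalkLength G ℓ s v r := by
  induction v using (wellFounded_transGen hG).induction with
  | _ v ih =>
    by_cases h : IsSource G v
    · exact ⟨v, 0, h, le_rfl, .refl⟩
    · obtain ⟨u, hu⟩ := not_forall_not.1 h
      obtain ⟨s, r, hs, hr, hw⟩ := ih u (.single hu)
      exact ⟨s, _, hs, add_nonneg hr (hℓ (u, v) hu), hw.tail hu⟩

theorem exists_walkLength_terminal [Finite V] (hG : Acyclic G) (hℓ : ∀ e ∈ edgeSet G, 0 ≤ ℓ e)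
    (v : V) : ∃ s r, IsTerminal G s ∧ 0 ≤ r ∧ WalkLength G ℓ v s r := by
  induction v using (wellFounded_swap_transGen hG).induction with
  | _ v ih =>
    by_cases h : IsTerminal G v
    · exact ⟨v, 0, h, le_rfl, .refl⟩
    · obtain ⟨u, hu⟩ := not_forall_not.1 h
      obtain ⟨s, r, hs, hr, hw⟩ := ih u (.single hu)
      exact ⟨s, _, hs, add_nonneg (hℓ (v, u) hu) hr, by
        simpa only [zero_add] using (WalkLength.refl.tail hu).trans hw⟩

/-- With nonnegative lengths a walk does not get shorter when it is extended backwards to a source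
and forwards to a terminal, and acyclicity makes the result a path. -/
theorem WalkLength.le_longestPathLength [Finite V] (hG : Acyclic G)
    (hℓ : ∀ e ∈ edgeSet G, 0 ≤ ℓ e) {u v : V} {r : ℝ} (h : WalkLength G ℓ u v r) :
    r ≤ longestPathLength G ℓ := by
  have : Nonempty V := ⟨u⟩
  obtain ⟨s, r₁, hs, h1, w1⟩ := exists_walkLength_source hG hℓ u
  obtain ⟨t, r₂, ht, h2, w2⟩ := exists_walkLength_terminal hG hℓ v
  obtain ⟨p, hp, hh, hl, hr⟩ := ((w1.trans h).trans w2).exists_list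
  have := (isGreatest_longestPathLength hG ℓ).2
    ⟨p, ⟨nodup_of_isChain hG hp, hp, ⟨s, hh, hs⟩, ⟨t, hl, ht⟩⟩, hr⟩
  linarith

/-- The lengths of the longest walks are a potential. -/
theorem exists_potential [Finite V] (hG : Acyclic G) (hℓ : ∀ e ∈ edgeSet G, 0 ≤ ℓ e) :
    ∃ g : V → ℝ, (∀ v, 0 ≤ g v ∧ g v ≤ longestPathLength G ℓ) ∧
      ∀ u v, G.Adj u v → g u + ℓ (u, v) ≤ g v := by
  have hb : ∀ v, BddAbove {r | ∃ u, WalkLength G ℓ u v r} := fun v =>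
    ⟨longestPathLength G ℓ, fun r ⟨u, h⟩ => h.le_longestPathLength hG hℓ⟩
  have h0 : ∀ v, (0 : ℝ) ∈ {r | ∃ u, WalkLength G ℓ u v r} := fun v => ⟨v, .refl⟩
  refine ⟨fun v => sSup {r | ∃ u, WalkLength G ℓ u v r}, fun v => ⟨le_csSup (hb v) (h0 v),
    csSup_le ⟨0, h0 v⟩ fun r ⟨u, h⟩ => h.le_longestPathLength hG hℓ⟩, fun u v e => ?_⟩
  rw [← le_sub_iff_add_le]
  refine csSup_le ⟨0, h0 u⟩ fun r ⟨w, h⟩ => ?_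
  rw [le_sub_iff_add_le]
  exact le_csSup (hb v) ⟨w, h.tail e⟩

theorem pathLength_le_of_potential {g : V → ℝ} (hg : ∀ u v, G.Adj u v → g u + ℓ (u, v) ≤ g v)
    {p : List V} (hp : p.IsChain G.Adj) {s t : V} (hs : p.head? = some s)
    (ht : p.getLast? = some t) : pathLength ℓ p ≤ g t - g s := by
  induction p generalizing s with
  | nil => simp at hs
  | cons a p ih =>
    obtain rfl : a = s := by simpa using hs
    cases p with
    | nil =>
      obtain rfl : a = t := by simpa using ht
      simp [pathLength]
    | cons b p =>
      rw [List.isChain_cons_cons] at hp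
      rw [List.getLast?_cons_cons] at ht
      have h1 := ih hp.2 rfl ht
      have h2 := hg a b hp.1
      simp only [pathLength, List.tail_cons, List.zip_cons_cons, List.map_cons,
        List.sum_cons] at h1 ⊢
      linarith

theorem longestPathLength_le_of_potential [Finite V] [Nonempty V] (hG : Acyclic G) {g : V → ℝ}
    {x : ℝ} (h0 : ∀ v, 0 ≤ g v) (hx : ∀ v, g v ≤ x)
    (hg : ∀ u v, G.Adj u v → g u + ℓ (u, v) ≤ g v) : longestPathLength G ℓ ≤ x := by
  obtain ⟨p, hp, h⟩ := (isGreatest_longestPathLength hG ℓ).1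
  obtain ⟨s, hs, -⟩ := hp.source
  obtain ⟨t, ht, -⟩ := hp.terminal
  rw [← h]
  have := pathLength_le_of_potential hg hp.chain hs ht
  linarith [h0 s, hx t]

theorem pathLength_congr {ℓ' : V × V → ℝ} (h : ∀ e ∈ edgeSet G, ℓ e = ℓ' e) {p : List V}
    (hp : p.IsChain G.Adj) : pathLength ℓ p = pathLength ℓ' p := by
  induction p with
  | nil => rfl
  | cons a p ih =>
    cases p with
    | nil => rfl
    | cons b p =>
      rw [List.isChain_cons_cons] at hp
      have h1 := ih hp.2
      simp only [pathLength, List.tail_cons, List.zip_cons_cons, List.map_cons,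
        List.sum_cons] at h1 ⊢
      rw [h1, h (a, b) hp.1]

theorem longestPathLength_congr {ℓ' : V × V → ℝ} (h : ∀ e ∈ edgeSet G, ℓ e = ℓ' e) :
    longestPathLength G ℓ = longestPathLength G ℓ' := by
  unfold longestPathLength pathLengths
  congr 1
  ext r
  exact exists_congr fun p => and_congr_right fun hp => by rw [pathLength_congr h hp.chain]

theorem longestPathLength_nonneg [Finite V] [Nonempty V] (hG : Acyclic G)
    (hℓ : ∀ e ∈ edgeSet G, 0 ≤ ℓ e) : 0 ≤ longestPathLength G ℓ :=
  (WalkLength.refl (u := Classical.arbitrary V)).le_longestPathLength hG hℓ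

/-- The rank is the number of proper ancestors. It grows along every edge, so adding it to rounded
times makes up for the rounding error of each edge. -/
theorem exists_rank [Fintype V] (hG : Acyclic G) :
    ∃ r : V → ℕ, (∀ v, r v < Fintype.card V) ∧ ∀ u v, G.Adj u v → r u < r v := by
  classical
  refine ⟨fun v => (Finset.univ.filter fun u => Relation.TransGen G.Adj u v).card, fun v => ?_,
    fun u v e => ?_⟩
  · refine Finset.card_lt_univ_of_notMem (x := v) ?_
    simpa using hG v
  · refine Finset.card_lt_card (Finset.ssubset_iff_of_subset (fun w hw => ?_) |>.2 ⟨u, ?_, ?_⟩)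
    · simp only [Finset.mem_filter, Finset.mem_univ, true_and] at hw ⊢
      exact hw.tail e
    · simpa using Relation.TransGen.single e
    · simpa using hG u

end LongestPath

/-! ## The distribution function of the longest path length -/

namespace CompletionTime

open Finset

section
variable {V E : Type*} {src tgt : E → V}

/-- `c` is the earliest schedule: at each vertex the maximum, over the incoming edges, of the time
at the tail plus the duration. By induction along the edges it is below every feasible schedule `g`.
-/
theorem exists_isCompletion_of_le [Finite V] [Fintype E] (h : EdgeAcyclic src tgt) (Z : E → ℕ)
    {g : V → ℕ} (hg : ∀ e, g (src e) + Z e ≤ g (tgt e)) :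
    ∃ c, (∀ v, c v ≤ g v) ∧ IsCompletion src tgt (fun e s s' => s + Z e ≤ s') c := by
  classical
  let c : V → ℕ := (wellFounded_of_edgeAcyclic h).fix fun v c => univ.sup fun e =>
    if he : tgt e = v then c (src e) (.single ⟨e, rfl, he⟩) + Z e else 0
  have hc : ∀ v s, (∀ e, tgt e = v → c (src e) + Z e ≤ s) ↔ c v ≤ s := by
    intro v s
    have : c v = univ.sup fun e => if tgt e = v then c (src e) + Z e else 0 := by
      simp only [c]
      rw [WellFounded.fix_eq]
      refine sup_congr rfl fun e _ => ?_
      split_ifs <;> rfl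
    rw [this, Finset.sup_le_iff]
    refine ⟨fun h' e _ => ?_, fun h' e he => ?_⟩
    · split_ifs with he
      · exact h' e he
      · exact Nat.zero_le _
    · simpa [he] using h' e (mem_univ e)
  refine ⟨c, fun v => ?_, fun v => ⟨fun e he => (hc v _).2 le_rfl e he, fun s hs h' =>
    not_le.2 hs ((hc v s).1 h')⟩⟩
  induction v using (wellFounded_of_edgeAcyclic h).induction with
  | _ v ih =>
    rw [← hc]
    intro e he
    have h1 := ih (src e) (.single ⟨e, rfl, he⟩)
    have h2 := hg e
    rw [he] at h2
    omega

end

end CompletionTime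

namespace LongestPath

open CompletionTime Filter Topology

section
variable {V : Type*} (G : Digraph V)

abbrev edgeSrc (e : edgeSet G) : V := e.1.1

abbrev edgeTgt (e : edgeSet G) : V := e.1.2

open Classical in
/-- The extension of a function on the edges by zero. -/
noncomputable def extendEdges (y : edgeSet G → ℝ) (e : V × V) : ℝ :=
  if h : e ∈ edgeSet G then y ⟨e, h⟩ else 0

variable {G}

theorem edgeAcyclic (hG : Acyclic G) : EdgeAcyclic (edgeSrc G) (edgeTgt G) := by
  intro v hv
  refine hG v (Relation.TransGen.mono (fun u w h => ?_) _ _ hv)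
  obtain ⟨e, rfl, rfl⟩ := h
  exact e.2

theorem extendEdges_apply (y : edgeSet G → ℝ) (e : edgeSet G) : extendEdges G y e = y e := by
  simp [extendEdges]

theorem measurable_longestPathLength [Finite V] [Nonempty V] (hG : Acyclic G) :
    Measurable fun y : edgeSet G → ℝ => longestPathLength G (extendEdges G y) := by
  refine measurable_of_Iic fun x => ?_
  have h1 : (fun y : edgeSet G → ℝ => longestPathLength G (extendEdges G y)) ⁻¹' Set.Iic x =
      ⋂ p : {p // IsSTPath G p}, {y | pathLength (extendEdges G y) p.1 ≤ x} := by
    ext y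
    simp only [Set.mem_preimage, Set.mem_Iic, Set.mem_iInter, Set.mem_ofPred_eq, Subtype.forall]
    refine ⟨fun h p hp => ((isGreatest_longestPathLength hG _).2 ⟨p, hp, rfl⟩).trans h, fun h => ?_⟩
    obtain ⟨p, hp, hl⟩ := (isGreatest_longestPathLength hG (extendEdges G y)).1
    exact hl ▸ h p hp
  rw [h1]
  refine MeasurableSet.iInter fun p => measurableSet_le ?_ measurable_const
  have h2 : ∀ e, Measurable fun y : edgeSet G → ℝ => extendEdges G y e := by
    intro e
    unfold extendEdges
    split_ifs
    · exact measurable_pi_apply _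
    · exact measurable_const
  have h3 : ∀ l : List (V × V), Measurable fun y : edgeSet G → ℝ =>
      (l.map (extendEdges G y)).sum := by
    intro l
    induction l with
    | nil => exact measurable_const
    | cons a l ih => exact (h2 a).add ih
  exact h3 _

section
variable [Fintype (edgeSet G)]

/-- The law of independent edge lengths with the standard exponential distribution. -/
noncomputable abbrev edgeLaw (G : Digraph V) [Fintype (edgeSet G)] : Measure (edgeSet G → ℝ) :=
  Measure.pi fun _ => expMeasure 1

instance : IsProbabilityMeasure (expMeasure 1) := isProbabilityMeasure_expMeasure one_pos

theorem real_expMeasure_Iic {c : ℝ} (hc : 0 ≤ c) :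
    (expMeasure 1).real (Set.Iic c) = 1 - Real.exp (-c) := by
  rw [← cdf_eq_real, cdf_expMeasure_eq one_pos, if_pos hc, one_mul]

theorem ae_nonneg_edgeLaw : ∀ᵐ y ∂edgeLaw G, ∀ e, 0 ≤ y e := by
  rw [ae_all_iff]
  intro e
  refine (Measure.tendsto_eval_ae_ae (μ := fun _ : edgeSet G => expMeasure 1) (i := e)).eventually
    (p := fun z : ℝ => 0 ≤ z) ?_
  rw [ae_iff]
  have h1 : (expMeasure 1).real (Set.Iic 0) = 0 := by rw [real_expMeasure_Iic le_rfl]; simp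
  rw [measureReal_eq_zero_iff] at h1
  exact measure_mono_null (fun z hz => (not_le.1 hz).le) h1

/-- Both sides are expanded over the same letters. On the left the indicator of the event is a
signed sum of indicators of boxes, whose probabilities are products over the edges; on the right
stands the letter sum for `ringPoly`. It remains to compare one factor per edge. -/
theorem real_edgeLaw_ceil [Fintype V] [DecidableEq V] (hG : Acyclic G) {h : ℝ} (hh : 0 < h) (N : ℕ) :
    (edgeLaw G).real {y | ∃ g, (∀ v, g v ≤ N) ∧
        IsCompletion (edgeSrc G) (edgeTgt G) (fun e s s' => s + ⌈y e / h⌉₊ ≤ s') g} =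
      Real.exp (-(Fintype.card (edgeSet G) * (N * h))) *
        (ringPoly (edgeSrc G) (edgeTgt G) N).eval (Real.exp h - 1) := by
  classical
  set A : Set (edgeSet G → ℝ) := {y | ∃ g, (∀ v, g v ≤ N) ∧
    IsCompletion (edgeSrc G) (edgeTgt G) (fun e s s' => s + ⌈y e / h⌉₊ ≤ s') g} with hA
  set S := Fintype.piFinset (fun _ : V => Finset.range (2 * (N + 1)))
  let B : (V → ℕ) → edgeSet G → Set ℝ := fun a e =>
    if outTime (a (edgeSrc G e)) ≤ inTime (a (edgeTgt G e)) then
      Set.Iic (((inTime (a (edgeTgt G e)) - outTime (a (edgeSrc G e)) : ℕ) : ℝ) * h) else ∅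
  have hB : ∀ a e, MeasurableSet (B a e) := by
    intro a e
    simp only [B]
    split_ifs
    · exact measurableSet_Iic
    · exact .empty
  have h1 : ∀ y, A.indicator (fun _ => (1 : ℝ)) y = ∑ a ∈ S, (∏ v, letterWeight N (a v)) *
      (Set.univ.pi (B a)).indicator (fun _ => (1 : ℝ)) y := by
    intro y
    have h2 := sum_letterWeight (edgeAcyclic hG) (fin := fun e s s' => s + ⌈y e / h⌉₊ ≤ s')
      (fun e s s' s'' h1 h2 => h1.trans h2) (Nat.lt_succ_self N)
    rw [Set.indicator_apply]
    refine Eq.trans ?_ (h2.symm.trans ?_)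
    · exact if_congr Iff.rfl rfl rfl
    · refine Finset.sum_congr rfl fun a _ => ?_
      congr 1
      have hiff : ∀ e, outTime (a (edgeSrc G e)) + ⌈y e / h⌉₊ ≤ inTime (a (edgeTgt G e)) ↔
          y e ∈ B a e := by
        intro e
        simp only [B]
        split_ifs with hle
        · rw [Set.mem_Iic, ← div_le_iff₀ hh, ← Nat.ceil_le]
          omega
        · simp only [Set.mem_empty_iff_false, iff_false]
          omega
      by_cases hall : ∀ e, y e ∈ B a e
      · rw [Set.indicator_of_mem (show y ∈ Set.univ.pi (B a) from fun e _ => hall e)]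
        exact Finset.prod_eq_one fun e _ => if_pos ((hiff e).2 (hall e))
      · rw [Set.indicator_of_notMem (show y ∉ Set.univ.pi (B a) from fun h' =>
          hall fun e => h' e trivial)]
        obtain ⟨e, he⟩ := not_forall.1 hall
        exact Finset.prod_eq_zero (Finset.mem_univ e) (if_neg fun h' => he ((hiff e).1 h'))
  have hF : Measurable fun y => ∑ a ∈ S, (∏ v, letterWeight N (a v)) *
      (Set.univ.pi (B a)).indicator (fun _ => (1 : ℝ)) y :=
    Finset.measurable_sum _ fun a _ => (measurable_const.indicator
      (MeasurableSet.univ_pi (hB a))).const_mul _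
  -- Measurability comes from the letter sum as well: the event is the preimage of one under a
  -- finite combination of indicators of boxes.
  have hAm : MeasurableSet A := by
    have : A = (fun y => ∑ a ∈ S, (∏ v, letterWeight N (a v)) *
      (Set.univ.pi (B a)).indicator (fun _ => (1 : ℝ)) y) ⁻¹' {1} := by
      ext y
      rw [Set.mem_preimage, ← h1, Set.mem_singleton_iff, Set.indicator_apply]
      split_ifs with hy <;> simp [hy]
    rw [this]
    exact hF (measurableSet_singleton 1)
  rw [← integral_indicator_one hAm]
  have h3 : ∫ y, A.indicator 1 y ∂edgeLaw G = ∫ y, ∑ a ∈ S, (∏ v, letterWeight N (a v)) *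
      (Set.univ.pi (B a)).indicator (fun _ => (1 : ℝ)) y ∂edgeLaw G :=
    integral_congr_ae (.of_forall h1)
  rw [h3, integral_finsetSum _ fun a _ => ((integrable_const _).indicator
    (MeasurableSet.univ_pi (hB a))).const_mul _, eval_ringPoly,
    transferOp_pow_allDone (edgeAcyclic hG) _ (Nat.lt_succ_self N), Finset.mul_sum]
  refine Finset.sum_congr rfl fun a _ => ?_
  rw [integral_const_mul, mul_left_comm]
  by_cases hz : ∃ v, N < inTime (a v)
  · obtain ⟨v, hv⟩ := hz
    rw [Finset.prod_eq_zero (Finset.mem_univ v) (letterWeight_eq_zero hv), zero_mul, zero_mul]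
  push Not at hz
  congr 1
  have h4 : ∫ y, (Set.univ.pi (B a)).indicator (fun _ => (1 : ℝ)) y ∂edgeLaw G =
      (edgeLaw G).real (Set.univ.pi (B a)) :=
    integral_indicator_one (MeasurableSet.univ_pi (hB a))
  have h5 : Real.exp (-(Fintype.card (edgeSet G) * (N * h))) =
      ∏ _e : edgeSet G, Real.exp (-(N * h)) := by
    rw [Finset.prod_const, ← Real.exp_nat_mul, Finset.card_univ]
    congr 1
    ring
  rw [h4, measureReal_def, Measure.pi_pi, ENNReal.toReal_prod, h5, ← Finset.prod_mul_distrib]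
  -- With `1 + t = exp h` and a duration `d ≤ N`, the factor is `exp (-N h) * (exp (N h) - exp ((N -
  -- d) h)) = 1 - exp (-d h)`.
  refine Finset.prod_congr rfl fun e _ => ?_
  have hd : inTime (a (edgeTgt G e)) - outTime (a (edgeSrc G e)) ≤ N :=
    (Nat.sub_le _ _).trans (hz _)
  rw [← measureReal_def, add_sub_cancel, ← Real.exp_nat_mul, ← Real.exp_nat_mul, mul_sub,
    ← Real.exp_add, ← Real.exp_add, neg_add_cancel, Real.exp_zero, Nat.cast_sub hd]
  simp only [B]
  split_ifs with hle
  · rw [real_expMeasure_Iic (by positivity)]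
    congr 2
    ring
  -- If the time bound lies before the start, the box is empty; the truncated difference is zero and
  -- makes the other side vanish, too.
  · have h0 : inTime (a (edgeTgt G e)) - outTime (a (edgeSrc G e)) = 0 := by omega
    rw [h0]
    simp

/-- The distribution function of the longest path length as a limit of polynomials. -/
theorem real_edgeLaw_eq_tsum [Fintype V] [DecidableEq V] [Nonempty V] (hG : Acyclic G) {x : ℝ} (hx : 0 ≤ x) :
    (edgeLaw G).real {y | longestPathLength G (extendEdges G y) ≤ x} =
      Real.exp (-(Fintype.card (edgeSet G) * x)) * ∑' r : ℕ, x ^ r / r.factorial *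
        wordCount (edgeSrc G) (edgeTgt G) r := by
  set p : ℝ → ℝ := fun x => (edgeLaw G).real {y | longestPathLength G (extendEdges G y) ≤ x}
  set n := Fintype.card V
  -- The summand `1 / (i + 1)` keeps the step positive even for `x = 0`. The `n` additional steps
  -- leave room for the ranks, and since `x ≤ N i * h i` the limit is approached from the right.
  let h : ℕ → ℝ := fun i => (x + 1 / ((i : ℝ) + 1)) / ((i : ℝ) + 1)
  let N : ℕ → ℕ := fun i => n + (i + 1)
  have hi : Tendsto (fun i : ℕ => 1 / ((i : ℝ) + 1)) atTop (𝓝 0) :=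
    tendsto_one_div_add_atTop_nhds_zero_nat
  have hpos : ∀ i, 0 < h i := fun i => by positivity
  have hh : Tendsto h atTop (𝓝 0) := by
    have := ((hi.const_add x).mul hi)
    rw [mul_zero] at this
    exact this.congr fun i => by simp only [h]; ring
  have hNh' : ∀ i : ℕ, (i + 1 : ℝ) * h i = x + 1 / ((i : ℝ) + 1) := fun i => by
    simp only [h]; field_simp
  have hNh : Tendsto (fun i => N i * h i) atTop (𝓝 x) := by
    have := (hh.const_mul (n : ℝ)).add (hi.const_add x)
    rw [mul_zero, zero_add, add_zero] at this
    refine this.congr fun i => ?_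
    rw [← hNh']
    simp only [N]
    push_cast
    ring
  have hxN : ∀ i, x ≤ N i * h i := fun i => by
    have h1 : (N i : ℝ) * h i = n * h i + (x + 1 / ((i : ℝ) + 1)) := by
      rw [← hNh']; simp only [N]; push_cast; ring
    have h2 : 0 ≤ n * h i := mul_nonneg (Nat.cast_nonneg _) (hpos i).le
    have h3 : (0 : ℝ) ≤ 1 / ((i : ℝ) + 1) := by positivity
    linarith
  set q : ℕ → ℝ := fun i => (edgeLaw G).real {y | ∃ g, (∀ v, g v ≤ N i) ∧
    IsCompletion (edgeSrc G) (edgeTgt G) (fun e s s' => s + ⌈y e / h i⌉₊ ≤ s') g} with hq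
  have hmono : ∀ x x', x ≤ x' → p x ≤ p x' := fun x x' hxx =>
    measureReal_mono fun y hy => le_trans hy hxx
  -- A potential bounded by `x` yields the schedule that adds the rank to the rounded-down
  -- potential: the ceiling of a duration exceeds its floor by at most one, and the rank grows by at
  -- least one along an edge.
  have hlow : ∀ i, p x ≤ q i := by
    intro i
    refine ENNReal.toReal_mono (measure_ne_top _ _) (measure_mono_ae ?_)
    filter_upwards [ae_nonneg_edgeLaw (G := G)] with y hy hyx
    change longestPathLength G (extendEdges G y) ≤ x at hyx
    have hy' : ∀ e ∈ edgeSet G, 0 ≤ extendEdges G y e := fun e he =>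
      (hy ⟨e, he⟩).trans_eq (extendEdges_apply y ⟨e, he⟩).symm
    obtain ⟨g, hg, hg'⟩ := exists_potential hG hy'
    obtain ⟨r, hr, hr'⟩ := exists_rank hG
    obtain ⟨c, hc, hc'⟩ := exists_isCompletion_of_le (edgeAcyclic hG) (fun e => ⌈y e / h i⌉₊)
      (g := fun v => ⌊g v / h i⌋₊ + r v) (by
        intro e
        have h1 := hg' e.1.1 e.1.2 e.2
        have h2 := hr' e.1.1 e.1.2 e.2
        rw [show ((e.1.1, e.1.2) : V × V) = e.1 from rfl, extendEdges_apply] at h1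
        have h3 : ⌊g e.1.1 / h i⌋₊ + ⌊y e / h i⌋₊ ≤ ⌊g e.1.2 / h i⌋₊ := by
          refine Nat.le_floor ?_
          push_cast
          have a1 := Nat.floor_le (div_nonneg (hg e.1.1).1 (hpos i).le)
          have a2 := Nat.floor_le (div_nonneg (hy e) (hpos i).le)
          have a3 : g e.1.1 / h i + y e / h i ≤ g e.1.2 / h i := by
            rw [← add_div]
            exact div_le_div_of_nonneg_right h1 (hpos i).le
          linarith
        have h4 := Nat.ceil_le_floor_add_one (y e / h i)
        simp only [edgeSrc, edgeTgt]
        omega)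
    refine ⟨c, fun v => (hc v).trans ?_, hc'⟩
    have h5 : ⌊g v / h i⌋₊ ≤ i + 1 := by
      refine Nat.floor_le_of_le ?_
      rw [div_le_iff₀ (hpos i)]
      push_cast
      have h6 : (0 : ℝ) ≤ 1 / ((i : ℝ) + 1) := by positivity
      linarith [hNh' i, (hg v).2]
    have := hr v
    simp only [N]
    omega
  -- Completion times multiplied by the step are a potential for the original lengths, because
  -- rounding up only lengthens the edges.
  have hup : ∀ i, q i ≤ p (N i * h i) := by
    intro i
    refine measureReal_mono fun y hy => ?_
    obtain ⟨g, hg, hc⟩ := hy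
    refine longestPathLength_le_of_potential hG (g := fun v => g v * h i)
      (fun v => mul_nonneg (Nat.cast_nonneg _) (hpos i).le)
      (fun v => mul_le_mul_of_nonneg_right (by exact_mod_cast hg v) (hpos i).le) fun u v e => ?_
    have h1 := (hc v).1 ⟨(u, v), e⟩ rfl
    have h2 := (div_le_iff₀ (hpos i)).1 (Nat.le_ceil (y ⟨(u, v), e⟩ / h i))
    have h3 : ((g u : ℝ) + (⌈y ⟨(u, v), e⟩ / h i⌉₊ : ℝ)) * h i ≤ g v * h i :=
      mul_le_mul_of_nonneg_right (by exact_mod_cast h1) (hpos i).le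
    have h4 : extendEdges G y (u, v) = y ⟨(u, v), e⟩ := extendEdges_apply y ⟨(u, v), e⟩
    rw [h4]
    linarith
  have hpq : Tendsto q atTop (𝓝 (p x)) := by
    refine tendsto_of_tendsto_of_tendsto_of_le_of_le tendsto_const_nhds ?_ hlow hup
    have hm := measurable_longestPathLength hG
    have : IsProbabilityMeasure ((edgeLaw G).map fun y => longestPathLength G (extendEdges G y)) :=
      Measure.isProbabilityMeasure_map hm.aemeasurable
    have hcdf : ∀ z, p z = cdf ((edgeLaw G).map fun y => longestPathLength G (extendEdges G y)) z := by
      intro z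
      rw [cdf_eq_real, map_measureReal_apply hm measurableSet_Iic]
      rfl
    simp only [hcdf]
    -- Continuity of the distribution function from the right closes the gap between the two bounds.
    refine ((cdf _).right_continuous x).tendsto.comp ?_
    exact tendsto_nhdsWithin_iff.2 ⟨hNh, .of_forall hxN⟩
  have ht : Tendsto (fun i => Real.exp (h i) - 1) atTop (𝓝 0) := by
    have := ((Real.continuous_exp.tendsto 0).comp hh).sub_const 1
    simpa using this
  have hlim : Tendsto q atTop (𝓝 (Real.exp (-(Fintype.card (edgeSet G) * x)) *
      ∑' r : ℕ, x ^ r / r.factorial * wordCount (edgeSrc G) (edgeTgt G) r)) := by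
    simp only [hq, real_edgeLaw_ceil hG (hpos _)]
    refine Tendsto.mul ?_ (tendsto_eval_ringPoly ht ?_ (.of_forall fun i => ?_))
    · exact (Real.continuous_exp.tendsto _).comp (hNh.const_mul _).neg
    · have h1 := hNh.add (hNh.mul hh)
      rw [mul_zero, add_zero] at h1
      refine tendsto_of_tendsto_of_tendsto_of_le_of_le' hNh h1 (.of_forall fun i => ?_) ?_
      · exact mul_le_mul_of_nonneg_left (by linarith [Real.add_one_le_exp (h i)])
          (Nat.cast_nonneg _)
      · filter_upwards [hh.eventually_le_const one_pos] with i hi1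
        have h2 := (abs_le.1 (Real.abs_exp_sub_one_sub_id_le
          (abs_le.2 ⟨by linarith [hpos i], hi1⟩))).2
        rw [mul_assoc, ← mul_add]
        exact mul_le_mul_of_nonneg_left (by nlinarith) (Nat.cast_nonneg _)
    · linarith [Real.add_one_le_exp (h i), hpos i]
  exact tendsto_nhds_unique hpq hlim

end

end

end LongestPath

/-! ### The closed formula, and its evaluation by dynamic programming -/

namespace LongestPath

open CompletionTime HermiteInterpolation PairwiseSum

section
variable {n : ℕ} (G : Digraph (Fin n))

open Classical in
/-- The factor of a pair of vertices in the sum over all letters. -/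
noncomputable def pairFactor (N : ℕ) (t : ℝ) (u v : Fin n) (x y : ℕ) : ℝ :=
  if G.Adj u v then (1 + t) ^ N - (1 + t) ^ (N - (inTime y - outTime x)) else 1

noncomputable abbrev edgeCount : ℕ := (edgeSet G).ncard

/-- The probability that the longest path has length at most `x`. -/
noncomputable def cdfValue [Fintype (edgeSet G)] (x : ℝ) : ℝ :=
  if x < 0 then 0 else
    Real.exp (-(edgeCount G * x)) *
      ∑ r ∈ Finset.range ((edgeCount G + 1) * (edgeCount G + 1)),
        (newton (edgeCount G + 1) (fun s => x ^ (s % (edgeCount G + 1)) *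
          Real.exp ((s / (edgeCount G + 1) : ℕ) * x))
          ((edgeCount G + 1) * (edgeCount G + 1))).coeff r *
        wordCount (edgeSrc G) (edgeTgt G) r

variable {G}

theorem card_edgeSet [Fintype (edgeSet G)] : Fintype.card (edgeSet G) = edgeCount G := by
  rw [edgeCount, Set.ncard_eq_toFinset_card', Set.toFinset_card]

theorem real_edgeLaw_eq [Fintype (edgeSet G)] (hn : 0 < n) (hG : Acyclic G) (x : ℝ) :
    (edgeLaw G).real {y | longestPathLength G (extendEdges G y) ≤ x} = cdfValue G x := by
  have : Nonempty (Fin n) := ⟨⟨0, hn⟩⟩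
  unfold cdfValue
  split_ifs with hx
  · rw [measureReal_eq_zero_iff]
    refine measure_eq_zero_iff_ae_notMem.2 ?_
    filter_upwards [ae_nonneg_edgeLaw (G := G)] with y hy hyx
    have := longestPathLength_nonneg hG (ℓ := extendEdges G y) fun e he =>
      (hy ⟨e, he⟩).trans_eq (extendEdges_apply y ⟨e, he⟩).symm
    exact absurd (this.trans hyx) (not_le.2 hx)
  · rw [real_edgeLaw_eq_tsum hG (not_lt.1 hx), (hasSum_wordCount x).tsum_eq, card_edgeSet]

theorem real_longestPathLength_le [Fintype (edgeSet G)] (hn : 0 < n) (hG : Acyclic G) (x : ℝ)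
    {Ω : Type*} [MeasurableSpace Ω] (μ : Measure Ω) [IsProbabilityMeasure μ]
    (Y : Fin n × Fin n → Ω → ℝ) (hY : ∀ e ∈ edgeSet G, HasLaw (Y e) (expMeasure 1) μ)
    (hI : iIndepFun (fun e : edgeSet G => Y e) μ) :
    μ.real {ω | longestPathLength G (fun e => Y e ω) ≤ x} = cdfValue G x := by
  have : Nonempty (Fin n) := ⟨⟨0, hn⟩⟩
  have hm : ∀ e : edgeSet G, AEMeasurable (Y e) μ := fun e => (hY e e.2).aemeasurable
  have hmap := (iIndepFun_iff_map_fun_eq_pi_map hm).1 hI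
  simp only [fun e : edgeSet G => (hY e e.2).map_eq] at hmap
  rw [← real_edgeLaw_eq hn hG, edgeLaw, ← hmap, map_measureReal_apply_of_aemeasurable
    (aemeasurable_pi_lambda _ hm) (measurableSet_le (measurable_longestPathLength hG)
      measurable_const)]
  congr 1
  ext ω
  have : longestPathLength G (fun e => Y e ω) =
      longestPathLength G (extendEdges G fun e : edgeSet G => Y e ω) :=
    longestPathLength_congr fun e he =>
      (extendEdges_apply (fun e : edgeSet G => Y e ω) ⟨e, he⟩).symm
  simp only [Set.mem_ofPred_eq, Set.mem_preimage, this]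

theorem pairFactor_eq_one (hG : Acyclic G) {N : ℕ} {t : ℝ} {u v : Fin n}
    (h : ¬ G.toSimpleGraphInclusive.Adj u v) (x y : ℕ) : pairFactor G N t u v x y = 1 := by
  refine if_neg fun e => h ?_
  rw [Digraph.toSimpleGraphInclusive, SimpleGraph.fromRel_adj]
  refine ⟨?_, .inl e⟩
  rintro rfl
  exact hG u (.single e)

/-- The product over the edges becomes a product over all ordered pairs, with factor one for
non-edges. The boundary values `β` are irrelevant because every vertex is summed over. -/
theorem eval_ringPoly_eq_partSum [Fintype (edgeSet G)] (hG : Acyclic G) {N M : ℕ} (hM : N < M)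
    (t : ℝ) (β : Fin n → ℕ) : (ringPoly (edgeSrc G) (edgeTgt G) N).eval t =
      partSum (2 * M) (letterWeight N) (pairFactor G N t) Finset.univ β := by
  classical
  rw [eval_ringPoly, transferOp_pow_allDone (edgeAcyclic hG) t hM, partSum]
  have : assignments (2 * M) Finset.univ β =
      Fintype.piFinset (fun _ : Fin n => Finset.range (2 * M)) := by
    simp [assignments]
  rw [this]
  refine Finset.sum_congr rfl fun a _ => ?_
  congr 1
  simp only [pairProd, Finset.mem_univ, true_or, if_true]
  rw [← Finset.prod_product' Finset.univ Finset.univ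
    fun u v => pairFactor G N t u v (a u) (a v)]
  simp only [pairFactor]
  rw [Finset.prod_ite, Finset.prod_const_one, mul_one]
  symm
  refine Finset.prod_bij' (fun e he => (⟨e, (Finset.mem_filter.1 he).2⟩ : edgeSet G))
    (fun e _ => e.1) ?_ ?_ ?_ ?_ ?_
  · simp
  · intro e _
    exact Finset.mem_filter.2 ⟨by simp, e.2⟩
  · simp
  · simp
  · simp

/-- The evaluation by dynamic programming. -/
theorem eval_ringPoly_eq_sum [Fintype (edgeSet G)] (hn : 0 < n) (hG : Acyclic G) {N M w : ℕ}
    (hM : N < M) (hw : 0 < w) {r : ℕ}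
    (hfeas : ∀ x c, c ≠ ⟨0, hn⟩ → Feasible G.toSimpleGraphInclusive r
      (constKey (A := 2 * M) w ⟨0, hn⟩ x) c) (t : ℝ) :
    open Classical in (ringPoly (edgeSrc G) (edgeTgt G) N).eval t =
      ∑ x : Fin (2 * M), letterWeight N x * ∏ c, if c ≠ ⟨0, hn⟩ ∧
        IsLeast G.toSimpleGraphInclusive (keySet (constKey w ⟨0, hn⟩ x)) c then
        compVal G.toSimpleGraphInclusive (letterWeight N) (pairFactor G N t) r
          (constKey w ⟨0, hn⟩ x) c else 1 := by
  rw [eval_ringPoly_eq_partSum hG hM t 0,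
    partSum_univ_eq hw (fun u v h x y => pairFactor_eq_one hG h x y) r ⟨0, hn⟩ hfeas]

end

end LongestPath

/-! ## Evaluation of terms -/

namespace RealRAM

open Finset

open Classical in
/-- The truth value of a proposition as a number. -/
noncomputable def ind (p : Prop) : ℕ := if p then 1 else 0

theorem ind_congr {p q : Prop} (h : p ↔ q) : ind p = ind q := by rw [propext h]

theorem ind_true {p : Prop} (h : p) : ind p = 1 := if_pos h

theorem ind_false {p : Prop} (h : ¬ p) : ind p = 0 := if_neg h

theorem ind_pos {p : Prop} : 0 < ind p ↔ p := by
  unfold ind; split_ifs <;> simp_all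

namespace NTerm

abbrev add (a b : NTerm) : NTerm := op .add a b

abbrev sub (a b : NTerm) : NTerm := op .sub a b

abbrev mul (a b : NTerm) : NTerm := op .mul a b

abbrev lt (a b : NTerm) : NTerm := op .lt a b

abbrev eq (a b : NTerm) : NTerm := op .eq a b

abbrev not (a : NTerm) : NTerm := sub (lit 1) a

abbrev all (j : ℕ) (b e : NTerm) : NTerm := big true j b e

abbrev ex (j : ℕ) (b e : NTerm) : NTerm := lt (lit 0) (big false j b e)

abbrev imp (a b : NTerm) : NTerm := not (mul a (not b))

/-- The value of `e` if variable `j` is the value of `a`. -/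
abbrev bind (j : ℕ) (a e : NTerm) : NTerm := big false j (add a (lit 1)) (mul (eq (var j) a) e)

/-- The quotient. -/
def div (a b : NTerm) : NTerm :=
  app a b (lit 0) (big false 2 (var 0)
    (lt (mul (add (var 2) (lit 1)) (var 1)) (add (var 0) (lit 1))))

/-- The remainder. -/
def mod (a b : NTerm) : NTerm :=
  app a b (lit 0) (sub (var 0) (mul (var 1) (div (var 0) (var 1))))

abbrev pow (j : ℕ) (a b : NTerm) : NTerm := big true j b a

end NTerm

namespace RTerm

abbrev add (a b : RTerm) : RTerm := op .add a b

abbrev sub (a b : RTerm) : RTerm := op .sub a b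

abbrev mul (a b : RTerm) : RTerm := op .mul a b

abbrev div (a b : RTerm) : RTerm := op .div a b

/-- The value of `e` if `a` holds, and one otherwise. -/
abbrev ite1 (a : NTerm) (e : RTerm) : RTerm :=
  add (ofNat (.lit 1)) (mul (ofNat a) (sub e (ofNat (.lit 1))))

/-- The value of `e` if variable `j` is the value of `a`. -/
abbrev bind (j : ℕ) (a : NTerm) (e : RTerm) : RTerm :=
  big false j (.add a (.lit 1)) (mul (ofNat (.eq (.var j) a)) e)

end RTerm

section
variable {M : Mem} {V : ℕ → ℕ}

@[simp] theorem NTerm.eval_lit (c : ℕ) : (NTerm.lit c).eval M V = c := rfl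

@[simp] theorem NTerm.eval_var (j : ℕ) : (NTerm.var j).eval M V = V j := rfl

@[simp] theorem NTerm.eval_inp (a : NTerm) : (NTerm.inp a).eval M V = M.src (a.eval M V) := rfl

@[simp] theorem NTerm.eval_tab (i : Fin 16) (a : NTerm) :
    (NTerm.tab i a).eval M V = M.nat i (a.eval M V) := rfl

@[simp] theorem NTerm.eval_add (a b : NTerm) :
    (NTerm.op .add a b).eval M V = a.eval M V + b.eval M V := rfl

@[simp] theorem NTerm.eval_sub (a b : NTerm) :
    (NTerm.op .sub a b).eval M V = a.eval M V - b.eval M V := rfl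

@[simp] theorem NTerm.eval_mul (a b : NTerm) :
    (NTerm.op .mul a b).eval M V = a.eval M V * b.eval M V := rfl

@[simp] theorem NTerm.eval_lt (a b : NTerm) :
    (NTerm.op .lt a b).eval M V = if a.eval M V < b.eval M V then 1 else 0 := rfl

@[simp] theorem NTerm.eval_eq (a b : NTerm) :
    (NTerm.op .eq a b).eval M V = if a.eval M V = b.eval M V then 1 else 0 := rfl

theorem NTerm.eval_app (a b c f : NTerm) :
    (NTerm.app a b c f).eval M V = f.eval M (bind3 V (a.eval M V) (b.eval M V) (c.eval M V)) := rfl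

@[simp] theorem RTerm.eval_arg : RTerm.arg.eval M V = M.arg := rfl

@[simp] theorem RTerm.eval_ofNat (a : NTerm) : (RTerm.ofNat a).eval M V = (a.eval M V : ℝ) := rfl

@[simp] theorem RTerm.eval_tab (i : Fin 16) (a : NTerm) :
    (RTerm.tab i a).eval M V = M.real i (a.eval M V) := rfl

@[simp] theorem RTerm.eval_add (a b : RTerm) :
    (RTerm.op .add a b).eval M V = a.eval M V + b.eval M V := rfl

@[simp] theorem RTerm.eval_sub (a b : RTerm) :
    (RTerm.op .sub a b).eval M V = a.eval M V - b.eval M V := rfl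

@[simp] theorem RTerm.eval_mul (a b : RTerm) :
    (RTerm.op .mul a b).eval M V = a.eval M V * b.eval M V := rfl

@[simp] theorem RTerm.eval_div (a b : RTerm) :
    (RTerm.op .div a b).eval M V = a.eval M V / b.eval M V := rfl

@[simp] theorem RTerm.eval_exp (a : RTerm) :
    (RTerm.exp a).eval M V = Real.exp (a.eval M V) := rfl

@[simp] theorem bind3_zero (a b c : ℕ) : bind3 V a b c 0 = a := by simp [bind3]

@[simp] theorem bind3_one (a b c : ℕ) : bind3 V a b c 1 = b := by simp [bind3]

@[simp] theorem bind3_two (a b c : ℕ) : bind3 V a b c 2 = c := by simp [bind3]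

theorem bind3_of_lt (a b c : ℕ) {j : ℕ} (hj : 2 < j) : bind3 V a b c j = V j := by
  unfold bind3
  rw [Function.update_of_ne (by omega), Function.update_of_ne (by omega),
    Function.update_of_ne (by omega)]

/-! ### Truth values -/

variable {a b e : NTerm} {p q : Prop} {j k : ℕ}

theorem NTerm.eval_not (h : a.eval M V = ind p) : (NTerm.not a).eval M V = ind ¬ p := by
  rw [eval_sub, h, eval_lit]
  by_cases hp : p <;> simp [ind, hp]

theorem NTerm.eval_and (h : a.eval M V = ind p) (h' : b.eval M V = ind q) :
    (NTerm.mul a b).eval M V = ind (p ∧ q) := by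
  rw [eval_mul, h, h']
  by_cases hp : p <;> by_cases hq : q <;> simp [ind, hp, hq]

theorem NTerm.eval_imp (h : a.eval M V = ind p) (h' : b.eval M V = ind q) :
    (NTerm.imp a b).eval M V = ind (p → q) :=
  (eval_not (eval_and h (eval_not h'))).trans (ind_congr (by tauto))

theorem NTerm.eval_eq_ind {x y : ℕ} (h : a.eval M V = x) (h' : b.eval M V = y) :
    (NTerm.eq a b).eval M V = ind (x = y) := by
  rw [eval_eq, h, h']
  by_cases hp : x = y <;> simp [ind, hp]

theorem NTerm.eval_lt_ind {x y : ℕ} (h : a.eval M V = x) (h' : b.eval M V = y) :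
    (NTerm.lt a b).eval M V = ind (x < y) := by
  rw [eval_lt, h, h']
  by_cases hp : x < y <;> simp [ind, hp]

theorem NTerm.eval_pos {x : ℕ} (h : a.eval M V = x) :
    (NTerm.lt (.lit 0) a).eval M V = ind (0 < x) := eval_lt_ind rfl h

/-- Loops are cut off at the cap, which makes the cost of a term depend on the cap alone. In return
each use has to verify that its number of iterations does not exceed the cap. -/
theorem NTerm.eval_big (o : Bool) {f : ℕ → ℕ} (hb : b.eval M V = k) (hk : k ≤ M.cap)
    (h : ∀ i < k, e.eval M (Function.update V j i) = f i) :
    (NTerm.big o j b e).eval M V = bigOp o k f := by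
  rw [NTerm.eval, hb, min_eq_left hk]
  unfold bigOp
  split_ifs
  · exact prod_congr rfl fun i hi => h i (mem_range.1 hi)
  · exact sum_congr rfl fun i hi => h i (mem_range.1 hi)

theorem NTerm.eval_sum {f : ℕ → ℕ} (hb : b.eval M V = k) (hk : k ≤ M.cap)
    (h : ∀ i < k, e.eval M (Function.update V j i) = f i) :
    (NTerm.big false j b e).eval M V = ∑ i ∈ range k, f i := eval_big false hb hk h

theorem NTerm.eval_prod {f : ℕ → ℕ} (hb : b.eval M V = k) (hk : k ≤ M.cap)
    (h : ∀ i < k, e.eval M (Function.update V j i) = f i) :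
    (NTerm.big true j b e).eval M V = ∏ i ∈ range k, f i := eval_big true hb hk h

theorem NTerm.eval_sum_fin {f : Fin k → ℕ} (hb : b.eval M V = k) (hk : k ≤ M.cap)
    (h : ∀ i : Fin k, e.eval M (Function.update V j i) = f i) :
    (NTerm.big false j b e).eval M V = ∑ i, f i := by
  rw [eval_sum (f := fun i => e.eval M (Function.update V j i)) hb hk fun _ _ => rfl,
    Finset.sum_range]
  exact sum_congr rfl fun i _ => h i

theorem NTerm.eval_prod_fin {f : Fin k → ℕ} (hb : b.eval M V = k) (hk : k ≤ M.cap)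
    (h : ∀ i : Fin k, e.eval M (Function.update V j i) = f i) :
    (NTerm.big true j b e).eval M V = ∏ i, f i := by
  rw [eval_prod (f := fun i => e.eval M (Function.update V j i)) hb hk fun _ _ => rfl,
    Finset.prod_range]
  exact prod_congr rfl fun i _ => h i

theorem prod_ind {ι : Type*} (s : Finset ι) (P : ι → Prop) :
    ∏ i ∈ s, ind (P i) = ind (∀ i ∈ s, P i) := by
  classical
  by_cases h : ∀ i ∈ s, P i
  · rw [ind_true h, prod_eq_one fun i hi => ind_true (h i hi)]
  · rw [ind_false h]
    push Not at h
    obtain ⟨i, hi, hp⟩ := h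
    exact prod_eq_zero hi (ind_false hp)

theorem sum_ind_pos {ι : Type*} (s : Finset ι) (P : ι → Prop) :
    0 < ∑ i ∈ s, ind (P i) ↔ ∃ i ∈ s, P i := by
  rw [sum_pos_iff]
  simp only [ind_pos]

theorem NTerm.eval_all {P : Fin k → Prop} (hb : b.eval M V = k) (hk : k ≤ M.cap)
    (h : ∀ i : Fin k, e.eval M (Function.update V j i) = ind (P i)) :
    (NTerm.all j b e).eval M V = ind (∀ i, P i) := by
  rw [eval_prod_fin hb hk h, prod_ind]
  exact ind_congr (by simp)

theorem NTerm.eval_ex {P : Fin k → Prop} (hb : b.eval M V = k) (hk : k ≤ M.cap)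
    (h : ∀ i : Fin k, e.eval M (Function.update V j i) = ind (P i)) :
    (NTerm.ex j b e).eval M V = ind (∃ i, P i) := by
  rw [eval_pos (eval_sum_fin hb hk h)]
  exact ind_congr (by rw [sum_ind_pos]; simp)

theorem NTerm.eval_pow {x : ℕ} (hb : b.eval M V = k) (hk : k ≤ M.cap)
    (h : ∀ i, a.eval M (Function.update V j i) = x) : (NTerm.pow j a b).eval M V = x ^ k := by
  rw [eval_prod hb hk fun i _ => h i, prod_const, card_range]

/-- Exactly one index passes the test, so a local definition is a sum with one nonzero term. The
bound value must not depend on the variable that it defines. -/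
theorem NTerm.eval_bind {x : ℕ} (ha : ∀ i, a.eval M (Function.update V j i) = x)
    (hx : x + 1 ≤ M.cap) : (NTerm.bind j a e).eval M V = e.eval M (Function.update V j x) := by
  have h0 : a.eval M V = x := by simpa using ha (V j)
  rw [eval_sum (f := fun i => if i = x then e.eval M (Function.update V j x) else 0)
    (k := x + 1) (by simp [h0]) hx]
  · simp
  · intro i _
    rw [eval_mul, eval_eq, ha, eval_var, Function.update_self]
    split_ifs with h
    · rw [h, one_mul]
    · rw [zero_mul]

/-- The machine has no division: the quotient is obtained by counting the `i < x` with `(i + 1) * y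
≤ x`. -/
theorem NTerm.eval_div {x y : ℕ} (ha : a.eval M V = x) (hb : b.eval M V = y) (hx : x ≤ M.cap)
    (hy : 0 < y) : (NTerm.div a b).eval M V = x / y := by
  rw [NTerm.div, eval_app, ha, hb, eval_sum (f := fun i => if i < x / y then 1 else 0) (k := x)]
  · rw [← sum_filter, sum_const, smul_eq_mul, mul_one]
    have : (range x).filter (fun i => i < x / y) = range (x / y) := by
      ext i
      simp only [mem_filter, mem_range]
      exact ⟨fun h => h.2, fun h => ⟨h.trans_le (Nat.div_le_self _ _), h⟩⟩
    rw [this, card_range]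
  · simp
  · exact hx
  · intro i _
    simp only [eval_lt, eval_mul, eval_add, eval_var, eval_lit, Function.update_self]
    rw [Function.update_of_ne (by decide), Function.update_of_ne (by decide), bind3_zero, bind3_one]
    refine if_congr ?_ rfl rfl
    rw [Nat.lt_succ_iff, ← Nat.le_div_iff_mul_le hy, Nat.succ_le_iff]

theorem NTerm.eval_mod {x y : ℕ} (ha : a.eval M V = x) (hb : b.eval M V = y) (hx : x ≤ M.cap)
    (hy : 0 < y) : (NTerm.mod a b).eval M V = x % y := by
  rw [NTerm.mod, eval_app, eval_sub, eval_mul, eval_div (x := x) (y := y) _ _ hx hy]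
  · simp only [eval_var, bind3_zero, bind3_one, ha, hb]
    have := Nat.div_add_mod x y
    omega
  · simpa using ha
  · simpa using hb

theorem RTerm.eval_sum {f : Fin k → ℝ} {e : RTerm} (hb : b.eval M V = k) (hk : k ≤ M.cap)
    (h : ∀ i : Fin k, e.eval M (Function.update V j i) = f i) :
    (RTerm.big false j b e).eval M V = ∑ i, f i := by
  rw [RTerm.eval, hb, min_eq_left hk, bigOp, if_neg (by decide), Finset.sum_range]
  exact sum_congr rfl fun i _ => h i

theorem RTerm.eval_prod {f : Fin k → ℝ} {e : RTerm} (hb : b.eval M V = k) (hk : k ≤ M.cap)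
    (h : ∀ i : Fin k, e.eval M (Function.update V j i) = f i) :
    (RTerm.big true j b e).eval M V = ∏ i, f i := by
  rw [RTerm.eval, hb, min_eq_left hk, bigOp, if_pos rfl, Finset.prod_range]
  exact prod_congr rfl fun i _ => h i

theorem RTerm.eval_sum_range {f : ℕ → ℝ} {e : RTerm} (hb : b.eval M V = k) (hk : k ≤ M.cap)
    (h : ∀ i < k, e.eval M (Function.update V j i) = f i) :
    (RTerm.big false j b e).eval M V = ∑ i ∈ range k, f i := by
  rw [eval_sum hb hk fun i => h i i.2, Finset.sum_range]

theorem RTerm.eval_prod_range {f : ℕ → ℝ} {e : RTerm} (hb : b.eval M V = k) (hk : k ≤ M.cap)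
    (h : ∀ i < k, e.eval M (Function.update V j i) = f i) :
    (RTerm.big true j b e).eval M V = ∏ i ∈ range k, f i := by
  rw [eval_prod hb hk fun i => h i i.2, Finset.prod_range]

open Classical in
theorem RTerm.eval_ite1 {x : ℝ} {e : RTerm} (ha : a.eval M V = ind p)
    (he : p → e.eval M V = x) : (RTerm.ite1 a e).eval M V = if p then x else 1 := by
  simp only [eval_add, eval_mul, eval_sub, eval_ofNat, ha, NTerm.eval_lit]
  by_cases hp : p
  · simp [ind, hp, he hp]
  · simp [ind, hp]

theorem RTerm.eval_bind {x : ℕ} {e : RTerm} (ha : ∀ i, a.eval M (Function.update V j i) = x)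
    (hx : x + 1 ≤ M.cap) : (RTerm.bind j a e).eval M V = e.eval M (Function.update V j x) := by
  have h0 : a.eval M V = x := by simpa using ha (V j)
  rw [eval_sum_range (f := fun i => if i = x then e.eval M (Function.update V j x) else 0)
    (k := x + 1) (by simp [h0]) hx]
  · simp
  · intro i _
    rw [eval_mul, eval_ofNat, NTerm.eval_eq, ha, NTerm.eval_var, Function.update_self]
    split_ifs with h
    · rw [h, Nat.cast_one, one_mul]
    · rw [Nat.cast_zero, zero_mul]

end

/-! ### Filled tables -/

/-- Strong induction for recursively filled tables: entry `a` may read entries with smaller indices,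
of which nothing but `Good` is known. -/
theorem Mem.fillNat_spec (M : Mem) (V : ℕ → ℕ) (i : Fin 16) (e : NTerm) (Good : ℕ → ℕ → Prop)
    (k : ℕ) (h : ∀ a < k, ∀ f : ℕ → ℕ, (∀ a' < a, Good a' (f a')) →
      Good a (e.eval { M with nat := Function.update M.nat i f } (Function.update V 0 a))) :
    ∃ f, M.fillNat V i e k = { M with nat := Function.update M.nat i f } ∧
      ∀ a < k, Good a (f a) := by
  induction k with
  | zero => exact ⟨M.nat i, by simp [fillNat], fun a ha => absurd ha (Nat.not_lt_zero _)⟩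
  | succ k ih =>
    obtain ⟨f, hf, hg⟩ := ih fun a ha => h a (by omega)
    refine ⟨Function.update f k (e.eval { M with nat := Function.update M.nat i f }
      (Function.update V 0 k)), ?_, fun a ha => ?_⟩
    · rw [fillNat, hf]
      simp
    · rcases Nat.lt_succ_iff_lt_or_eq.1 ha with ha | rfl
      · rw [Function.update_of_ne ha.ne]
        exact hg a ha
      · rw [Function.update_self]
        exact h a (by omega) f hg

theorem Mem.fillReal_spec (M : Mem) (V : ℕ → ℕ) (i : Fin 16) (e : RTerm) (Good : ℕ → ℝ → Prop)
    (k : ℕ) (h : ∀ a < k, ∀ f : ℕ → ℝ, (∀ a' < a, Good a' (f a')) →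
      Good a (e.eval { M with real := Function.update M.real i f } (Function.update V 0 a))) :
    ∃ f, M.fillReal V i e k = { M with real := Function.update M.real i f } ∧
      ∀ a < k, Good a (f a) := by
  induction k with
  | zero => exact ⟨M.real i, by simp [fillReal], fun a ha => absurd ha (Nat.not_lt_zero _)⟩
  | succ k ih =>
    obtain ⟨f, hf, hg⟩ := ih fun a ha => h a (by omega)
    refine ⟨Function.update f k (e.eval { M with real := Function.update M.real i f }
      (Function.update V 0 k)), ?_, fun a ha => ?_⟩
    · rw [fillReal, hf]
      simp
    · rcases Nat.lt_succ_iff_lt_or_eq.1 ha with ha | rfl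
      · rw [Function.update_of_ne ha.ne]
        exact hg a ha
      · rw [Function.update_self]
        exact h a (by omega) f hg

/-! ### Polynomial bounds -/

theorem exists_cost_le_of_add {f g : ℕ → ℕ} (hf : ∃ c, ∀ l, f l ≤ (l + 2) ^ c)
    (hg : ∃ c, ∀ l, g l ≤ (l + 2) ^ c) : ∃ c, ∀ l, f l + g l ≤ (l + 2) ^ c := by
  obtain ⟨c, hc⟩ := hf
  obtain ⟨d, hd⟩ := hg
  refine ⟨c + d + 1, fun l => ?_⟩
  have h1 : (l + 2) ^ c ≤ (l + 2) ^ (c + d) := Nat.pow_le_pow_right (by omega) (by omega)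
  have h2 : (l + 2) ^ d ≤ (l + 2) ^ (c + d) := Nat.pow_le_pow_right (by omega) (by omega)
  have := hc l
  have := hd l
  rw [pow_succ]
  nlinarith

theorem exists_cost_le_of_mul {f g : ℕ → ℕ} (hf : ∃ c, ∀ l, f l ≤ (l + 2) ^ c)
    (hg : ∃ c, ∀ l, g l ≤ (l + 2) ^ c) : ∃ c, ∀ l, f l * g l ≤ (l + 2) ^ c := by
  obtain ⟨c, hc⟩ := hf
  obtain ⟨d, hd⟩ := hg
  exact ⟨c + d, fun l => by rw [pow_add]; exact Nat.mul_le_mul (hc l) (hd l)⟩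

/-- The base `l + 2` is at least two, so a constant is absorbed by the exponent, even for `l = 0`.
-/
theorem exists_cost_le_of_const (k : ℕ) : ∃ c, ∀ l : ℕ, k ≤ (l + 2) ^ c :=
  ⟨k, fun l => (Nat.lt_pow_self (by omega)).le⟩

theorem exists_cost_le_of_id : ∃ c, ∀ l : ℕ, l ≤ (l + 2) ^ c := ⟨1, fun l => by rw [pow_one]; omega⟩

theorem NTerm.exists_cost_le (e : NTerm) : ∃ c, ∀ l, e.cost l ≤ (l + 2) ^ c := by
  induction e with
  | lit | cap | var => exact exists_cost_le_of_const 100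
  | inp a ih | tab i a ih => exact exists_cost_le_of_add ih (exists_cost_le_of_const 100)
  | op o a b iha ihb =>
    exact exists_cost_le_of_add (exists_cost_le_of_add iha ihb) (exists_cost_le_of_const 100)
  | big o j b e ihb ihe =>
    exact exists_cost_le_of_add (exists_cost_le_of_add ihb (exists_cost_le_of_mul
      exists_cost_le_of_id (exists_cost_le_of_add ihe (exists_cost_le_of_const 500))))
      (exists_cost_le_of_const 500)
  | app a b c f iha ihb ihc ihf =>
    exact exists_cost_le_of_add (exists_cost_le_of_add (exists_cost_le_of_add
      (exists_cost_le_of_add iha ihb) ihc) ihf) (exists_cost_le_of_const 500)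

theorem RTerm.exists_cost_le (e : RTerm) : ∃ c, ∀ l, e.cost l ≤ (l + 2) ^ c := by
  induction e with
  | arg => exact exists_cost_le_of_const 100
  | ofNat a | tab i a =>
    exact exists_cost_le_of_add a.exists_cost_le (exists_cost_le_of_const 100)
  | exp a ih => exact exists_cost_le_of_add ih (exists_cost_le_of_const 100)
  | op o a b iha ihb =>
    exact exists_cost_le_of_add (exists_cost_le_of_add iha ihb) (exists_cost_le_of_const 100)
  | big o j b e ihe =>
    exact exists_cost_le_of_add (exists_cost_le_of_add b.exists_cost_le (exists_cost_le_of_mul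
      exists_cost_le_of_id (exists_cost_le_of_add ihe (exists_cost_le_of_const 500))))
      (exists_cost_le_of_const 500)
  | app a b c f ihf =>
    exact exists_cost_le_of_add (exists_cost_le_of_add (exists_cost_le_of_add
      (exists_cost_le_of_add a.exists_cost_le b.exists_cost_le) c.exists_cost_le) ihf)
      (exists_cost_le_of_const 500)

theorem Cmd.exists_cost_le (c : Cmd) : ∃ d, ∀ l, c.cost l ≤ (l + 2) ^ d := by
  induction c with
  | setVar j e => exact exists_cost_le_of_add e.exists_cost_le (exists_cost_le_of_const 100)
  | fillNat i e | fillReal i e =>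
    exact exists_cost_le_of_add (exists_cost_le_of_mul exists_cost_le_of_id
      (exists_cost_le_of_add e.exists_cost_le (exists_cost_le_of_const 500)))
      (exists_cost_le_of_const 500)
  | seq c d ihc ihd => exact exists_cost_le_of_add ihc ihd

end RealRAM

/-! ## Terms for the graph and for keys -/

namespace RealRAM

open Finset PairwiseSum LongestPath

section
variable {n : ℕ} (G : Digraph (Fin n))

/-- The number of word counts, and one more than the largest number of time steps. -/
noncomputable abbrev numRounds : ℕ := (edgeCount G + 1) * (edgeCount G + 1)

noncomputable abbrev numLetters : ℕ := 2 * numRounds G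

noncomputable abbrev keyBase : ℕ := n * numLetters G

/-- A bound for the number of interpolation nodes. -/
noncomputable abbrev numNodes : ℕ := (edgeCount G + 1) * numRounds G + 1

theorem numLetters_pos : 0 < numLetters G := by unfold numLetters numRounds; positivity

abbrev GKey (w : ℕ) := Key n (numLetters G) w

variable {G}

/-- The number with the digits `x + letters * v`, for the pairs `(v, x)` of the key. -/
noncomputable def keyCode {w : ℕ} (κ : GKey G w) : ℕ :=
  finFunctionFinEquiv fun i => finProdFinEquiv (κ i)

theorem keyCode_lt {w : ℕ} (κ : GKey G w) : keyCode κ < keyBase G ^ w := Fin.is_lt _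

theorem keyCode_eq {w : ℕ} (κ : GKey G w) :
    keyCode κ = ∑ i, ((κ i).2 + numLetters G * (κ i).1 : ℕ) * keyBase G ^ (i : ℕ) := by
  rw [keyCode, finFunctionFinEquiv_apply]
  rfl

theorem keyCode_div_mod {w : ℕ} (κ : GKey G w) (i : Fin w) :
    keyCode κ / keyBase G ^ (i : ℕ) % keyBase G = (κ i).2 + numLetters G * (κ i).1 := by
  have h := congrFun (finFunctionFinEquiv.symm_apply_apply fun i => finProdFinEquiv (κ i)) i
  have h' := congrArg Fin.val h
  rw [finFunctionFinEquiv_symm_apply_val] at h'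
  exact h'

/-- The new digit is added before the old one is removed, so the truncated subtraction loses
nothing. -/
theorem keyCode_update {w : ℕ} (κ : GKey G w) (i : Fin w) (p : Fin n × Fin (numLetters G)) :
    keyCode (Function.update κ i p) = keyCode κ + (p.2 + numLetters G * p.1 : ℕ) * keyBase G ^ (i : ℕ) -
      ((κ i).2 + numLetters G * (κ i).1 : ℕ) * keyBase G ^ (i : ℕ) := by
  rw [keyCode_eq, keyCode_eq, ← add_sum_erase _ _ (mem_univ i),
    ← add_sum_erase (a := i) univ (fun i => ((κ i).2 + numLetters G * (κ i).1 : ℕ) * keyBase G ^ (i : ℕ))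
      (mem_univ i), Function.update_self]
  rw [sum_congr rfl (g := fun i => ((κ i).2 + numLetters G * (κ i).1 : ℕ) * keyBase G ^ (i : ℕ))
    fun j hj => by rw [Function.update_of_ne (ne_of_mem_erase hj)]]
  omega

/-- With vertex zero as the root all digits equal `x`, so the geometric sum of the powers of the
base is the only extra parameter for the root keys. -/
theorem keyCode_const {w : ℕ} (hn : 0 < n) (x : Fin (numLetters G)) :
    keyCode (constKey w ⟨0, hn⟩ x) = x * ∑ j ∈ range w, keyBase G ^ j := by
  rw [keyCode_eq, mul_sum, Finset.sum_range fun j => (x : ℕ) * keyBase G ^ j]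
  refine sum_congr rfl fun i _ => ?_
  simp [constKey]

variable (G) in
/-- The variables from `20` on hold the parameters, and the cap is large enough. -/
structure Setup (w : ℕ) (M : Mem) (V : ℕ → ℕ) : Prop where
  size_pos : 0 < n
  adj : ∀ u v : Fin n, M.src (1 + (u * n + v)) = ind (G.Adj u v)
  size : V 20 = n
  edges : V 21 = edgeCount G
  rounds : V 22 = numRounds G
  letters : V 23 = numLetters G
  base : V 24 = keyBase G
  width : V 25 = w
  keys : V 26 = keyBase G ^ w
  nodes : V 27 = numNodes G
  geom : V 28 = ∑ j ∈ range w, keyBase G ^ j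
  cap_values : (numRounds G + 1) * numNodes G * (n + 1) * keyBase G ^ w * n * n ≤ M.cap
  cap_polys : (numRounds G + 1) * (numNodes G + 1) * (numNodes G + 1) ≤ M.cap
  width_le : w ≤ M.cap
  width_pos : 0 < w

end

namespace Setup

variable {n : ℕ} {G : Digraph (Fin n)} {w : ℕ} {M : Mem} {V : ℕ → ℕ}

theorem congr (h : Setup G w M V) {M' : Mem} {V' : ℕ → ℕ} (hs : M'.src = M.src)
    (hc : M'.cap = M.cap) (hV : ∀ j, 20 ≤ j → V' j = V j) : Setup G w M' V' where
  size_pos := h.size_pos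
  adj := hs ▸ h.adj
  size := (hV _ le_rfl).trans h.size
  edges := (hV _ (by decide)).trans h.edges
  rounds := (hV _ (by decide)).trans h.rounds
  letters := (hV _ (by decide)).trans h.letters
  base := (hV _ (by decide)).trans h.base
  width := (hV _ (by decide)).trans h.width
  keys := (hV _ (by decide)).trans h.keys
  nodes := (hV _ (by decide)).trans h.nodes
  geom := (hV _ (by decide)).trans h.geom
  cap_values := hc ▸ h.cap_values
  cap_polys := hc ▸ h.cap_polys
  width_le := hc ▸ h.width_le
  width_pos := h.width_pos

theorem update (h : Setup G w M V) {j : ℕ} (a : ℕ) (hj : j < 20 := by decide) :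
    Setup G w M (Function.update V j a) :=
  h.congr rfl rfl fun i hi => Function.update_of_ne (by omega) _ _

theorem bind (h : Setup G w M V) (a b c : ℕ) : Setup G w M (bind3 V a b c) :=
  h.congr rfl rfl fun _ hi => bind3_of_lt _ _ _ (by omega)

theorem base_pos (h : Setup G w M V) : 0 < keyBase G :=
  Nat.mul_pos h.size_pos (numLetters_pos G)

theorem keys_pos (h : Setup G w M V) : 0 < keyBase G ^ w := Nat.pow_pos h.base_pos

theorem keys_le (h : Setup G w M V) : keyBase G ^ w ≤ M.cap := by
  refine le_trans ?_ h.cap_values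
  have h1 : 1 ≤ (numRounds G + 1) * numNodes G * (n + 1) :=
    Nat.mul_pos (Nat.mul_pos (Nat.succ_pos _) (Nat.succ_pos _)) (Nat.succ_pos _)
  have h2 := h.size_pos
  calc keyBase G ^ w = 1 * keyBase G ^ w * 1 * 1 := by ring
    _ ≤ _ := Nat.mul_le_mul (Nat.mul_le_mul (Nat.mul_le_mul h1 le_rfl) h2) h2

theorem base_le (h : Setup G w M V) : keyBase G ≤ M.cap :=
  (Nat.le_self_pow h.width_pos.ne' _).trans h.keys_le

theorem letters_le (h : Setup G w M V) : numLetters G ≤ M.cap :=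
  (Nat.le_mul_of_pos_left _ h.size_pos).trans h.base_le

theorem rounds_le (h : Setup G w M V) : numRounds G ≤ M.cap :=
  (Nat.le_mul_of_pos_left _ two_pos).trans h.letters_le

theorem size_le (h : Setup G w M V) : n ≤ M.cap :=
  (Nat.le_mul_of_pos_right _ (numLetters_pos G)).trans h.base_le

theorem nodes_le (h : Setup G w M V) : numNodes G + 1 ≤ M.cap :=
  (Nat.le_mul_of_pos_left _ (Nat.mul_pos (by omega) (by omega))).trans h.cap_polys

theorem keyCode_le (h : Setup G w M V) (κ : GKey G w) : keyCode κ ≤ M.cap :=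
  (keyCode_lt κ).le.trans h.keys_le

end Setup

namespace NTerm

def adj (u v : NTerm) : NTerm :=
  lt (lit 0) (add (inp (add (lit 1) (add (mul u (var 20)) v)))
    (inp (add (lit 1) (add (mul v (var 20)) u))))

def arc (u v : NTerm) : NTerm := inp (add (lit 1) (add (mul u (var 20)) v))

def basePow (i : NTerm) : NTerm := app i (lit 0) (lit 0) (pow 3 (var 24) (var 0))

def digit (K i : NTerm) : NTerm :=
  app K i (lit 0) (mod (div (var 0) (basePow (var 1))) (var 24))

def digitVertex (K i : NTerm) : NTerm := div (digit K i) (var 23)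

def digitLetter (K i : NTerm) : NTerm := mod (digit K i) (var 23)

def isFirst (K u i : NTerm) : NTerm :=
  app K u i (mul (eq (digitVertex (var 0) (var 2)) (var 1))
    (all 3 (var 2) (not (eq (digitVertex (var 0) (var 3)) (var 1)))))

def isKey (K u : NTerm) : NTerm :=
  app K u (lit 0) (ex 3 (var 25) (eq (digitVertex (var 0) (var 3)) (var 1)))

def keyVal (K u : NTerm) : NTerm :=
  app K u (lit 0) (big false 4 (var 25)
    (mul (isFirst (var 0) (var 1) (var 4)) (digitLetter (var 0) (var 4))))

def keyUpdate (K i v x : NTerm) : NTerm :=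
  sub (add K (mul (add x (mul (var 23) v)) (basePow i))) (mul (digit K i) (basePow i))

end NTerm

section
variable {n : ℕ} {G : Digraph (Fin n)} {w : ℕ} {M : Mem} {V : ℕ → ℕ} {κ : GKey G w} {u v : Fin n}
  {i : Fin w} {x : Fin (numLetters G)} {eK eu ev ei ex : NTerm}

theorem Setup.eval_arc (h : Setup G w M V) (hu : eu.eval M V = u) (hv : ev.eval M V = v) :
    (NTerm.arc eu ev).eval M V = ind (G.Adj u v) := by
  simp only [NTerm.arc, NTerm.eval_inp, NTerm.eval_add, NTerm.eval_mul, NTerm.eval_lit,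
    NTerm.eval_var, hu, hv, h.size, h.adj]

theorem Setup.eval_adj (h : Setup G w M V) (hG : Acyclic G) (hu : eu.eval M V = u)
    (hv : ev.eval M V = v) :
    (NTerm.adj eu ev).eval M V = ind (G.toSimpleGraphInclusive.Adj u v) := by
  rw [NTerm.adj, NTerm.eval_pos (x := ind (G.Adj u v) + ind (G.Adj v u))]
  · refine ind_congr ?_
    rw [Digraph.toSimpleGraphInclusive, SimpleGraph.fromRel_adj, Nat.add_pos_iff_pos_or_pos,
      ind_pos, ind_pos]
    refine ⟨fun h' => ⟨?_, h'⟩, fun h' => h'.2⟩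
    rintro rfl
    exact hG u (.single (h'.elim id id))
  · exact congrArg₂ (· + ·) (h.eval_arc hu hv) (h.eval_arc hv hu)

theorem Setup.eval_basePow (h : Setup G w M V) (hi : ei.eval M V = i) :
    (NTerm.basePow ei).eval M V = keyBase G ^ (i : ℕ) := by
  rw [NTerm.basePow, NTerm.eval_app, NTerm.eval_pow (k := i) (x := keyBase G)]
  · simpa using hi
  · exact i.2.le.trans h.width_le
  · intro j
    exact ((h.bind _ _ _).update j).base

theorem Setup.eval_digit (h : Setup G w M V) (hK : eK.eval M V = keyCode κ)
    (hi : ei.eval M V = i) :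
    (NTerm.digit eK ei).eval M V = (κ i).2 + numLetters G * (κ i).1 := by
  have h1 := h.bind (eK.eval M V) (ei.eval M V) 0
  rw [NTerm.digit, NTerm.eval_app, NTerm.eval_lit, ← keyCode_div_mod]
  refine NTerm.eval_mod (NTerm.eval_div (by simpa using hK) (h1.eval_basePow (by simpa using hi))
    (h.keyCode_le κ) (Nat.pow_pos h.base_pos)) h1.base
    ((Nat.div_le_self _ _).trans (h.keyCode_le κ)) h.base_pos

theorem digit_lt (κ : GKey G w) (i : Fin w) :
    ((κ i).2 + numLetters G * (κ i).1 : ℕ) < keyBase G := by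
  rw [← keyCode_div_mod]
  refine Nat.mod_lt _ ?_
  have := (κ i).1.pos
  exact Nat.mul_pos this (numLetters_pos G)

theorem Setup.eval_digitVertex (h : Setup G w M V) (hK : eK.eval M V = keyCode κ)
    (hi : ei.eval M V = i) : (NTerm.digitVertex eK ei).eval M V = (κ i).1 := by
  rw [NTerm.digitVertex, NTerm.eval_div (b := .var 23) (h.eval_digit hK hi) h.letters
    ((digit_lt κ i).le.trans h.base_le) (numLetters_pos G), Nat.add_mul_div_left _ _ (numLetters_pos G),
    Nat.div_eq_of_lt (κ i).2.2, zero_add]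

theorem Setup.eval_digitLetter (h : Setup G w M V) (hK : eK.eval M V = keyCode κ)
    (hi : ei.eval M V = i) : (NTerm.digitLetter eK ei).eval M V = (κ i).2 := by
  rw [NTerm.digitLetter, NTerm.eval_mod (b := .var 23) (h.eval_digit hK hi) h.letters
    ((digit_lt κ i).le.trans h.base_le) (numLetters_pos G), Nat.add_mul_mod_self_left,
    Nat.mod_eq_of_lt (κ i).2.2]

theorem Setup.eval_isFirst (h : Setup G w M V) (hK : eK.eval M V = keyCode κ)
    (hu : eu.eval M V = u) (hi : ei.eval M V = i) :
    (NTerm.isFirst eK eu ei).eval M V = ind (IsFirst κ u i) := by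
  have h1 := h.bind (eK.eval M V) (eu.eval M V) (ei.eval M V)
  rw [NTerm.isFirst, NTerm.eval_app, NTerm.eval_and (p := (κ i).1 = u)
    (q := ∀ j : Fin i, (κ ⟨j, j.2.trans i.2⟩).1 ≠ u)]
  · refine ind_congr ?_
    refine and_congr_right fun _ => ⟨fun h' j hj => h' ⟨j, hj⟩, fun h' j => h' _ j.2⟩
  · refine (NTerm.eval_eq_ind (h1.eval_digitVertex (κ := κ) (i := i) (by simpa using hK)
      (by simpa using hi)) (by simpa using hu)).trans (ind_congr (by rw [Fin.ext_iff]))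
  · refine NTerm.eval_all (by simpa using hi) (i.2.le.trans h.width_le) fun j => NTerm.eval_not ?_
    refine (NTerm.eval_eq_ind ((h1.update j).eval_digitVertex (κ := κ) (i := ⟨j, j.2.trans i.2⟩)
      (by simpa using hK) (by simp)) (by simpa using hu)).trans (ind_congr (by rw [Fin.ext_iff]))

theorem Setup.eval_isKey (h : Setup G w M V) (hK : eK.eval M V = keyCode κ)
    (hu : eu.eval M V = u) : (NTerm.isKey eK eu).eval M V = ind (u ∈ keySet κ) := by
  have h1 := h.bind (eK.eval M V) (eu.eval M V) 0
  rw [NTerm.isKey, NTerm.eval_app, NTerm.eval_ex (P := fun j : Fin w => (κ j).1 = u)]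
  · exact ind_congr mem_keySet.symm
  · exact h1.width
  · exact h.width_le
  · intro j
    refine (NTerm.eval_eq_ind ((h1.update j).eval_digitVertex (κ := κ) (i := j)
      (by simpa using hK) (by simp)) (by simpa using hu)).trans (ind_congr (by rw [Fin.ext_iff]))

theorem Setup.eval_keyVal (h : Setup G w M V) (hK : eK.eval M V = keyCode κ)
    (hu : eu.eval M V = u) : (NTerm.keyVal eK eu).eval M V = keyVal κ u := by
  classical
  have h1 := h.bind (eK.eval M V) (eu.eval M V) 0
  rw [NTerm.keyVal, NTerm.eval_app, NTerm.eval_lit, NTerm.eval_sum_fin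
    (f := fun j : Fin w => if IsFirst κ u j then ((κ j).2 : ℕ) else 0)]
  · unfold keyVal
    exact sum_congr rfl fun j _ => if_congr Iff.rfl rfl rfl
  · exact h1.width
  · exact h.width_le
  · intro j
    have h2 := h1.update (j := 4) j
    rw [NTerm.eval_mul, h2.eval_isFirst (κ := κ) (u := u) (i := j) (by simpa using hK)
      (by simpa using hu) (by simp), h2.eval_digitLetter (κ := κ) (i := j) (by simpa using hK)
      (by simp)]
    unfold ind
    split_ifs <;> simp

theorem Setup.eval_keyUpdate (h : Setup G w M V) (hK : eK.eval M V = keyCode κ)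
    (hi : ei.eval M V = i) (hv : ev.eval M V = v) (hx : ex.eval M V = x) :
    (NTerm.keyUpdate eK ei ev ex).eval M V = keyCode (Function.update κ i (v, x)) := by
  rw [keyCode_update]
  simp only [NTerm.keyUpdate, NTerm.eval_sub, NTerm.eval_add, NTerm.eval_mul, NTerm.eval_var,
    h.eval_basePow hi, h.eval_digit hK hi, hK, hv, hx, h.letters]

end

end RealRAM

/-! ## Tables for components and for feasible keys -/

namespace PairwiseSum

open Finset

variable {n : ℕ} (H : SimpleGraph (Fin n)) (S : Finset (Fin n)) (c : Fin n)

/-- There is a walk with at most `r` steps from `c` to `v` outside `S`. -/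
def ReachIn : ℕ → Fin n → Prop
  | 0, v => v = c ∧ c ∉ S
  | r + 1, v => ReachIn r v ∨ v ∉ S ∧ ∃ u, ReachIn r u ∧ H.Adj u v

variable {H S c}

theorem ReachIn.mem_component {r : ℕ} {v : Fin n} (h : ReachIn H S c r v) :
    v ∈ component H S c := by
  induction r generalizing v with
  | zero =>
    obtain ⟨rfl, h⟩ := h
    exact mem_component_self h
  | succ r ih =>
    rcases h with h | ⟨hv, u, hu, e⟩
    · exact ih h
    · exact mem_component_of_adj (ih hu) e hv

theorem ReachIn.mono {r r' : ℕ} {v : Fin n} (h : ReachIn H S c r v) (hr : r ≤ r') :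
    ReachIn H S c r' v := by
  induction hr with
  | refl => exact h
  | step _ ih => exact .inl ih

theorem ReachIn.of_walk {r : ℕ} {u v : Fin n} (h : ReachIn H S c r u) (p : (avoid H S).Walk u v) :
    ReachIn H S c (r + p.length) v := by
  induction p generalizing r with
  | nil => exact h
  | cons e p ih =>
    have := ih (r := r + 1) (.inr ⟨e.2.2, _, h, e.1⟩)
    rw [SimpleGraph.Walk.length_cons]
    exact this.mono (by omega)

/-- A walk can be shortened to a path, which has fewer than `n` steps. -/
theorem reachIn_iff {v : Fin n} : ReachIn H S c n v ↔ v ∈ component H S c := by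
  classical
  refine ⟨ReachIn.mem_component, fun h => ?_⟩
  obtain ⟨hc, ⟨p⟩⟩ := mem_component.1 h
  have h0 : ReachIn H S c 0 c := ⟨rfl, hc⟩
  refine (h0.of_walk p.bypass).mono ?_
  have := p.bypass_isPath.length_lt
  rw [Fintype.card_fin] at this
  omega

end PairwiseSum

namespace RealRAM

open Finset PairwiseSum LongestPath

theorem radix_div (x : ℕ) {b r : ℕ} (h : r < b) : (x * b + r) / b = x := by
  rw [mul_comm, Nat.mul_add_div (by omega), Nat.div_eq_of_lt h, add_zero]

theorem radix_mod (x : ℕ) {b r : ℕ} (h : r < b) : (x * b + r) % b = r := by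
  rw [mul_comm, Nat.mul_add_mod, Nat.mod_eq_of_lt h]

/-- Mixed-radix indices are compared by their leading digits. This yields both the bounds for the
tables and the fact that entries of an earlier round have smaller indices. -/
theorem radix_lt {x y b r r' : ℕ} (h : x < y) (hr : r < b) : x * b + r < y * b + r' := by
  have := Nat.mul_le_mul_right b (Nat.succ_le_of_lt h)
  rw [Nat.succ_mul] at this
  omega

namespace NTerm

abbrev size : NTerm := var 20

abbrev keys : NTerm := var 26

abbrev or (a b : NTerm) : NTerm := lt (lit 0) (add a b)

def reachIndex (r K c v : NTerm) : NTerm :=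
  add (mul (add (mul (add (mul r keys) K) size) c) size) v

def reach (K c v : NTerm) : NTerm := tab 0 (reachIndex size K c v)

def feasIndex (r K c : NTerm) : NTerm := add (mul (add (mul r keys) K) size) c

def feas (r K c : NTerm) : NTerm := tab 1 (feasIndex r K c)

/-- Variables `10` to `13` receive the digits of the index, the least significant first: target
vertex, start vertex, code of the key, and round. -/
def reachFill : NTerm :=
  bind 10 (mod (var 0) size) (bind 11 (mod (div (var 0) size) size)
    (bind 12 (mod (div (div (var 0) size) size) keys) (bind 13 (div (div (div (var 0) size) size) keys)
      (add (mul (eq (var 13) (lit 0)) (mul (eq (var 10) (var 11)) (not (isKey (var 12) (var 11)))))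
        (mul (lt (lit 0) (var 13))
          (or (tab 0 (reachIndex (sub (var 13) (lit 1)) (var 12) (var 11) (var 10)))
            (mul (not (isKey (var 12) (var 10))) (ex 5 size
              (mul (tab 0 (reachIndex (sub (var 13) (lit 1)) (var 12) (var 11) (var 5)))
                (adj (var 5) (var 10)))))))))))

/-- Whether the key in variable `11` may be changed to the vertex in variable `7` at the slot in
variable `6`, if the component of variable `10` is eliminated. -/
def usable (r : NTerm) : NTerm :=
  mul (reach (var 11) (var 10) (var 7)) (mul
    (all 8 size (imp (isFirst (var 11) (var 8) (var 6))
      (all 9 size (imp (reach (var 11) (var 10) (var 9)) (not (adj (var 8) (var 9)))))))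
    (all 15 size (imp (reach (var 11) (var 10) (var 15)) (imp (not (eq (var 15) (var 7)))
      (all 16 (var 23) (feas r (keyUpdate (var 11) (var 6) (var 7) (var 16)) (var 15)))))))

def feasFill : NTerm :=
  bind 10 (mod (var 0) size) (bind 11 (mod (div (var 0) size) keys)
    (bind 12 (div (div (var 0) size) keys)
      (mul (lt (lit 0) (var 12)) (ex 6 (var 25) (ex 7 size (usable (sub (var 12) (lit 1))))))))

end NTerm

section
variable {n : ℕ} {G : Digraph (Fin n)} {w : ℕ} {M : Mem} {V : ℕ → ℕ}

variable (G) in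
abbrev skeleton : SimpleGraph (Fin n) := G.toSimpleGraphInclusive

variable (G) in
/-- The first natural table holds the components. -/
def HasReach (w : ℕ) (M : Mem) : Prop := ∀ (κ : GKey G w) (c v : Fin n),
  M.nat 0 (((n * keyBase G ^ w + keyCode κ) * n + c) * n + v) =
    ind (v ∈ keyComponent (skeleton G) κ c)

variable (G) in
/-- The second natural table holds the keys that are feasible in `r` rounds. -/
def HasFeas (w : ℕ) (M : Mem) (r : ℕ) : Prop := ∀ (κ : GKey G w) (c : Fin n),
  M.nat 1 ((r * keyBase G ^ w + keyCode κ) * n + c) = ind (Feasible (skeleton G) r κ c)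

theorem Setup.reachIndex_lt (h : Setup G w M V) {r : ℕ} (hr : r ≤ n) (κ : GKey G w) (c v : Fin n) :
    ((r * keyBase G ^ w + keyCode κ) * n + c) * n + v < M.cap := by
  refine lt_of_lt_of_le ?_ h.cap_values
  have h1 : r * keyBase G ^ w + keyCode κ < (n + 1) * keyBase G ^ w := by
    have := radix_lt (r' := 0) (Nat.lt_succ_of_le hr) (keyCode_lt κ)
    exact this
  have h2 : (r * keyBase G ^ w + keyCode κ) * n + c < (n + 1) * keyBase G ^ w * n :=
    radix_lt (r' := 0) h1 c.2
  have h3 : ((r * keyBase G ^ w + keyCode κ) * n + c) * n + v < (n + 1) * keyBase G ^ w * n * n :=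
    radix_lt (r' := 0) h2 v.2
  refine h3.trans_le ?_
  have h4 : 1 ≤ (numRounds G + 1) * numNodes G := Nat.mul_pos (Nat.succ_pos _) (Nat.succ_pos _)
  calc (n + 1) * keyBase G ^ w * n * n = 1 * ((n + 1) * keyBase G ^ w * n * n) := (one_mul _).symm
    _ ≤ (numRounds G + 1) * numNodes G * ((n + 1) * keyBase G ^ w * n * n) := Nat.mul_le_mul_right _ h4
    _ = _ := by ring

theorem Setup.feasIndex_lt (h : Setup G w M V) {r : ℕ} (hr : r ≤ n) (κ : GKey G w) (c : Fin n) :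
    (r * keyBase G ^ w + keyCode κ) * n + c < M.cap := by
  refine lt_of_le_of_lt ?_ (h.reachIndex_lt hr κ c ⟨0, h.size_pos⟩)
  exact (Nat.le_mul_of_pos_right _ h.size_pos).trans (Nat.le_add_right _ _)

theorem Setup.eval_size (h : Setup G w M V) : NTerm.size.eval M V = n := h.size

theorem Setup.eval_keys (h : Setup G w M V) : NTerm.keys.eval M V = keyBase G ^ w := h.keys

theorem Setup.eval_letters (h : Setup G w M V) : (NTerm.var 23).eval M V = numLetters G := h.letters

theorem Setup.eval_width (h : Setup G w M V) : (NTerm.var 25).eval M V = w := h.width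

section
variable {e : NTerm} {x y r : ℕ}

theorem Setup.eval_modSize (h : Setup G w M V) (he : e.eval M V = x * n + r) (hr : r < n)
    (hx : x * n + r ≤ M.cap) : (NTerm.mod e .size).eval M V = r := by
  rw [NTerm.eval_mod he h.eval_size hx h.size_pos, radix_mod _ hr]

theorem Setup.eval_divSize (h : Setup G w M V) (he : e.eval M V = x * n + r) (hr : r < n)
    (hx : x * n + r ≤ M.cap) : (NTerm.div e .size).eval M V = x := by
  rw [NTerm.eval_div he h.eval_size hx h.size_pos, radix_div _ hr]

theorem Setup.eval_modKeys (h : Setup G w M V) (he : e.eval M V = x * keyBase G ^ w + r)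
    (hr : r < keyBase G ^ w) (hx : x * keyBase G ^ w + r ≤ M.cap) :
    (NTerm.mod e .keys).eval M V = r := by
  rw [NTerm.eval_mod he h.eval_keys hx h.keys_pos, radix_mod _ hr]

theorem Setup.eval_divKeys (h : Setup G w M V) (he : e.eval M V = x * keyBase G ^ w + r)
    (hr : r < keyBase G ^ w) (hx : x * keyBase G ^ w + r ≤ M.cap) :
    (NTerm.div e .keys).eval M V = x := by
  rw [NTerm.eval_div he h.eval_keys hx h.keys_pos, radix_div _ hr]

end

section
variable {κ : GKey G w} {c u v : Fin n} {i : Fin w} {r : ℕ} {er eK ec ev : NTerm}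

theorem Setup.eval_reachIndex (h : Setup G w M V) (hr : er.eval M V = r)
    (hK : eK.eval M V = keyCode κ) (hc : ec.eval M V = c) (hv : ev.eval M V = v) :
    (NTerm.reachIndex er eK ec ev).eval M V =
      ((r * keyBase G ^ w + keyCode κ) * n + c) * n + v := by
  simp only [NTerm.reachIndex, NTerm.eval_add, NTerm.eval_mul, NTerm.eval_var, h.keys, h.size,
    hr, hK, hc, hv]

theorem Setup.eval_feasIndex (h : Setup G w M V) (hr : er.eval M V = r)
    (hK : eK.eval M V = keyCode κ) (hc : ec.eval M V = c) :
    (NTerm.feasIndex er eK ec).eval M V = (r * keyBase G ^ w + keyCode κ) * n + c := by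
  simp only [NTerm.feasIndex, NTerm.eval_add, NTerm.eval_mul, NTerm.eval_var, h.keys, h.size,
    hr, hK, hc]

theorem Setup.eval_reach (h : Setup G w M V) (hM : HasReach G w M) (hK : eK.eval M V = keyCode κ)
    (hc : ec.eval M V = c) (hv : ev.eval M V = v) :
    (NTerm.reach eK ec ev).eval M V = ind (v ∈ keyComponent (skeleton G) κ c) := by
  rw [NTerm.reach, NTerm.eval_tab, h.eval_reachIndex (r := n) h.eval_size hK hc hv, hM]

theorem Setup.eval_feas (h : Setup G w M V) (hM : HasFeas G w M r) (hr : er.eval M V = r)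
    (hK : eK.eval M V = keyCode κ) (hc : ec.eval M V = c) :
    (NTerm.feas er eK ec).eval M V = ind (Feasible (skeleton G) r κ c) := by
  rw [NTerm.feas, NTerm.eval_tab, h.eval_feasIndex hr hK hc, hM]

theorem Setup.eval_usable (h : Setup G w M V) (hG : Acyclic G) (hM : HasReach G w M)
    (hF : HasFeas G w M r) (hr : ∀ a b : ℕ,
      er.eval M (Function.update (Function.update V 15 a) 16 b) = r)
    (hK : V 11 = keyCode κ) (hc : V 10 = c) (hi : V 6 = i) (hv : V 7 = v) :
    (NTerm.usable er).eval M V =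
      ind (Usable (skeleton G) (Feasible (skeleton G) r) κ c i v) := by
  unfold NTerm.usable
  refine NTerm.eval_and (h.eval_reach hM (κ := κ) (c := c) (v := v) hK hc hv)
    (NTerm.eval_and ?_ ?_)
  · refine NTerm.eval_all h.eval_size h.size_le fun u => ?_
    have h1 := h.update (j := 8) u
    refine NTerm.eval_imp (h1.eval_isFirst (κ := κ) (u := u) (i := i)
      (by simp [hK]) (by simp) (by simp [hi])) ?_
    have h2 : ∀ v', _ := fun v' => h1.update (j := 9) v'
    refine (NTerm.eval_all h1.eval_size h.size_le fun v' : Fin n => NTerm.eval_imp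
      ((h2 v').eval_reach hM (κ := κ) (c := c) (v := v') (by simp [hK]) (by simp [hc]) (by simp))
      (NTerm.eval_not ((h2 v').eval_adj hG (u := u) (v := v') (by simp) (by simp)))).trans
      (ind_congr Iff.rfl)
  · refine NTerm.eval_all h.eval_size h.size_le fun c' => ?_
    have h1 := h.update (j := 15) c'
    refine NTerm.eval_imp (h1.eval_reach hM (κ := κ) (c := c) (v := c') (by simp [hK])
      (by simp [hc]) (by simp)) (NTerm.eval_imp (NTerm.eval_not ((NTerm.eval_eq_ind
        (x := c') (y := v) (by simp) (by simp [hv])).trans (ind_congr (Fin.ext_iff).symm))) ?_)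
    refine NTerm.eval_all h1.eval_letters h.letters_le fun x => ?_
    have h2 := h1.update (j := 16) x
    exact h2.eval_feas hF (hr _ _) (h2.eval_keyUpdate (κ := κ) (i := i) (v := v) (x := x)
      (by simp [hK]) (by simp [hi]) (by simp [hv]) (by simp)) (by simp)

end

theorem Setup.reachFill_spec (h : Setup G w M V) (hG : Acyclic G) :
    ∃ f, M.fillNat V 0 NTerm.reachFill M.cap = { M with nat := Function.update M.nat 0 f } ∧
      HasReach G w { M with nat := Function.update M.nat 0 f } := by
  -- The property refers to all ways of writing `a` as an index; if there are none, nothing is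
  -- claimed about that entry.
  refine (M.fillNat_spec V 0 NTerm.reachFill (fun a y => ∀ r ≤ n, ∀ (κ : GKey G w)
    (c v : Fin n), a = ((r * keyBase G ^ w + keyCode κ) * n + c) * n + v →
      y = ind (ReachIn (skeleton G) (keySet κ) c r v)) M.cap ?_).elim
    fun f ⟨hf, hg⟩ => ⟨f, hf, fun κ c v => ?_⟩
  swap
  · simp only [Function.update_self]
    rw [hg _ (h.reachIndex_lt le_rfl κ c v) n le_rfl κ c v rfl]
    exact ind_congr reachIn_iff
  · intro a ha f hf r hr κ c v hav
    set M' : Mem := { M with nat := Function.update M.nat 0 f } with hM'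
    have h0 : Setup G w M' (Function.update V 0 a) := (h.update a).congr rfl rfl fun _ _ => rfl
    have hn := h.size_pos
    have hc : a ≤ M'.cap := ha.le
    subst hav
    set a₁ := (r * keyBase G ^ w + keyCode κ) * n + c with ha₁
    have l₁ : a₁ ≤ a₁ * n + v := (Nat.le_mul_of_pos_right _ hn).trans (Nat.le_add_right _ _)
    have l₂ : r * keyBase G ^ w + keyCode κ ≤ a₁ :=
      (Nat.le_mul_of_pos_right _ hn).trans (Nat.le_add_right _ _)
    have l₃ : r ≤ r * keyBase G ^ w + keyCode κ :=
      (Nat.le_mul_of_pos_right _ h.keys_pos).trans (Nat.le_add_right _ _)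
    have ha' : a₁ * n + v < M'.cap := ha
    have d₀ : ∀ V', Setup G w M' V' → V' 0 = a₁ * n + v →
        (NTerm.div (.var 0) .size).eval M' V' = a₁ := fun V' hV h0 =>
      hV.eval_divSize h0 v.2 hc
    have d₁ : ∀ V', Setup G w M' V' → V' 0 = a₁ * n + v →
        (NTerm.div (.div (.var 0) .size) .size).eval M' V' = r * keyBase G ^ w + keyCode κ :=
      fun V' hV h0 => hV.eval_divSize (d₀ V' hV h0) c.2 (l₁.trans hc)
    unfold NTerm.reachFill
    rw [NTerm.eval_bind (x := v) (fun b => (h0.update b).eval_modSize (by simp) v.2 hc)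
        (by have := v.2; omega),
      NTerm.eval_bind (x := c) (fun b => ((h0.update _).update b).eval_modSize
        (d₀ _ ((h0.update _).update b) (by simp)) c.2 (l₁.trans hc)) (by have := c.2; omega),
      NTerm.eval_bind (x := keyCode κ) (fun b => (((h0.update _).update _).update b).eval_modKeys
        (d₁ _ (((h0.update _).update _).update b) (by simp)) (keyCode_lt κ)
          (l₂.trans (l₁.trans hc))) (by omega),
      NTerm.eval_bind (x := r) (fun b => ((((h0.update _).update _).update _).update b).eval_divKeys
        (d₁ _ ((((h0.update _).update _).update _).update b) (by simp)) (keyCode_lt κ)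
          (l₂.trans (l₁.trans hc))) (by omega)]
    have h4 := (((h0.update (j := 10) v).update (j := 11) c).update (j := 12)
      (keyCode κ)).update (j := 13) r
    set V4 := Function.update (Function.update (Function.update (Function.update
      (Function.update V 0 (a₁ * n + v)) 10 v) 11 c) 12 (keyCode κ)) 13 r with hV4
    have e10 : V4 10 = v := by simp [hV4]
    have e11 : V4 11 = c := by simp [hV4]
    have e12 : V4 12 = keyCode κ := by simp [hV4]
    have e13 : V4 13 = r := by simp [hV4]
    have t10 : (NTerm.var 10).eval M' V4 = v := e10
    have t11 : (NTerm.var 11).eval M' V4 = c := e11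
    have t13 : (NTerm.var 13).eval M' V4 = r := e13
    have k11 : (NTerm.isKey (.var 12) (.var 11)).eval M' V4 = ind (c ∈ keySet κ) :=
      h4.eval_isKey e12 e11
    have k10 : (NTerm.isKey (.var 12) (.var 10)).eval M' V4 = ind (v ∈ keySet κ) :=
      h4.eval_isKey e12 e10
    rw [NTerm.eval_add, NTerm.eval_and (NTerm.eval_eq_ind t13 (NTerm.eval_lit 0)) (NTerm.eval_and
      ((NTerm.eval_eq_ind t10 t11).trans (ind_congr (Fin.ext_iff).symm)) (NTerm.eval_not k11)),
      NTerm.eval_mul, NTerm.eval_lt, NTerm.eval_var, e13, NTerm.eval_lit]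
    cases r with
    | zero =>
      simp only [Nat.lt_irrefl, if_false, zero_mul, add_zero, true_and]
      rfl
    | succ r =>
      have hf' : ∀ v' : Fin n, f (((r * keyBase G ^ w + keyCode κ) * n + c) * n + v') =
          ind (ReachIn (skeleton G) (keySet κ) c r v') := by
        intro v'
        refine hf _ ?_ r (by omega) κ c v' rfl
        refine radix_lt (radix_lt ?_ c.2) v'.2
        rw [Nat.succ_mul]
        have := h.keys_pos
        omega
      rw [ind_false (by omega), zero_add, if_pos (by omega), one_mul]
      have hr1 : ∀ V', V' 13 = r + 1 → (NTerm.sub (.var 13) (.lit 1)).eval M' V' = r := by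
        intro V' h'
        simp [h']
      have ht : ∀ V', Setup G w M' V' → V' 13 = r + 1 → V' 12 = keyCode κ → V' 11 = c →
          ∀ (e : NTerm) (v' : Fin n), e.eval M' V' = v' →
          (NTerm.tab 0 (.reachIndex (.sub (.var 13) (.lit 1)) (.var 12) (.var 11) e)).eval M' V' =
            ind (ReachIn (skeleton G) (keySet κ) c r v') := by
        intro V' hV a13 a12 a11 e v' he
        rw [NTerm.eval_tab, hV.eval_reachIndex (eK := .var 12) (ec := .var 11) (hr1 V' a13) a12 a11 he, ← hf']
        simp [hM']
      have h5 := fun b => h4.update (j := 5) b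
      refine (NTerm.eval_pos (NTerm.eval_add _ _)).trans ?_
      rw [ht V4 h4 e13 e12 e11 (.var 10) v e10, NTerm.eval_and (NTerm.eval_not k10)
        (NTerm.eval_ex h4.eval_size h.size_le fun u : Fin n => NTerm.eval_and
          (ht _ (h5 u) (by simp [e13]) (by simp [e12]) (by simp [e11]) (.var 5) u (by simp))
          ((h5 u).eval_adj hG (u := u) (v := v) (by simp) (by simp [e10])))]
      refine ind_congr ?_
      rw [Nat.add_pos_iff_pos_or_pos, ind_pos, ind_pos]
      rfl

theorem Setup.feasFill_spec (h : Setup G w M V) (hG : Acyclic G) (hM : HasReach G w M) :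
    ∃ f, M.fillNat V 1 NTerm.feasFill M.cap = { M with nat := Function.update M.nat 1 f } ∧
      ∀ r ≤ n, HasFeas G w { M with nat := Function.update M.nat 1 f } r := by
  refine (M.fillNat_spec V 1 NTerm.feasFill (fun a y => ∀ r ≤ n, ∀ (κ : GKey G w)
    (c : Fin n), a = (r * keyBase G ^ w + keyCode κ) * n + c →
      y = ind (Feasible (skeleton G) r κ c)) M.cap ?_).elim
    fun f ⟨hf, hg⟩ => ⟨f, hf, fun r hr κ c => ?_⟩
  swap
  · simp only [Function.update_self]
    rw [hg _ (h.feasIndex_lt hr κ c) r hr κ c rfl]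
  · intro a ha f hf r hr κ c hav
    set M' : Mem := { M with nat := Function.update M.nat 1 f } with hM'
    have h0 : Setup G w M' (Function.update V 0 a) := (h.update a).congr rfl rfl fun _ _ => rfl
    have hn := h.size_pos
    have hc : a ≤ M'.cap := ha.le
    subst hav
    set a₁ := r * keyBase G ^ w + keyCode κ with ha₁
    have l₁ : a₁ ≤ a₁ * n + c := (Nat.le_mul_of_pos_right _ hn).trans (Nat.le_add_right _ _)
    have l₃ : r ≤ a₁ := (Nat.le_mul_of_pos_right _ h.keys_pos).trans (Nat.le_add_right _ _)
    have ha' : a₁ * n + c < M'.cap := ha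
    have d₀ : ∀ V', Setup G w M' V' → V' 0 = a₁ * n + c →
        (NTerm.div (.var 0) .size).eval M' V' = a₁ := fun V' hV h0 =>
      hV.eval_divSize h0 c.2 hc
    unfold NTerm.feasFill
    rw [NTerm.eval_bind (x := c) (fun b => (h0.update b).eval_modSize (by simp) c.2 hc)
        (by have := c.2; omega),
      NTerm.eval_bind (x := keyCode κ) (fun b => ((h0.update _).update b).eval_modKeys
        (d₀ _ ((h0.update _).update b) (by simp)) (keyCode_lt κ) (l₁.trans hc)) (by omega),
      NTerm.eval_bind (x := r) (fun b => (((h0.update _).update _).update b).eval_divKeys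
        (d₀ _ (((h0.update _).update _).update b) (by simp)) (keyCode_lt κ)
          (l₁.trans hc)) (by omega)]
    have h4 := ((h0.update (j := 10) c).update (j := 11) (keyCode κ)).update (j := 12) r
    set V4 := Function.update (Function.update (Function.update
      (Function.update V 0 (a₁ * n + c)) 10 c) 11 (keyCode κ)) 12 r with hV4
    have e10 : V4 10 = c := by simp [hV4]
    have e11 : V4 11 = keyCode κ := by simp [hV4]
    have e12 : V4 12 = r := by simp [hV4]
    rw [NTerm.eval_mul, NTerm.eval_lt, NTerm.eval_var, e12, NTerm.eval_lit]
    cases r with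
    | zero =>
      rw [if_neg (lt_irrefl _), zero_mul, ind_false]
      exact id
    | succ r =>
      rw [if_pos (by omega), one_mul]
      have hM'' : HasReach G w M' := by
        intro κ c v
        rw [← hM]
        simp [hM']
      have hF : HasFeas G w M' r := by
        intro κ' c'
        simp only [hM', Function.update_self]
        refine hf _ ?_ r (by omega) κ' c' rfl
        refine radix_lt ?_ c'.2
        refine lt_of_lt_of_le (b := (r + 1) * keyBase G ^ w) ?_ (Nat.le_add_right _ _)
        rw [Nat.succ_mul]
        have := keyCode_lt κ'
        omega
      have h5 := fun b => h4.update (j := 6) b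
      have h6 := fun b b' => (h5 b).update (j := 7) b'
      rw [NTerm.eval_ex h4.eval_width h.width_le fun i : Fin w =>
        NTerm.eval_ex (h5 i).eval_size h.size_le fun v : Fin n =>
          (h6 i v).eval_usable hG hM'' hF (κ := κ) (c := c) (i := i) (v := v)
            (fun a b => by simp [e12]) (by simp [e11]) (by simp [e10]) (by simp) (by simp)]
      rfl

end

end RealRAM

/-! ## The table of the dynamic program -/

namespace RealRAM

open Finset PairwiseSum LongestPath CompletionTime

namespace NTerm

/-- The number of time steps between the start at the letter `x` and the end at the letter `y`. -/
def duration (x y : NTerm) : NTerm := sub (sub (div y (lit 2)) (mod y (lit 2))) (div x (lit 2))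

/-- The power of the point in variable `13`, plus one. -/
def pointPow (e : NTerm) : NTerm :=
  app e (lit 0) (lit 0) (pow 3 (add (var 13) (lit 1)) (var 0))

def isLeast (K c : NTerm) : NTerm :=
  app K c (lit 0) (all 3 (var 1) (not (reach (var 0) (var 1) (var 3))))

def valIndex (N b r K c : NTerm) : NTerm :=
  add (mul (add (mul (add (mul (add (mul N (var 27)) b) (add size (lit 1))) r) keys) K) size) c

end NTerm

namespace RTerm

def weight (N x : NTerm) : RTerm :=
  mul (ofNat (.mul (.lt (.div x (.lit 2)) (.add N (.lit 1)))
      (.lt (.mod x (.lit 2)) (.add (.div x (.lit 2)) (.lit 1)))))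
    (sub (ofNat (.lit 1)) (ofNat (.mul (.lit 2) (.mod x (.lit 2)))))

def factor (u v x y : NTerm) : RTerm :=
  ite1 (.arc u v) (sub (ofNat (.pointPow (.var 14)))
    (ofNat (.pointPow (.sub (.var 14) (.duration x y)))))

def val (r K c : NTerm) : RTerm := tab 0 (.valIndex (.var 14) (.var 13) r K c)

def step (r : NTerm) : RTerm :=
  big false 16 (.var 23) (mul (mul (weight (.var 14) (.var 16))
    (big true 8 .size (ite1 (.isKey (.var 11) (.var 8))
      (mul (factor (.var 8) (.var 7) (.keyVal (.var 11) (.var 8)) (.var 16))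
        (factor (.var 7) (.var 8) (.var 16) (.keyVal (.var 11) (.var 8)))))))
    (big true 15 .size (ite1 (.mul (.reach (.var 11) (.var 10) (.var 15))
        (.mul (.not (.eq (.var 15) (.var 7)))
          (.isLeast (.keyUpdate (.var 11) (.var 6) (.var 7) (.var 16)) (.var 15))))
      (val r (.keyUpdate (.var 11) (.var 6) (.var 7) (.var 16)) (.var 15)))))

/-- In round zero the truncated predecessor makes the second factor refer to round zero itself,
possibly to entries not yet filled; the first factor discards that value. -/
def valBody : RTerm :=
  mul (ofNat (.lt (.lit 0) (.var 12))) (div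
    (big false 6 (.var 25) (big false 7 .size
      (mul (ofNat (.usable (.sub (.var 12) (.lit 1)))) (step (.sub (.var 12) (.lit 1))))))
    (big false 6 (.var 25) (big false 7 .size (ofNat (.usable (.sub (.var 12) (.lit 1)))))))

def valFill : RTerm :=
  bind 10 (.mod (.var 0) .size) (bind 11 (.mod (.div (.var 0) .size) .keys)
    (bind 12 (.mod (.div (.div (.var 0) .size) .keys) (.add .size (.lit 1)))
      (bind 13 (.mod (.div (.div (.div (.var 0) .size) .keys) (.add .size (.lit 1))) (.var 27))
        (bind 14 (.div (.div (.div (.div (.var 0) .size) .keys) (.add .size (.lit 1))) (.var 27))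
          valBody))))

end RTerm

section
variable {n : ℕ} {G : Digraph (Fin n)} {w : ℕ} {M : Mem} {V : ℕ → ℕ}

variable (G) in
noncomputable def valAddr {w : ℕ} (N b r : ℕ) (κ : GKey G w) (c : Fin n) : ℕ :=
  (((N * numNodes G + b) * (n + 1) + r) * keyBase G ^ w + keyCode κ) * n + c

variable (G) in
/-- The first real table holds the contributions of the components after `r` rounds, for `N` time
steps and the point `b`. -/
def HasVal (w : ℕ) (M : Mem) (N b r : ℕ) : Prop := ∀ (κ : GKey G w) (c : Fin n),
  M.real 0 (valAddr G N b r κ c) =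
    compVal (skeleton G) (letterWeight N) (pairFactor G N b) r κ c

theorem Setup.valAddr_lt (h : Setup G w M V) {N b r : ℕ} (hN : N < numRounds G)
    (hb : b < numNodes G) (hr : r ≤ n) (κ : GKey G w) (c : Fin n) :
    valAddr G N b r κ c < M.cap := by
  refine lt_of_lt_of_le ?_ h.cap_values
  have h1 : N * numNodes G + b < numRounds G * numNodes G := radix_lt (r' := 0) hN hb
  have h2 := radix_lt (r' := 0) h1 (Nat.lt_succ_of_le hr)
  have h3 := radix_lt (r' := 0) h2 (keyCode_lt κ)
  have h4 := radix_lt (r' := 0) h3 c.2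
  refine h4.trans_le ?_
  rw [add_zero]
  calc numRounds G * numNodes G * (n + 1) * keyBase G ^ w * n
      ≤ numRounds G * numNodes G * (n + 1) * keyBase G ^ w * n * n :=
        Nat.le_mul_of_pos_right _ h.size_pos
    _ ≤ _ := by gcongr; omega

section
variable {κ : GKey G w} {c u v : Fin n} {i : Fin w} {N b r x y : ℕ} {er eK ec ev eu ex ey : NTerm}

theorem eval_duration (hx : ex.eval M V = x) (hy : ey.eval M V = y) (hcx : x ≤ M.cap)
    (hcy : y ≤ M.cap) : (NTerm.duration ex ey).eval M V = inTime y - outTime x := by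
  simp only [NTerm.duration, NTerm.eval_sub, NTerm.eval_div hx (NTerm.eval_lit 2) hcx two_pos,
    NTerm.eval_div hy (NTerm.eval_lit 2) hcy two_pos,
    NTerm.eval_mod hy (NTerm.eval_lit 2) hcy two_pos, inTime, outTime]

theorem eval_pointPow (hx : ex.eval M V = x) (hc : x ≤ M.cap) (hb : V 13 = b) :
    (NTerm.pointPow ex).eval M V = (b + 1) ^ x := by
  rw [NTerm.pointPow, NTerm.eval_app, NTerm.eval_pow (k := x) (x := b + 1)]
  · simpa using hx
  · exact hc
  · intro j
    simp [bind3_of_lt, hb]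

theorem Setup.eval_isLeast (h : Setup G w M V) (hM : HasReach G w M)
    (hK : eK.eval M V = keyCode κ) (hc : ec.eval M V = c) :
    (NTerm.isLeast eK ec).eval M V = ind (IsLeast (skeleton G) (keySet κ) c) := by
  have h1 := h.bind (eK.eval M V) (ec.eval M V) 0
  rw [NTerm.isLeast, NTerm.eval_app, NTerm.eval_lit,
    NTerm.eval_all (P := fun v : Fin c => (⟨v, v.2.trans c.2⟩ : Fin n) ∉
      component (skeleton G) (keySet κ) c)]
  · exact ind_congr ⟨fun h' v hv => h' ⟨v, hv⟩, fun h' v => h' _ v.2⟩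
  · simpa using hc
  · exact c.2.le.trans h.size_le
  · intro v
    exact NTerm.eval_not ((h1.update v).eval_reach hM (κ := κ) (c := c) (v := ⟨v, v.2.trans c.2⟩)
      (by simpa using hK) (by simpa using hc) (by simp))

theorem eval_weight {eN : NTerm} (hN : eN.eval M V = N) (hx : ex.eval M V = x) (hcx : x ≤ M.cap) :
    (RTerm.weight eN ex).eval M V = letterWeight N x := by
  simp only [RTerm.weight, RTerm.eval_mul, RTerm.eval_sub, RTerm.eval_ofNat, NTerm.eval_mul,
    NTerm.eval_lt, NTerm.eval_add, NTerm.eval_lit, hN,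
    NTerm.eval_div hx (NTerm.eval_lit 2) hcx two_pos,
    NTerm.eval_mod hx (NTerm.eval_lit 2) hcx two_pos, letterWeight, Nat.lt_succ_iff]
  rcases Nat.mod_two_eq_zero_or_one x with h | h <;> rw [h] <;>
    by_cases h1 : x / 2 ≤ N <;> by_cases h2 : 1 ≤ x / 2 <;> (simp [h1, h2]; try norm_num)

theorem Setup.eval_factor (h : Setup G w M V) (hN : V 14 = N) (hb : V 13 = b)
    (hNR : N < numRounds G) (hu : eu.eval M V = u) (hv : ev.eval M V = v) (hx : ex.eval M V = x)
    (hy : ey.eval M V = y) (hcx : x ≤ M.cap) (hcy : y ≤ M.cap) :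
    (RTerm.factor eu ev ex ey).eval M V = pairFactor G N b u v x y := by
  have hNc : N ≤ M.cap := hNR.le.trans h.rounds_le
  have t14 : (NTerm.var 14).eval M V = N := hN
  rw [RTerm.factor, RTerm.eval_ite1 (x := (1 + (b : ℝ)) ^ N -
    (1 + (b : ℝ)) ^ (N - (inTime y - outTime x))) (h.eval_arc hu hv)]
  · rfl
  · intro _
    rw [RTerm.eval_sub, RTerm.eval_ofNat, RTerm.eval_ofNat, eval_pointPow t14 hNc hb,
      eval_pointPow (x := N - (inTime y - outTime x)) _ ((Nat.sub_le _ _).trans hNc) hb]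
    · push_cast
      rw [add_comm (b : ℝ)]
    · rw [NTerm.eval_sub, t14, eval_duration hx hy hcx hcy]

theorem Setup.eval_valIndex (h : Setup G w M V) (hN : V 14 = N) (hb : V 13 = b)
    (hr : er.eval M V = r) (hK : eK.eval M V = keyCode κ) (hc : ec.eval M V = c) :
    (NTerm.valIndex (.var 14) (.var 13) er eK ec).eval M V = valAddr G N b r κ c := by
  simp only [NTerm.valIndex, NTerm.eval_add, NTerm.eval_mul, NTerm.eval_var, NTerm.eval_lit,
    h.keys, h.size, h.nodes, hr, hK, hc, hN, hb, valAddr]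

theorem keyVal_lt {n A w : ℕ} (κ : Key n A w) (u : Fin n) (hA : 0 < A) : keyVal κ u < A := by
  by_cases h : u ∈ keySet κ
  · obtain ⟨i, hi⟩ := exists_isFirst h
    rw [keyVal_eq hi]
    exact (κ i).2.2
  · rw [keyVal, sum_eq_zero fun i _ => if_neg fun h' => h (mem_keySet_of_isFirst h')]
    exact hA

theorem Setup.eval_step (h : Setup G w M V) (hM : HasReach G w M)
    (hV : HasVal G w M N b r) (hNR : N < numRounds G) (hr : ∀ a b : ℕ,
      er.eval M (Function.update (Function.update V 16 a) 15 b) = r)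
    (hN : V 14 = N) (hb : V 13 = b)
    (hK : V 11 = keyCode κ) (hc : V 10 = c) (hi : V 6 = i) (hv : V 7 = v) :
    (RTerm.step er).eval M V = stepVal (skeleton G) (letterWeight N) (pairFactor G N b)
      (compVal (skeleton G) (letterWeight N) (pairFactor G N b) r) κ c i v := by
  classical
  unfold RTerm.step stepVal
  refine RTerm.eval_sum h.eval_letters h.letters_le fun x => ?_
  have h1 := h.update (j := 16) x
  have hx : (x : ℕ) ≤ M.cap := x.2.le.trans h.letters_le
  refine congrArg₂ (· * ·) (congrArg₂ (· * ·) (eval_weight (by simp [hN]) (by simp) hx) ?_) ?_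
  · refine RTerm.eval_prod h1.eval_size h.size_le fun u => ?_
    have h2 := h1.update (j := 8) u
    have hk : (NTerm.keyVal (.var 11) (.var 8)).eval M
        (Function.update (Function.update V 16 x) 8 u) = keyVal κ u :=
      h2.eval_keyVal (by simp [hK]) (by simp)
    have hkc : keyVal κ u ≤ M.cap := (keyVal_lt κ u (numLetters_pos G)).le.trans h.letters_le
    refine (RTerm.eval_ite1 (h2.eval_isKey (κ := κ) (u := u) (by simp [hK]) (by simp))
      fun _ => congrArg₂ (· * ·)
        (h2.eval_factor (N := N) (b := b) (by simp [hN]) (by simp [hb]) hNR (u := u) (v := v) (by simp)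
          (by simp [hv]) hk (y := x) (by simp) hkc hx)
        (h2.eval_factor (N := N) (b := b) (by simp [hN]) (by simp [hb]) hNR (u := v) (v := u) (by simp [hv])
          (by simp) (x := x) (by simp) hk hx hkc)).trans ?_
    split_ifs <;> rfl
  · refine RTerm.eval_prod h1.eval_size h.size_le fun c' => ?_
    have h2 := h1.update (j := 15) c'
    have hk : (NTerm.keyUpdate (.var 11) (.var 6) (.var 7) (.var 16)).eval M
        (Function.update (Function.update V 16 x) 15 c') =
        keyCode (Function.update κ i (v, x)) :=
      h2.eval_keyUpdate (by simp [hK]) (by simp [hi]) (by simp [hv]) (by simp)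
    refine (RTerm.eval_ite1 (NTerm.eval_and (h2.eval_reach hM (κ := κ) (c := c) (v := c')
      (by simp [hK]) (by simp [hc]) (by simp)) (NTerm.eval_and (NTerm.eval_not
        ((NTerm.eval_eq_ind (x := c') (y := v) (by simp) (by simp [hv])).trans
          (ind_congr (Fin.ext_iff).symm))) (h2.eval_isLeast hM hk (c := c') (by simp))))
      (x := compVal (skeleton G) (letterWeight N) (pairFactor G N b) r
        (Function.update κ i (v, x)) c') fun _ => ?_).trans ?_
    · rw [RTerm.val, RTerm.eval_tab, h2.eval_valIndex (N := N) (b := b) (by simp [hN])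
        (by simp [hb]) (hr _ _) hk (c := c') (by simp), hV]
    · split_ifs <;> rfl

end

theorem Setup.valFill_spec (h : Setup G w M V) (hG : Acyclic G) (hM : HasReach G w M)
    (hF : ∀ r ≤ n, HasFeas G w M r) :
    ∃ f, M.fillReal V 0 RTerm.valFill M.cap = { M with real := Function.update M.real 0 f } ∧
      ∀ N < numRounds G, ∀ b < numNodes G, ∀ r ≤ n,
        HasVal G w { M with real := Function.update M.real 0 f } N b r := by
  classical
  refine (M.fillReal_spec V 0 RTerm.valFill (fun a y => ∀ N < numRounds G, ∀ b < numNodes G,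
    ∀ r ≤ n, ∀ (κ : GKey G w) (c : Fin n), a = valAddr G N b r κ c →
      y = compVal (skeleton G) (letterWeight N) (pairFactor G N b) r κ c) M.cap ?_).elim
    fun f ⟨hf, hg⟩ => ⟨f, hf, fun N hN b hb r hr κ c => ?_⟩
  swap
  · simp only [Function.update_self]
    exact hg _ (h.valAddr_lt hN hb hr κ c) N hN b hb r hr κ c rfl
  · intro a ha f hf N hN b hb r hr κ c hav
    set M' : Mem := { M with real := Function.update M.real 0 f } with hM'
    have h0 : Setup G w M' (Function.update V 0 a) := (h.update a).congr rfl rfl fun _ _ => rfl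
    have hn := h.size_pos
    have hc : a ≤ M'.cap := ha.le
    have ha' : a < M'.cap := ha
    rw [valAddr] at hav
    set a₃ := N * numNodes G + b with ha₃
    set a₂ := a₃ * (n + 1) + r with ha₂
    set a₁ := a₂ * keyBase G ^ w + keyCode κ with ha₁
    have l₁ : a₁ ≤ a :=
      hav ▸ (Nat.le_mul_of_pos_right _ hn).trans (Nat.le_add_right _ _)
    have l₂ : a₂ ≤ a₁ := (Nat.le_mul_of_pos_right _ h.keys_pos).trans (Nat.le_add_right _ _)
    have l₃ : a₃ ≤ a₂ := (Nat.le_mul_of_pos_right _ (Nat.succ_pos _)).trans (Nat.le_add_right _ _)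
    have l₄ : N ≤ a₃ := (Nat.le_mul_of_pos_right _ (Nat.succ_pos _)).trans (Nat.le_add_right _ _)
    have l₅ : r ≤ a₂ := Nat.le_add_left _ _
    have l₆ : b ≤ a₃ := Nat.le_add_left _ _
    have k₁ : a₁ < M'.cap := l₁.trans_lt ha'
    have k₂ : a₂ < M'.cap := l₂.trans_lt k₁
    have k₃ : a₃ < M'.cap := l₃.trans_lt k₂
    have hnp : ∀ V', Setup G w M' V' → (NTerm.add .size (.lit 1)).eval M' V' = n + 1 :=
      fun V' hV => congrArg (· + 1) hV.size
    have hnn : ∀ V', Setup G w M' V' → (NTerm.var 27).eval M' V' = numNodes G :=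
      fun V' hV => hV.nodes
    have d₀ : ∀ V', Setup G w M' V' → V' 0 = a →
        (NTerm.div (.var 0) .size).eval M' V' = a₁ := fun V' hV h0 =>
      hV.eval_divSize (h0.trans hav) c.2 (hav ▸ hc)
    have d₁ : ∀ V', Setup G w M' V' → V' 0 = a →
        (NTerm.div (.div (.var 0) .size) .keys).eval M' V' = a₂ :=
      fun V' hV h0 => hV.eval_divKeys (d₀ V' hV h0) (keyCode_lt κ) (l₁.trans hc)
    have d₂ : ∀ V', Setup G w M' V' → V' 0 = a →
        (NTerm.div (.div (.div (.var 0) .size) .keys) (.add .size (.lit 1))).eval M' V' = a₃ := by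
      intro V' hV h0
      rw [NTerm.eval_div (d₁ V' hV h0) (hnp V' hV) (l₂.trans (l₁.trans hc)) (Nat.succ_pos _),
        radix_div _ (Nat.lt_succ_of_le hr)]
    unfold RTerm.valFill
    rw [RTerm.eval_bind (x := c) (fun b => (h0.update b).eval_modSize
        (by simp [hav]) c.2 (hav ▸ hc)) (c.2.trans_le h.size_le),
      RTerm.eval_bind (x := keyCode κ) (fun b => ((h0.update _).update b).eval_modKeys
        (d₀ _ ((h0.update _).update b) (by simp)) (keyCode_lt κ) (l₁.trans hc)) ((keyCode_lt κ).trans_le h.keys_le),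
      RTerm.eval_bind (x := r) (fun b => (NTerm.eval_mod
        (d₁ _ (((h0.update _).update _).update b) (by simp))
        (hnp _ (((h0.update _).update _).update b)) (l₂.trans (l₁.trans hc))
        (Nat.succ_pos _)).trans (radix_mod _ (Nat.lt_succ_of_le hr))) (l₅.trans_lt k₂),
      RTerm.eval_bind (x := b) (fun b' => (NTerm.eval_mod
        (d₂ _ ((((h0.update _).update _).update _).update b') (by simp))
        (hnn _ ((((h0.update _).update _).update _).update b')) (l₃.trans (l₂.trans (l₁.trans hc)))
        (Nat.succ_pos _)).trans (radix_mod _ hb)) (l₆.trans_lt k₃),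
      RTerm.eval_bind (x := N) (fun b' => (NTerm.eval_div
        (d₂ _ (((((h0.update _).update _).update _).update _).update b') (by simp))
        (hnn _ (((((h0.update _).update _).update _).update _).update b'))
        (l₃.trans (l₂.trans (l₁.trans hc)))
        (Nat.succ_pos _)).trans (radix_div _ hb)) (l₄.trans_lt k₃)]
    have h4 := ((((h0.update (j := 10) c).update (j := 11) (keyCode κ)).update (j := 12) r).update
      (j := 13) b).update (j := 14) N
    set V4 := Function.update (Function.update (Function.update (Function.update (Function.update
      (Function.update V 0 a) 10 c) 11 (keyCode κ)) 12 r) 13 b) 14 N with hV4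
    have e10 : V4 10 = c := by simp [hV4]
    have e11 : V4 11 = keyCode κ := by simp [hV4]
    have e12 : V4 12 = r := by simp [hV4]
    have e13 : V4 13 = b := by simp [hV4]
    have e14 : V4 14 = N := by simp [hV4]
    rw [RTerm.valBody, RTerm.eval_mul, RTerm.eval_ofNat, NTerm.eval_lt, NTerm.eval_var, e12,
      NTerm.eval_lit]
    cases r with
    | zero => simp [compVal]
    | succ r =>
      rw [if_pos (by omega), Nat.cast_one, one_mul]
      have hMr : HasReach G w M' := hM
      have hFr : HasFeas G w M' r := hF r (by omega)
      have hVr : HasVal G w M' N b r := by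
        intro κ' c'
        simp only [hM', Function.update_self]
        refine hf _ ?_ N hN b hb r (by omega) κ' c' rfl
        rw [hav]
        refine radix_lt (radix_lt ?_ (keyCode_lt κ')) c'.2
        exact Nat.lt_succ_self _
      have h5 := fun b => h4.update (j := 6) b
      have h6 := fun b b' => (h5 b).update (j := 7) b'
      have hu : ∀ (i : Fin w) (v : Fin n), (NTerm.usable (.sub (.var 12) (.lit 1))).eval M'
          (Function.update (Function.update V4 6 i) 7 v) =
          ind (Usable (skeleton G) (Feasible (skeleton G) r) κ c i v) := fun i v =>
        (h6 i v).eval_usable hG hMr hFr (κ := κ) (c := c) (i := i) (v := v)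
            (fun a b => by simp [e12]) (by simp [e11]) (by simp [e10]) (by simp) (by simp)
      have hs : ∀ (i : Fin w) (v : Fin n), (RTerm.step (.sub (.var 12) (.lit 1))).eval M'
          (Function.update (Function.update V4 6 i) 7 v) = _ := fun i v =>
        (h6 i v).eval_step hMr hVr hN (κ := κ) (c := c) (i := i) (v := v)
            (fun a b => by simp [e12]) (by simp [e14]) (by simp [e13]) (by simp [e11])
            (by simp [e10]) (by simp) (by simp)
      rw [RTerm.eval_div, compVal]
      refine congrArg₂ (· / ·) ?_ ?_
      · refine RTerm.eval_sum h4.eval_width h.width_le fun i => ?_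
        refine RTerm.eval_sum (h5 i).eval_size h.size_le fun v => ?_
        rw [RTerm.eval_mul, RTerm.eval_ofNat, hu, hs]
        unfold ind
        split_ifs <;> simp
      · refine RTerm.eval_sum h4.eval_width h.width_le fun i => ?_
        refine RTerm.eval_sum (h5 i).eval_size h.size_le fun v => ?_
        rw [RTerm.eval_ofNat, hu]
        unfold ind
        split_ifs <;> simp

end

end RealRAM

/-! ## Interpolation tables -/

namespace RealRAM

theorem NTerm.eval_var_of {M : Mem} {V : ℕ → ℕ} {j x : ℕ} (h : V j = x) :
    (NTerm.var j).eval M V = x := h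

open Finset PairwiseSum LongestPath CompletionTime HermiteInterpolation Polynomial

namespace NTerm

/-- The key with the letter in variable `16` in all slots. -/
def rootKey : NTerm := mul (var 16) (var 28)

def rootLeast : NTerm := mul (lt (lit 0) (var 15)) (isLeast rootKey (var 15))

abbrev side : NTerm := add (var 27) (lit 1)

def polyIndex (N s c : NTerm) : NTerm := add (mul (add (mul N side) s) side) c

/-- The multiplicity of the nodes in row `N`. -/
def mult (N : NTerm) : NTerm := add (lit 1) (mul (var 21) (eq N (var 22)))

def descFactorial (j : ℕ) (c i : NTerm) : NTerm := big true j i (sub c (var j))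

end NTerm

namespace RTerm

def evalFill : RTerm :=
  bind 13 (.mod (.var 0) (.var 27)) (bind 14 (.div (.var 0) (.var 27))
    (big false 16 (.var 23) (mul (weight (.var 14) (.var 16)) (big true 15 .size
      (ite1 .rootLeast (val .size .rootKey (.var 15)))))))

/-- Polynomial `s` arises from polynomial `s - 1` by condition `s - 1`. Accordingly variables `14`,
`15` and `16` hold the predecessor of `s`, the node and the order of the derivative. -/
def polyFill (e : RTerm) : RTerm :=
  bind 10 (.mod (.var 0) .side) (bind 11 (.mod (.div (.var 0) .side) .side)
    (bind 12 (.div (.div (.var 0) .side) .side) (bind 14 (.sub (.var 11) (.lit 1))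
      (bind 15 (.div (.var 14) (.mult (.var 12))) (bind 16 (.mod (.var 14) (.mult (.var 12))) e)))))

abbrev coeff (t : Fin 16) (c : NTerm) : RTerm := tab t (.polyIndex (.var 12) (.var 14) c)

/-- The derivative of order variable `16` at the point in variable `15`. -/
def deriv (t : Fin 16) : RTerm :=
  big false 17 .side (mul (coeff t (.var 17)) (ofNat (.mul
    (.descFactorial 18 (.var 17) (.var 16)) (.pow 18 (.var 15) (.sub (.var 17) (.var 16))))))

def nodeBody : RTerm :=
  add (ofNat (.mul (.eq (.var 11) (.lit 0)) (.eq (.var 10) (.lit 0))))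
    (mul (ofNat (.lt (.lit 0) (.var 11)))
      (sub (mul (ofNat (.lt (.lit 0) (.var 10))) (coeff 2 (.sub (.var 10) (.lit 1))))
        (mul (ofNat (.var 15)) (coeff 2 (.var 10)))))

/-- The last row, in variable `22`, interpolates `y ↦ exp (x * y)`, whose derivative of order `i` at
`j` is `x ^ i * exp (j * x)`. The other rows interpolate values from table `1`. -/
def condition : RTerm :=
  add (mul (ofNat (.lt (.var 12) (.var 22))) (tab 1 (.add (.mul (.var 12) (.var 27)) (.var 14))))
    (mul (ofNat (.eq (.var 12) (.var 22)))
      (mul (big true 17 (.var 16) arg) (exp (mul (ofNat (.var 15)) arg))))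

def newtonBody : RTerm :=
  mul (ofNat (.lt (.lit 0) (.var 11))) (add (coeff 3 (.var 10))
    (mul (div (sub condition (deriv 3)) (deriv 2)) (coeff 2 (.var 10))))

def signedChoose (r N : NTerm) : RTerm :=
  mul (big true 8 (.sub r N) (sub (ofNat (.lit 0)) (ofNat (.lit 1))))
    (div (ofNat (.descFactorial 8 r N)) (ofNat (.big true 8 N (.add (.var 8) (.lit 1)))))

/-- The last row is read after as many conditions as there are word counts, the other rows after all
nodes. -/
def answer : RTerm :=
  mul (exp (sub (ofNat (.lit 0)) (mul (ofNat (.var 21)) arg))) (big false 6 (.var 22)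
    (mul (tab 3 (.polyIndex (.var 22) (.var 22) (.var 6)))
      (big false 7 (.add (.var 6) (.lit 1)) (mul (signedChoose (.var 6) (.var 7))
        (tab 3 (.polyIndex (.var 7) (.var 27) (.var 6)))))))

end RTerm

/-- The sum may run up to any `d` beyond the degree, so one loop bound serves for all rows. For `c <
i` the falling factorial vanishes and the truncated exponent does no harm. -/
theorem eval_iterate_derivative_eq_sum (p : ℝ[X]) {d : ℕ} (hd : p.natDegree < d) (i : ℕ) (a : ℝ) :
    (derivative^[i] p).eval a =
      ∑ c ∈ range d, p.coeff c * ((c.descFactorial i : ℝ) * a ^ (c - i)) := by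
  conv_lhs => rw [p.as_sum_range' d hd]
  rw [iterate_derivative_sum, eval_finsetSum]
  refine sum_congr rfl fun c _ => ?_
  rw [← C_mul_X_pow_eq_monomial, iterate_derivative_C_mul, iterate_derivative_X_pow_eq_C_mul]
  simp

section
variable {n : ℕ} {G : Digraph (Fin n)} {w : ℕ} {M : Mem} {V : ℕ → ℕ}

theorem Setup.eval_rootKey (h : Setup G w M V) {x : Fin (numLetters G)} (hx : V 16 = x) :
    NTerm.rootKey.eval M V = keyCode (constKey w ⟨0, h.size_pos⟩ x) := by
  rw [keyCode_const, NTerm.rootKey, NTerm.eval_mul, NTerm.eval_var, NTerm.eval_var, h.geom, hx]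

variable (G) in
/-- Table `1` holds the values of the polynomials at all nodes. -/
def HasEval [Fintype (edgeSet G)] (M : Mem) : Prop := ∀ N < numRounds G, ∀ b < numNodes G,
  M.real 1 (N * numNodes G + b) = (ringPoly (edgeSrc G) (edgeTgt G) N).eval (b : ℝ)

theorem Setup.evalFill_spec [Fintype (edgeSet G)] (h : Setup G w M V) (hG : Acyclic G)
    (hM : HasReach G w M)
    (hv : ∀ N < numRounds G, ∀ b < numNodes G, ∀ r ≤ n, HasVal G w M N b r)
    (hfeas : ∀ x c, c ≠ ⟨0, h.size_pos⟩ →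
      Feasible (skeleton G) n (constKey (A := numLetters G) w ⟨0, h.size_pos⟩ x) c) :
    ∃ f, M.fillReal V 1 RTerm.evalFill M.cap = { M with real := Function.update M.real 1 f } ∧
      HasEval G { M with real := Function.update M.real 1 f } := by
  classical
  refine (M.fillReal_spec V 1 RTerm.evalFill (fun a y => ∀ N < numRounds G, ∀ b < numNodes G,
    a = N * numNodes G + b → y = (ringPoly (edgeSrc G) (edgeTgt G) N).eval (b : ℝ))
    M.cap ?_).elim fun f ⟨hf, hg⟩ => ⟨f, hf, fun N hN b hb => ?_⟩
  swap
  · simp only [Function.update_self]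
    refine hg _ (lt_of_lt_of_le (radix_lt (r' := 0) hN hb) ?_) N hN b hb rfl
    refine le_trans ?_ h.cap_polys
    rw [add_zero]
    exact (Nat.mul_le_mul (Nat.le_succ _) (Nat.le_succ _)).trans
      (Nat.le_mul_of_pos_right _ (Nat.succ_pos _))
  · intro a ha f _ N hN b hb hab
    set M' : Mem := { M with real := Function.update M.real 1 f } with hM'
    have h0 : Setup G w M' (Function.update V 0 a) := (h.update a).congr rfl rfl fun _ _ => rfl
    have hc : a < M'.cap := ha
    have l₁ : N ≤ a := hab ▸ (Nat.le_mul_of_pos_right _ (Nat.succ_pos _)).trans (Nat.le_add_right _ _)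
    have l₂ : b ≤ a := hab ▸ Nat.le_add_left _ _
    have hnn : ∀ V', Setup G w M' V' → (NTerm.var 27).eval M' V' = numNodes G :=
      fun V' hV => hV.nodes
    unfold RTerm.evalFill
    rw [RTerm.eval_bind (x := b) (fun i => (NTerm.eval_mod (x := a) (by simp)
        (hnn _ (h0.update i)) hc.le (Nat.succ_pos _)).trans (by rw [hab, radix_mod _ hb]))
        (l₂.trans_lt hc),
      RTerm.eval_bind (x := N) (fun i => (NTerm.eval_div (x := a) (by simp)
        (hnn _ ((h0.update _).update i)) hc.le (Nat.succ_pos _)).trans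
        (by rw [hab, radix_div _ hb])) (l₁.trans_lt hc)]
    have h1 := (h0.update (j := 13) b).update (j := 14) N
    set V1 := Function.update (Function.update (Function.update V 0 a) 13 b) 14 N with hV1
    have e13 : V1 13 = b := by simp [hV1]
    have e14 : V1 14 = N := by simp [hV1]
    rw [eval_ringPoly_eq_sum h.size_pos hG hN h.width_pos hfeas]
    refine RTerm.eval_sum h1.eval_letters h.letters_le fun x => ?_
    have h2 := h1.update (j := 16) x
    have hx : (x : ℕ) ≤ M'.cap := x.2.le.trans h.letters_le
    refine congrArg₂ (· * ·) (eval_weight (by simp [e14]) (by simp) hx) ?_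
    refine RTerm.eval_prod h2.eval_size h.size_le fun c => ?_
    have h3 := h2.update (j := 15) c
    have hk := h3.eval_rootKey (x := x) (by simp)
    have hl : NTerm.rootLeast.eval M' (Function.update (Function.update V1 16 x) 15 c) =
        ind (c ≠ ⟨0, h.size_pos⟩ ∧
          IsLeast (skeleton G) (keySet (constKey w ⟨0, h.size_pos⟩ x)) c) := by
      refine NTerm.eval_and ?_ (h3.eval_isLeast hM hk (c := c) (by simp))
      refine (NTerm.eval_pos (x := c) (by simp)).trans (ind_congr ?_)
      rw [Ne, Fin.ext_iff, Nat.pos_iff_ne_zero]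
    refine (RTerm.eval_ite1 hl (x := compVal (skeleton G) (letterWeight N) (pairFactor G N b) n
        (constKey w ⟨0, h.size_pos⟩ x) c) fun _ => ?_).trans ?_
    · rw [RTerm.val, RTerm.eval_tab, h3.eval_valIndex (N := N) (b := b) (by simp [e14])
        (by simp [e13]) h3.eval_size hk (c := c) (by simp)]
      exact hv N hN b hb n le_rfl _ c
    · split_ifs <;> rfl

/-! ### Tables of coefficients -/

variable (G) in
noncomputable def polyAddr (N s c : ℕ) : ℕ :=
  (N * (numNodes G + 1) + s) * (numNodes G + 1) + c

variable (G) in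
/-- The multiplicity of the nodes in row `N`: the last row interpolates the exponential. -/
noncomputable def nodeMult (N : ℕ) : ℕ := if N = numRounds G then 1 + edgeCount G else 1

variable (G) in
/-- The interpolation conditions. -/
noncomputable def nodeData [Fintype (edgeSet G)] (x : ℝ) (N s : ℕ) : ℝ :=
  if N < numRounds G then (ringPoly (edgeSrc G) (edgeTgt G) N).eval (s : ℝ)
  else x ^ (s % (1 + edgeCount G)) * Real.exp ((s / (1 + edgeCount G) : ℕ) * x)

theorem nodeMult_pos (N : ℕ) : 0 < nodeMult G N := by
  unfold nodeMult; split_ifs <;> omega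

variable (G) in
/-- Table `t` holds the coefficients of the polynomials `p N s`. -/
def HasPoly (t : Fin 16) (p : ℕ → ℕ → ℝ[X]) (M : Mem) : Prop := ∀ N ≤ numRounds G,
  ∀ s ≤ numNodes G, ∀ c ≤ numNodes G, M.real t (polyAddr G N s c) = (p N s).coeff c

theorem Setup.polyAddr_lt (h : Setup G w M V) {N s c : ℕ} (hN : N ≤ numRounds G)
    (hs : s ≤ numNodes G) (hc : c ≤ numNodes G) : polyAddr G N s c < M.cap :=
  (radix_lt (r' := 0) (radix_lt (r' := 0) (Nat.lt_succ_of_le hN) (Nat.lt_succ_of_le hs))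
    (Nat.lt_succ_of_le hc)).trans_le h.cap_polys

section
variable {N s c : ℕ} {eN es ec : NTerm}

theorem Setup.eval_side (h : Setup G w M V) : NTerm.side.eval M V = numNodes G + 1 :=
  congrArg (· + 1) h.nodes

theorem Setup.eval_polyIndex (h : Setup G w M V) (hN : eN.eval M V = N) (hs : es.eval M V = s)
    (hc : ec.eval M V = c) : (NTerm.polyIndex eN es ec).eval M V = polyAddr G N s c := by
  simp only [NTerm.polyIndex, NTerm.eval_add, NTerm.eval_mul, NTerm.eval_var, NTerm.eval_lit,
    h.nodes, hN, hs, hc, polyAddr]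

theorem Setup.eval_mult (h : Setup G w M V) (hN : eN.eval M V = N) :
    (NTerm.mult eN).eval M V = nodeMult G N := by
  simp only [NTerm.mult, NTerm.eval_add, NTerm.eval_mul, NTerm.eval_eq, NTerm.eval_var,
    NTerm.eval_lit, h.edges, h.rounds, hN, nodeMult]
  split_ifs <;> simp

theorem eval_descFactorial {j x i : ℕ} {ex ei : NTerm} (hx : ∀ k, ex.eval M (Function.update V j k) = x)
    (hi : ei.eval M V = i) (hc : i ≤ M.cap) :
    (NTerm.descFactorial j ex ei).eval M V = x.descFactorial i := by
  rw [NTerm.descFactorial, NTerm.eval_prod (f := fun k => x - k) hi hc, Nat.descFactorial_eq_prod_range]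
  intro k _
  rw [NTerm.eval_sub, hx, NTerm.eval_var, Function.update_self]

/-- The registers while the entry for row `N`, polynomial `s` and coefficient `c` is computed. -/
structure PolyRegs (G : Digraph (Fin n)) (w : ℕ) (M : Mem) (N s c : ℕ) (V : ℕ → ℕ) : Prop where
  setup : Setup G w M V
  coeff : V 10 = c
  index : V 11 = s
  row : V 12 = N
  pred : V 14 = s - 1
  node : V 15 = (s - 1) / nodeMult G N
  order : V 16 = (s - 1) % nodeMult G N

theorem PolyRegs.update {V : ℕ → ℕ} (h : PolyRegs G w M N s c V) {j : ℕ} (a : ℕ)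
    (hj : 16 < j := by decide) (hj' : j < 20 := by decide) :
    PolyRegs G w M N s c (Function.update V j a) where
  setup := h.setup.update a hj'
  coeff := (Function.update_of_ne (by omega) _ _).trans h.coeff
  index := (Function.update_of_ne (by omega) _ _).trans h.index
  row := (Function.update_of_ne (by omega) _ _).trans h.row
  pred := (Function.update_of_ne (by omega) _ _).trans h.pred
  node := (Function.update_of_ne (by omega) _ _).trans h.node
  order := (Function.update_of_ne (by omega) _ _).trans h.order

theorem Setup.eval_polyFill (h : Setup G w M V) (h0 : V 0 = polyAddr G N s c)
    (hN : N ≤ numRounds G) (hs : s ≤ numNodes G) (hc : c ≤ numNodes G) (e : RTerm) :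
    ∃ V', PolyRegs G w M N s c V' ∧ (RTerm.polyFill e).eval M V = e.eval M V' := by
  have hlt := h.polyAddr_lt hN hs hc
  have hpos : 0 < numNodes G + 1 := Nat.succ_pos _
  have hlt' : N * (numNodes G + 1) + s < M.cap :=
    lt_of_le_of_lt ((Nat.le_mul_of_pos_right _ hpos).trans (Nat.le_add_right _ _)) hlt
  have hNc : N < M.cap :=
    lt_of_le_of_lt ((Nat.le_mul_of_pos_right _ hpos).trans (Nat.le_add_right _ _)) hlt'
  have hsc : s < M.cap := lt_of_le_of_lt (Nat.le_add_left _ _) hlt'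
  have hcc : c < M.cap := lt_of_le_of_lt (Nat.le_add_left _ _) hlt
  have hdiv : ∀ V', Setup G w M V' → V' 0 = polyAddr G N s c →
      (NTerm.div (.var 0) .side).eval M V' = N * (numNodes G + 1) + s := fun V' hV e0 =>
    (NTerm.eval_div (x := polyAddr G N s c) (NTerm.eval_var_of e0) hV.eval_side hlt.le hpos).trans
      (radix_div _ (Nat.lt_succ_of_le hc))
  have hm : ∀ {V'}, Setup G w M V' → V' 12 = N →
      (NTerm.mult (.var 12)).eval M V' = nodeMult G N := fun hV e => hV.eval_mult e
  unfold RTerm.polyFill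
  rw [RTerm.eval_bind (x := c) (fun i => (NTerm.eval_mod (x := polyAddr G N s c) (by simp [h0])
      (h.update i).eval_side hlt.le hpos).trans (radix_mod _ (Nat.lt_succ_of_le hc))) hcc,
    RTerm.eval_bind (x := s) (fun i => (NTerm.eval_mod (hdiv _ ((h.update _).update i) (by simp [h0]))
      ((h.update _).update i).eval_side hlt'.le hpos).trans (radix_mod _ (Nat.lt_succ_of_le hs))) hsc,
    RTerm.eval_bind (x := N) (fun i => (NTerm.eval_div
      (hdiv _ (((h.update _).update _).update i) (by simp [h0]))
      (((h.update _).update _).update i).eval_side hlt'.le hpos).trans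
      (radix_div _ (Nat.lt_succ_of_le hs))) hNc,
    RTerm.eval_bind (x := s - 1) (fun i => by simp) (lt_of_le_of_lt (Nat.sub_le _ _) hsc),
    RTerm.eval_bind (x := (s - 1) / nodeMult G N) (fun i => NTerm.eval_div (by simp)
      (hm (((((h.update _).update _).update _).update _).update i) (by simp))
      ((Nat.sub_le _ _).trans hsc.le) (nodeMult_pos N))
      (lt_of_le_of_lt ((Nat.div_le_self _ _).trans (Nat.sub_le _ _)) hsc),
    RTerm.eval_bind (x := (s - 1) % nodeMult G N) (fun i => NTerm.eval_mod (by simp)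
      (hm ((((((h.update _).update _).update _).update _).update _).update i) (by simp))
      ((Nat.sub_le _ _).trans hsc.le) (nodeMult_pos N))
      (lt_of_le_of_lt ((Nat.mod_le _ _).trans (Nat.sub_le _ _)) hsc)]
  refine ⟨_, ⟨?_, ?_, ?_, ?_, ?_, ?_, ?_⟩, rfl⟩
  · exact (((((h.update _).update _).update _).update _).update _).update _
  all_goals simp

theorem PolyRegs.eval_coeff (h : PolyRegs G w M N (s + 1) c V) {t : Fin 16} {p : ℝ[X]}
    (hp : ∀ c ≤ numNodes G, M.real t (polyAddr G N s c) = p.coeff c) {c' : ℕ}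
    (hc : ec.eval M V = c') (hc' : c' ≤ numNodes G) :
    (RTerm.coeff t ec).eval M V = p.coeff c' := by
  rw [RTerm.eval_tab, h.setup.eval_polyIndex (s := s) (NTerm.eval_var_of h.row) (NTerm.eval_var_of h.pred) hc, hp _ hc']

theorem PolyRegs.eval_deriv (h : PolyRegs G w M N (s + 1) c V) {t : Fin 16} {p : ℝ[X]}
    (hs : s ≤ numNodes G)
    (hp : ∀ c ≤ numNodes G, M.real t (polyAddr G N s c) = p.coeff c)
    (hd : p.natDegree ≤ numNodes G) :
    (RTerm.deriv t).eval M V =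
      (derivative^[s % nodeMult G N] p).eval ((s / nodeMult G N : ℕ) : ℝ) := by
  have hcap := h.setup.nodes_le
  rw [eval_iterate_derivative_eq_sum p (Nat.lt_succ_of_le hd)]
  refine RTerm.eval_sum_range h.setup.eval_side hcap fun c' hc' => ?_
  have h1 := h.update (j := 17) c'
  have e16 : Function.update V 17 c' 16 = s % nodeMult G N := h1.order
  have e15 : Function.update V 17 c' 15 = s / nodeMult G N := h1.node
  have hi : s % nodeMult G N ≤ M.cap := (Nat.mod_le _ _).trans (hs.trans ((Nat.le_succ _).trans hcap))
  refine congrArg₂ (· * ·) (h1.eval_coeff hp (by simp) (Nat.le_of_lt_succ hc')) ?_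
  rw [RTerm.eval_ofNat, NTerm.eval_mul, eval_descFactorial (x := c') (fun k => by simp)
    (NTerm.eval_var_of e16) hi,
    NTerm.eval_pow (k := c' - s % nodeMult G N) (x := s / nodeMult G N)]
  · push_cast; rfl
  · rw [NTerm.eval_sub, NTerm.eval_var, NTerm.eval_var, e16, Function.update_self]
  · exact (Nat.sub_le _ _).trans (hc'.le.trans hcap)
  · intro i
    rw [NTerm.eval_var, Function.update_of_ne (by decide), e15]

end

/-- Common to the tables of node polynomials and of interpolants: it treats the loop and the
decoding of the index, and leaves the recursion from the preceding polynomials of the same row. -/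
theorem Setup.polyFill_spec (h : Setup G w M V) (t : Fin 16) (p : ℕ → ℕ → ℝ[X]) (e : RTerm)
    (he : ∀ f, ∀ N ≤ numRounds G, ∀ s ≤ numNodes G, ∀ c ≤ numNodes G, ∀ V',
      (∀ s' < s, ∀ c' ≤ numNodes G, f (polyAddr G N s' c') = (p N s').coeff c') →
      PolyRegs G w { M with real := Function.update M.real t f } N s c V' →
      e.eval { M with real := Function.update M.real t f } V' = (p N s).coeff c) :
    ∃ f, M.fillReal V t e.polyFill M.cap = { M with real := Function.update M.real t f } ∧
      HasPoly G t p { M with real := Function.update M.real t f } := by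
  refine (M.fillReal_spec V t e.polyFill (fun a y => ∀ N ≤ numRounds G, ∀ s ≤ numNodes G,
    ∀ c ≤ numNodes G, a = polyAddr G N s c → y = (p N s).coeff c)
    M.cap ?_).elim fun f ⟨hf, hg⟩ => ⟨f, hf, fun N hN s hs c hc => ?_⟩
  swap
  · simp only [Function.update_self]
    exact hg _ (h.polyAddr_lt hN hs hc) N hN s hs c hc rfl
  · intro a ha f hf N hN s hs c hc hac
    have h0 : Setup G w { M with real := Function.update M.real t f } (Function.update V 0 a) :=
      (h.update a).congr rfl rfl fun _ _ => rfl
    obtain ⟨V', hV', e'⟩ := h0.eval_polyFill (by simp [hac]) hN hs hc e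
    rw [e']
    refine he f N hN s hs c hc V' (fun s' hs' c' hc' => ?_) hV'
    refine hf _ ?_ N hN s' (hs'.le.trans hs) c' hc' rfl
    rw [hac]
    exact radix_lt (Nat.add_lt_add_left hs' _) (Nat.lt_succ_of_le hc')

theorem Setup.nodeFill_spec (h : Setup G w M V) :
    ∃ f, M.fillReal V 2 RTerm.nodeBody.polyFill M.cap =
        { M with real := Function.update M.real 2 f } ∧
      HasPoly G 2 (fun N => nodePoly (nodeMult G N))
        { M with real := Function.update M.real 2 f } := by
  refine h.polyFill_spec 2 _ _ fun f N hN s hs c hc V' hf hV => ?_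
  simp only [RTerm.nodeBody, RTerm.eval_add, RTerm.eval_mul, RTerm.eval_sub, RTerm.eval_ofNat,
    NTerm.eval_mul, NTerm.eval_eq, NTerm.eval_lt, NTerm.eval_var, NTerm.eval_lit, hV.coeff, hV.index]
  cases s with
  | zero => by_cases h0 : c = 0 <;> simp [nodePoly, h0, Polynomial.coeff_one]
  | succ s =>
    have hp : ∀ c' ≤ numNodes G, ({ M with real := Function.update M.real 2 f } : Mem).real 2
        (polyAddr G N s c') = (nodePoly (nodeMult G N) s).coeff c' := by
      simpa using hf s (Nat.lt_succ_self _)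
    rw [hV.eval_coeff hp (c' := c) (NTerm.eval_var_of hV.coeff) hc, hV.eval_coeff hp (c' := c - 1)
      (by rw [NTerm.eval_sub, NTerm.eval_var, hV.coeff, NTerm.eval_lit])
      ((Nat.sub_le _ _).trans hc), hV.node, Nat.add_sub_cancel, nodePoly, mul_sub (nodePoly _ _), coeff_sub,
      coeff_mul_C]
    cases c with
    | zero => simp; ring
    | succ c => simp [coeff_mul_X]; ring

theorem Setup.newtonFill_spec [Fintype (edgeSet G)] (h : Setup G w M V) (hE : HasEval G M)
    (hp : HasPoly G 2 (fun N => nodePoly (nodeMult G N)) M) :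
    ∃ f, M.fillReal V 3 RTerm.newtonBody.polyFill M.cap =
        { M with real := Function.update M.real 3 f } ∧
      HasPoly G 3 (fun N => newton (nodeMult G N) (nodeData G M.arg N))
        { M with real := Function.update M.real 3 f } := by
  refine h.polyFill_spec 3 _ _ fun f N hN s hs c hc V' hf hV => ?_
  rw [RTerm.newtonBody, RTerm.eval_mul, RTerm.eval_ofNat, NTerm.eval_lt, NTerm.eval_var,
    NTerm.eval_lit, hV.index]
  cases s with
  | zero => simp [newton]
  | succ s =>
    have hs' : s < numNodes G := hs
    set M' : Mem := { M with real := Function.update M.real 3 f } with hM'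
    have hp3 : ∀ c' ≤ numNodes G, M'.real 3 (polyAddr G N s c') =
        (newton (nodeMult G N) (nodeData G M.arg N) s).coeff c' := by
      simpa [hM'] using hf s (Nat.lt_succ_self _)
    have hp2 : ∀ c' ≤ numNodes G, M'.real 2 (polyAddr G N s c') =
        (nodePoly (nodeMult G N) s).coeff c' := by
      simpa [hM'] using hp N hN s hs'.le
    have hdat : RTerm.condition.eval M' V' = nodeData G M.arg N s := by
      have e16 : V' 16 = s % nodeMult G N := hV.order
      have e15 : V' 15 = s / nodeMult G N := hV.node
      have e14 : V' 14 = s := hV.pred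
      rw [RTerm.condition, RTerm.eval_add, RTerm.eval_mul, RTerm.eval_mul, RTerm.eval_mul,
        RTerm.eval_ofNat, RTerm.eval_ofNat, NTerm.eval_lt, NTerm.eval_eq, NTerm.eval_var,
        NTerm.eval_var, hV.row, hV.setup.rounds, RTerm.eval_prod_range (M := M') (f := fun _ => M.arg)
          (k := s % nodeMult G N) (NTerm.eval_var_of e16) ((Nat.mod_le _ _).trans (hs'.le.trans
            ((Nat.le_succ _).trans h.nodes_le))) fun _ _ => RTerm.eval_arg]
      unfold nodeData
      rcases hN.lt_or_eq with h1 | h1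
      · rw [if_pos h1, if_neg h1.ne, if_pos h1, ← hE N h1 s hs']
        simp [hV.row, hV.setup.nodes, e14, hM']
      · rw [if_neg h1.not_lt, if_pos h1, if_neg h1.not_lt]
        have : nodeMult G N = 1 + edgeCount G := if_pos h1
        simp [e15, this, hM']
    rw [if_pos (Nat.succ_pos _), Nat.cast_one, one_mul, RTerm.eval_add, RTerm.eval_mul,
      RTerm.eval_div, RTerm.eval_sub, hdat,
      hV.eval_deriv hs'.le hp3 ((natDegree_newton_le _ _).trans ((Nat.sub_le _ _).trans hs'.le)),
      hV.eval_deriv hs'.le hp2 ((natDegree_nodePoly_le _).trans hs'.le),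
      hV.eval_coeff hp3 (NTerm.eval_var_of hV.coeff) hc,
      hV.eval_coeff hp2 (NTerm.eval_var_of hV.coeff) hc, newton, coeff_add, coeff_C_mul]

/-! ### The answer -/

theorem eval_signedChoose {er eN : NTerm} {r N : ℕ} (hr : er.eval M V = r) (hN : eN.eval M V = N)
    (hr' : ∀ k, er.eval M (Function.update V 8 k) = r) (hc : r ≤ M.cap) (hNr : N ≤ r) :
    (RTerm.signedChoose er eN).eval M V = (-1) ^ (r - N) * (r.choose N : ℝ) := by
  rw [RTerm.signedChoose, RTerm.eval_mul, RTerm.eval_prod_range (f := fun _ => (-1 : ℝ))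
    (k := r - N) (by rw [NTerm.eval_sub, hr, hN]) ((Nat.sub_le _ _).trans hc), RTerm.eval_div,
    RTerm.eval_ofNat, RTerm.eval_ofNat, eval_descFactorial hr' hN (hNr.trans hc),
    NTerm.eval_prod (f := fun k => k + 1) hN (hNr.trans hc), prod_const, card_range,
    prod_range_add_one_eq_factorial, Nat.descFactorial_eq_factorial_mul_choose]
  · have : (N.factorial : ℝ) ≠ 0 := by positivity
    push_cast
    field_simp
  · intro k _; simp
  · intro k _; simp

theorem Setup.eval_answer [Fintype (edgeSet G)] (h : Setup G w M V)
    (hp : HasPoly G 3 (fun N => newton (nodeMult G N) (nodeData G M.arg N)) M)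
    (hx : 0 ≤ M.arg) : RTerm.answer.eval M V = cdfValue G M.arg := by
  have hRK : numRounds G ≤ numNodes G :=
    (Nat.le_mul_of_pos_left _ (Nat.succ_pos _)).trans (Nat.le_succ _)
  have hmult : nodeMult G (numRounds G) = edgeCount G + 1 := (if_pos rfl).trans (add_comm _ _)
  have hdata : nodeData G M.arg (numRounds G) = fun s => M.arg ^ (s % (edgeCount G + 1)) *
      Real.exp ((s / (edgeCount G + 1) : ℕ) * M.arg) := by
    funext s
    rw [nodeData, if_neg (lt_irrefl _), add_comm 1]
  rw [RTerm.answer, cdfValue, if_neg hx.not_gt, RTerm.eval_mul]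
  refine congrArg₂ (· * ·) ?_ ?_
  · simp [h.edges]
  · have er : (NTerm.var 22).eval M V = numRounds G := h.rounds
    refine RTerm.eval_sum_range er h.rounds_le fun r hr => ?_
    have h1 := h.update (j := 6) r
    refine congrArg₂ (· * ·) ?_ ?_
    · rw [RTerm.eval_tab, h1.eval_polyIndex (N := numRounds G) (s := numRounds G) (c := r)
        (NTerm.eval_var_of h1.rounds)
        (NTerm.eval_var_of h1.rounds) (NTerm.eval_var_of (Function.update_self _ _ _)), hp _ le_rfl _ hRK _ (hr.le.trans hRK)]
      simp only [hmult, hdata]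
    · have hrc : r ≤ M.cap := hr.le.trans h.rounds_le
      rw [wordCount_eq]
      refine RTerm.eval_sum_range (by simp) (Nat.succ_le_of_lt (hr.trans_le h.rounds_le))
        fun N hN => ?_
      have h2 := h1.update (j := 7) N
      have hNr : N ≤ r := Nat.le_of_lt_succ hN
      have hNR : N < numRounds G := hNr.trans_lt hr
      refine congrArg₂ (· * ·) (eval_signedChoose (by simp) (by simp) (fun k => by simp) hrc hNr) ?_
      rw [RTerm.eval_tab, h2.eval_polyIndex (N := N) (s := numNodes G) (c := r)
        (NTerm.eval_var_of (Function.update_self _ _ _)) (NTerm.eval_var_of h2.nodes)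
        (NTerm.eval_var_of (by simp)), hp N hNR.le _ le_rfl r (hr.le.trans hRK)]
      have hd : nodeData G M.arg N = fun s : ℕ =>
          (ringPoly (edgeSrc G) (edgeTgt G) N).eval (s : ℝ) := by
        funext s
        rw [nodeData, if_pos hNR]
      simp only [hd]
      -- There are more nodes than the degree bound `N * m` requires, so interpolation recovers
      -- `ringPoly N` itself.
      rw [nodeMult, if_neg hNR.ne, eq_newton]
      refine (natDegree_ringPoly_le N).trans_lt (Nat.lt_succ_of_le ?_)
      rw [card_edgeSet, mul_comm]
      exact Nat.mul_le_mul (Nat.le_succ _) hNR.le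

end

end RealRAM

/-! ## The program -/

namespace RealRAM

open Finset PairwiseSum LongestPath CompletionTime HermiteInterpolation

/-- Whether all components of the root keys are feasible. -/
def NTerm.found : NTerm :=
  all 16 (var 23) (all 15 size (imp (lt (lit 0) (var 15)) (feas size rootKey (var 15))))

namespace Cmd

/-- Variable `29` is the factor by which the power in `30` grows per round, and `26` is the number
of keys. Variables `25`, `28` and `31` start at zero: no slots, an empty geometric sum, and the
search not yet successful. -/
def init : Cmd :=
  seq (setVar 20 (.inp (.lit 0))) (seq (setVar 21 (.big false 5 (.var 20) (.big false 6 (.var 20)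
    (.arc (.var 5) (.var 6))))) (seq
  (setVar 22 (.mul (.add (.var 21) (.lit 1)) (.add (.var 21) (.lit 1)))) (seq
  (setVar 23 (.mul (.lit 2) (.var 22))) (seq (setVar 24 (.mul (.var 20) (.var 23))) (seq
  (setVar 27 (.add (.mul (.add (.var 21) (.lit 1)) (.var 22)) (.lit 1))) (seq
  (setVar 29 (.mul (.mul (.lit 4) (.var 20)) (.mul (.add (.var 21) (.lit 2))
    (.mul (.add (.var 21) (.lit 2)) (.add (.var 21) (.lit 2)))))) (seq
  (setVar 30 (.lit 1)) (setVar 26 (.lit 1)))))))))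

/-- The geometric sum in variable `28` is extended by Horner's rule. -/
def grow : Cmd :=
  seq (setVar 25 (.add (.var 25) (.lit 1))) (seq (setVar 30 (.mul (.var 30) (.var 29)))
    (seq (setVar 26 (.mul (.var 26) (.var 24)))
      (setVar 28 (.add (.mul (.var 28) (.var 24)) (.lit 1)))))

def search : Cmd :=
  seq (fillNat 0 .reachFill) (seq (fillNat 1 .feasFill) (setVar 31 .found))

/-- Commands store real values only by filling a table, so the answer is written to all entries of
table `4`; one of them is read. -/
def finish : Cmd :=
  seq (fillReal 0 .valFill) (seq (fillReal 1 .evalFill) (seq (fillReal 2 RTerm.nodeBody.polyFill)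
    (seq (fillReal 3 RTerm.newtonBody.polyFill) (fillReal 4 .answer))))

end Cmd

section
variable {n : ℕ} {G : Digraph (Fin n)} {w : ℕ} {M : Mem} {V : ℕ → ℕ}

variable (G) in
/-- The keys with `w` slots suffice for the dynamic program. -/
def WidthSuffices (hn : 0 < n) (w : ℕ) : Prop := ∀ x c, c ≠ ⟨0, hn⟩ →
  Feasible (skeleton G) n (constKey (A := numLetters G) w ⟨0, hn⟩ x) c

theorem widthSuffices_of_treewidth_le (hn : 0 < n) {k : ℕ} (h : treewidth (skeleton G) ≤ k) :
    WidthSuffices G hn (k + 1) := by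
  obtain ⟨T, hT⟩ := exists_treeDecomposition_of_treewidth_le h
  exact fun x c hc => feasible_constKey T hT (Nat.succ_pos _) _ x c hc

theorem Setup.eval_found (h : Setup G w M V) (hM : HasFeas G w M n) :
    NTerm.found.eval M V = ind (WidthSuffices G h.size_pos w) := by
  refine NTerm.eval_all h.eval_letters h.letters_le fun x => ?_
  have h1 := h.update (j := 16) x
  refine NTerm.eval_all h1.eval_size h.size_le fun c => ?_
  have h2 := h1.update (j := 15) c
  refine NTerm.eval_imp ((NTerm.eval_pos (x := c) (by simp)).trans (ind_congr ?_))
    (h2.eval_feas hM h2.eval_size (h2.eval_rootKey (x := x) (by simp)) (c := c) (by simp))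
  rw [Ne, Fin.ext_iff, Nat.pos_iff_ne_zero]

theorem Setup.finish_run [Fintype (edgeSet G)] (h : Setup G w M V) (hG : Acyclic G)
    (hM : HasReach G w M) (hF : ∀ r ≤ n, HasFeas G w M r) (hw : WidthSuffices G h.size_pos w) :
    (Cmd.finish.run (M, V)).1.arg = M.arg ∧
      (0 ≤ M.arg → (Cmd.finish.run (M, V)).1.real 4 0 = cdfValue G M.arg) := by
  obtain ⟨f₀, e₀, p₀⟩ := h.valFill_spec hG hM hF
  set M₀ : Mem := { M with real := Function.update M.real 0 f₀ } with hM₀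
  have h₀ : Setup G w M₀ V := h.congr rfl rfl fun _ _ => rfl
  obtain ⟨f₁, e₁, p₁⟩ := h₀.evalFill_spec hG hM p₀ hw
  set M₁ : Mem := { M₀ with real := Function.update M₀.real 1 f₁ } with hM₁
  have h₁ : Setup G w M₁ V := h₀.congr rfl rfl fun _ _ => rfl
  obtain ⟨f₂, e₂, p₂⟩ := h₁.nodeFill_spec
  set M₂ : Mem := { M₁ with real := Function.update M₁.real 2 f₂ } with hM₂
  have h₂ : Setup G w M₂ V := h₁.congr rfl rfl fun _ _ => rfl
  have p₁' : HasEval G M₂ := p₁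
  obtain ⟨f₃, e₃, p₃⟩ := h₂.newtonFill_spec p₁' p₂
  set M₃ : Mem := { M₂ with real := Function.update M₂.real 3 f₃ } with hM₃
  have h₃ : Setup G w M₃ V := h₂.congr rfl rfl fun _ _ => rfl
  obtain ⟨f₄, e₄, p₄⟩ := M₃.fillReal_spec V 4 .answer (fun _ y => 0 ≤ M.arg → y = cdfValue G M.arg)
    M₃.cap (fun a _ f _ hx => by
      have h₄ : Setup G w { M₃ with real := Function.update M₃.real 4 f } (Function.update V 0 a) :=
        (h₃.update a).congr rfl rfl fun _ _ => rfl
      exact h₄.eval_answer p₃ hx)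
  have e : Cmd.finish.run (M, V) = ({ M₃ with real := Function.update M₃.real 4 f₄ }, V) := by
    simp only [Cmd.finish, Cmd.run]
    rw [e₀, e₁, e₂, e₃, e₄]
  rw [e]
  refine ⟨rfl, fun hx => ?_⟩
  simp only [Function.update_self]
  exact p₄ 0 (h.size_pos.trans_le h.size_le) hx

variable (G) in
/-- The parameter that determines the caps. -/
noncomputable abbrev capBase : ℕ :=
  4 * n * ((edgeCount G + 2) * ((edgeCount G + 2) * (edgeCount G + 2)))

variable (G) in
/-- The invariant of the search for a sufficient number of slots. -/
structure LoopInv (hn : 0 < n) (x : ℝ) (w : ℕ) (M : Mem) (V : ℕ → ℕ) : Prop where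
  src : M.src = (input G x).nat
  arg : M.arg = x
  size : V 20 = n
  edges : V 21 = edgeCount G
  rounds : V 22 = numRounds G
  letters : V 23 = numLetters G
  base : V 24 = keyBase G
  width : V 25 = w
  keys : V 26 = keyBase G ^ w
  nodes : V 27 = numNodes G
  geom : V 28 = ∑ j ∈ range w, keyBase G ^ j
  growth : V 29 = capBase G
  power : V 30 = capBase G ^ w
  cap_le : M.cap ≤ capBase G ^ (4 * w + 1)
  found : V 31 = ind (0 < w ∧ WidthSuffices G hn w)
  tables : 0 < w → Setup G w M V ∧ HasReach G w M ∧ ∀ r ≤ n, HasFeas G w M r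

theorem input_adj (G : Digraph (Fin n)) (x : ℝ) (u v : Fin n) :
    (input G x).nat (1 + (u * n + v)) = ind (G.Adj u v) := by
  classical
  have e : (∃ u' v' : Fin n, G.Adj u' v' ∧ 1 + ((u : ℕ) * n + v) = 1 + ((u' : ℕ) * n + v')) ↔
      G.Adj u v := by
    refine ⟨?_, fun h => ⟨u, v, h, rfl⟩⟩
    rintro ⟨u', v', h, e⟩
    have e := Nat.add_left_cancel e
    have hu : u = u' := Fin.ext (by rw [← radix_div u v.2, e, radix_div _ v'.2])
    have hv : v = v' := Fin.ext (by rw [← radix_mod u v.2, e, radix_mod _ v'.2])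
    rwa [hu, hv]
  simp only [input, e, ind]
  rw [if_neg (by omega)]

theorem input_eq_zero (G : Digraph (Fin n)) (x : ℝ) {a : ℕ} (ha : n * n < a) :
    (input G x).nat a = 0 := by
  simp only [input]
  rw [if_neg (by omega), if_neg]
  rintro ⟨u, v, -, rfl⟩
  have := radix_lt (r' := 0) u.2 v.2
  omega

theorem rep_input (G : Digraph (Fin n)) (x : ℝ) :
    Rep n ⟨(input G x).nat, x, 0, fun _ _ => 0, fun _ _ => 0⟩ (fun _ => 0) (fun _ => 0) (fun _ => 0)
      (input G x) where
  size := by simp [input]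
  src a _ := rfl
  src_zero a ha := input_eq_zero G x ha
  cap := input_eq_zero G x (by unfold natAddr; omega)
  var j := input_eq_zero G x (by unfold natAddr; omega)
  tmp j := input_eq_zero G x (by unfold natAddr; omega)
  tab i a := input_eq_zero G x (by unfold natAddr; omega)
  arg := by simp [input]
  rtmp j := by simp [input, realAddr]
  rtab i a := by simp [input, realAddr]

theorem sum_ind_adj (G : Digraph (Fin n)) :
    ∑ u, ∑ v, ind (G.Adj u v) = edgeCount G := by
  classical
  have e : edgeSet G = (univ.filter fun e : Fin n × Fin n => G.Adj e.1 e.2 : Finset _) := by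
    ext e
    simp [edgeSet]
  rw [edgeCount, e, Set.ncard_coe_finset, card_filter,
    ← Fintype.sum_prod_type' (f := fun u v => ind (G.Adj u v))]
  exact sum_congr rfl fun _ _ => by unfold ind; congr

theorem LoopInv.init (hn : 0 < n) (x : ℝ) (hs : M.src = (input G x).nat) (hx : M.arg = x)
    (hc : M.cap = n) : LoopInv G hn x 0 (Cmd.init.run (M, fun _ => 0)).1
      (Cmd.init.run (M, fun _ => 0)).2 := by
  have e0 : M.src 0 = n := by simp [hs, input]
  have e1 : ∀ V : ℕ → ℕ, V 20 = n → (NTerm.big false 5 (.var 20) (.big false 6 (.var 20)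
      (.arc (.var 5) (.var 6)))).eval M V = edgeCount G := by
    intro V h20
    rw [← sum_ind_adj]
    refine NTerm.eval_sum_fin (NTerm.eval_var_of h20) hc.ge fun u => ?_
    refine NTerm.eval_sum_fin (NTerm.eval_var_of (by simp [h20])) hc.ge fun v => ?_
    rw [← input_adj G x, ← hs]
    simp [NTerm.arc, h20]
  have hB : n ≤ capBase G := by
    have : 1 ≤ (edgeCount G + 2) * ((edgeCount G + 2) * (edgeCount G + 2)) := by
      refine Nat.mul_pos ?_ (Nat.mul_pos ?_ ?_) <;> omega
    calc n ≤ 4 * n := by omega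
      _ ≤ _ := Nat.le_mul_of_pos_right _ this
  have e1' := e1 (Function.update (fun _ => 0) 20 n) (by simp)
  simp only [Cmd.init, Cmd.run, NTerm.eval_inp, NTerm.eval_lit, e0, e1']
  constructor
  case cap_le => simpa [hc] using hB
  case found => simp [ind]
  case tables => exact fun h => absurd h (lt_irrefl _)
  case src => exact hs
  case arg => exact hx
  all_goals simp

/-- Three powers of `capBase` pay for the dimensions of the tables apart from the keys, and `keyBase
G ≤ capBase G` bounds the number of keys by one more power per slot. The factor `4 * n` and the
shift by two leave room for all successors. -/
theorem capBase_bounds (G : Digraph (Fin n)) (hn : 0 < n) :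
    keyBase G ≤ capBase G ∧ 2 ≤ capBase G ∧
      (numRounds G + 1) * numNodes G * (n + 1) * n * n ≤ capBase G ^ 3 ∧
      (numRounds G + 1) * (numNodes G + 1) * (numNodes G + 1) ≤ capBase G ^ 3 := by
  obtain ⟨b, hb⟩ : ∃ b, edgeCount G + 2 = b := ⟨_, rfl⟩
  obtain ⟨a, ha⟩ : ∃ a, edgeCount G + 1 = a := ⟨_, rfl⟩
  have ha1 : 1 ≤ a := by omega
  have hab : b = a + 1 := by omega
  have hb1 : 1 ≤ b := by omega
  have h1 : a * a + 1 ≤ b * b := by subst hab; nlinarith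
  have h2 : a * (a * a) + 1 + 1 ≤ b * (b * b) := by subst hab; nlinarith
  have hb2 : 1 ≤ b * b := Nat.mul_pos hb1 hb1
  have hb3 : 1 ≤ b * (b * b) := Nat.mul_pos hb1 hb2
  have hc : capBase G = 4 * n * (b * (b * b)) := by rw [capBase, hb]
  have hR : numRounds G = a * a := by rw [numRounds, ha]
  have hK : numNodes G = a * (a * a) + 1 := by rw [numNodes, ha, hR]
  have hn2 : n + 1 ≤ 2 * n := by omega
  have h3 : b * b ≤ b * (b * b) := Nat.le_mul_of_pos_left _ hb1
  refine ⟨?_, ?_, ?_, ?_⟩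
  · rw [keyBase, numLetters, hR, hc, show n * (2 * (a * a)) = 2 * n * (a * a) by ring]
    exact Nat.mul_le_mul (Nat.mul_le_mul_right _ (by omega)) ((Nat.le_succ _).trans (h1.trans h3))
  · rw [hc]
    calc 2 ≤ 4 * n := by omega
      _ ≤ _ := Nat.le_mul_of_pos_right _ hb3
  · rw [hR, hK, hc]
    calc (a * a + 1) * (a * (a * a) + 1) * (n + 1) * n * n
        ≤ (b * (b * b)) * (b * (b * b)) * (2 * n) * n * n := by
          gcongr
          · exact h1.trans h3
          · omega
      _ = 2 * n ^ 3 * ((b * (b * b)) ^ 2) := by ring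
      _ ≤ 64 * n ^ 3 * ((b * (b * b)) ^ 3) := by gcongr <;> omega
      _ = _ := by ring
  · rw [hR, hK, hc]
    calc (a * a + 1) * (a * (a * a) + 1 + 1) * (a * (a * a) + 1 + 1)
        ≤ (b * (b * b)) * (b * (b * b)) * (b * (b * b)) := by
          gcongr
          exact h1.trans h3
      _ = 1 * (b * (b * b)) ^ 3 := by ring
      _ ≤ (4 * n) ^ 3 * (b * (b * b)) ^ 3 := by gcongr; exact Nat.pow_pos (by omega)
      _ = _ := by ring

/-- Of the fourth power in the cap, three factors cover the dimensions of the tables and one covers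
the keys. -/
theorem LoopInv.setup {hn : 0 < n} {x : ℝ} (h : LoopInv G hn x w M V) :
    Setup G (w + 1) { M with cap := (capBase G ^ (w + 1)) ^ 4 } (Cmd.grow.run (M, V)).2 := by
  obtain ⟨hQ, hB, hv, hp⟩ := capBase_bounds G hn
  have hS : capBase G ≤ capBase G ^ (w + 1) := Nat.le_self_pow (Nat.succ_ne_zero _) _
  have hS1 : 1 ≤ capBase G ^ (w + 1) := Nat.pow_pos (by omega)
  constructor
  case size_pos => exact hn
  case adj => exact fun u v => h.src ▸ input_adj G x u v
  case cap_values =>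
    calc (numRounds G + 1) * numNodes G * (n + 1) * keyBase G ^ (w + 1) * n * n
        = (numRounds G + 1) * numNodes G * (n + 1) * n * n * keyBase G ^ (w + 1) := by ring
      _ ≤ capBase G ^ 3 * capBase G ^ (w + 1) :=
          Nat.mul_le_mul hv (Nat.pow_le_pow_left hQ _)
      _ ≤ (capBase G ^ (w + 1)) ^ 3 * capBase G ^ (w + 1) :=
          Nat.mul_le_mul_right _ (Nat.pow_le_pow_left hS _)
      _ = _ := (pow_succ _ 3).symm
  case cap_polys =>
    calc _ ≤ capBase G ^ 3 := hp
      _ ≤ (capBase G ^ (w + 1)) ^ 3 := Nat.pow_le_pow_left hS _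
      _ ≤ _ := Nat.pow_le_pow_right hS1 (by decide)
  case width_le =>
    calc w + 1 ≤ 2 ^ (w + 1) := Nat.lt_two_pow_self.le
      _ ≤ capBase G ^ (w + 1) := Nat.pow_le_pow_left hB _
      _ ≤ _ := Nat.le_self_pow (by decide) _
  case width_pos => exact Nat.succ_pos _
  case geom =>
    rw [sum_range_succ', pow_zero]
    simp only [pow_succ]
    rw [← sum_mul]
    simp [Cmd.grow, Cmd.run, h.geom, h.base]
  case keys => simp [Cmd.grow, Cmd.run, h.keys, h.base, pow_succ]
  all_goals simp [Cmd.grow, Cmd.run, h.size, h.edges, h.rounds, h.letters, h.base, h.width, h.nodes]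

theorem LoopInv.step {hn : 0 < n} {x : ℝ} (h : LoopInv G hn x w M V) (hG : Acyclic G) :
    LoopInv G hn x (w + 1)
      (Cmd.search.run ({ M with cap := (capBase G ^ (w + 1)) ^ 4 }, (Cmd.grow.run (M, V)).2)).1
      (Cmd.search.run ({ M with cap := (capBase G ^ (w + 1)) ^ 4 }, (Cmd.grow.run (M, V)).2)).2 := by
  have h0 := h.setup
  set M₀ : Mem := { M with cap := (capBase G ^ (w + 1)) ^ 4 } with hM₀
  obtain ⟨V', hV'⟩ : ∃ V', V' = (Cmd.grow.run (M, V)).2 := ⟨_, rfl⟩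
  rw [← hV'] at h0 ⊢
  obtain ⟨f₁, e₁, p₁⟩ := h0.reachFill_spec hG
  set M₁ : Mem := { M₀ with nat := Function.update M₀.nat 0 f₁ } with hM₁
  have h₁ : Setup G (w + 1) M₁ V' := h0.congr rfl rfl fun _ _ => rfl
  obtain ⟨f₂, e₂, p₂⟩ := h₁.feasFill_spec hG p₁
  set M₂ : Mem := { M₁ with nat := Function.update M₁.nat 1 f₂ } with hM₂
  have h₂ : Setup G (w + 1) M₂ V' := h₁.congr rfl rfl fun _ _ => rfl
  have e : Cmd.search.run (M₀, V') =
      (M₂, Function.update V' 31 (ind (WidthSuffices G hn (w + 1)))) := by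
    simp only [Cmd.search, Cmd.run]
    rw [e₁, e₂, h₂.eval_found (p₂ n le_rfl)]
  rw [e]
  have h29 : V' 29 = capBase G := by simp [hV', Cmd.grow, Cmd.run, h.growth]
  have h30 : V' 30 = capBase G ^ (w + 1) := by
    simp [hV', Cmd.grow, Cmd.run, h.growth, h.power, pow_succ]
  have hu : ∀ j ≠ 31, Function.update V' 31 (ind (WidthSuffices G hn (w + 1))) j = V' j :=
    fun j hj => Function.update_of_ne hj _ _
  exact
  { src := h.src
    arg := h.arg
    size := (hu _ (by decide)).trans h0.size
    edges := (hu _ (by decide)).trans h0.edges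
    rounds := (hu _ (by decide)).trans h0.rounds
    letters := (hu _ (by decide)).trans h0.letters
    base := (hu _ (by decide)).trans h0.base
    width := (hu _ (by decide)).trans h0.width
    keys := (hu _ (by decide)).trans h0.keys
    nodes := (hu _ (by decide)).trans h0.nodes
    geom := (hu _ (by decide)).trans h0.geom
    growth := (hu _ (by decide)).trans h29
    power := (hu _ (by decide)).trans h30
    cap_le := by
      show (capBase G ^ (w + 1)) ^ 4 ≤ _
      rw [← pow_mul]
      exact Nat.pow_le_pow_right (by have := (capBase_bounds G hn).2.1; omega) (by omega)
    found := by
      show Function.update V' 31 _ 31 = _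
      rw [Function.update_self]
      exact ind_congr (by simp)
    tables := fun _ => ⟨{ h₂ with
      size := (hu _ (by decide)).trans h0.size
      edges := (hu _ (by decide)).trans h0.edges
      rounds := (hu _ (by decide)).trans h0.rounds
      letters := (hu _ (by decide)).trans h0.letters
      base := (hu _ (by decide)).trans h0.base
      width := (hu _ (by decide)).trans h0.width
      keys := (hu _ (by decide)).trans h0.keys
      nodes := (hu _ (by decide)).trans h0.nodes
      geom := (hu _ (by decide)).trans h0.geom }, p₁, p₂⟩ }

/-! ### Executions -/

def searchTest : BExp := .natEq (getVar 31) (.lit 0)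

/-- The cap changes outside the commands, whose cost is measured under a fixed cap. Here `P ^ 4` is
formed from the power `P` in variable `30`. -/
def setCap : Program :=
  .setNat (natRef 1 (.lit 0)) (.mul (.mul (.mul (getVar 30) (getVar 30)) (getVar 30)) (getVar 30))

def searchBody : Program := .seq Cmd.grow.compile (.seq setCap Cmd.search.compile)

/-- The closed formula holds for nonnegative arguments only, so negative ones are answered by zero
directly. Real array `5` is table `4`. -/
def outputProg : Program :=
  .ite (.realLt (.cell (.lit 0)) (.ofNat (.lit 0))) (.setReal (.lit 0) (.ofNat (.lit 0)))
    (.setReal (.lit 0) (.cell (realRef 5 (.lit 0))))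

/-- The initial cap is `n`, just enough for the double loop that counts the edges. -/
def mainProg : Program :=
  .seq (.setNat (natRef 1 (.lit 0)) (.cell (.lit 0))) (.seq Cmd.init.compile
    (.seq (.while searchTest searchBody) (.seq Cmd.finish.compile outputProg)))

variable (G) in
/-- The memory represents a state of the search with `w` slots. -/
def SearchState (hn : 0 < n) (x : ℝ) (w : ℕ) (s : State) : Prop :=
  ∃ M V τ ρ, Rep n M V τ ρ s ∧ LoopInv G hn x w M V

theorem runs_searchBody {hn : 0 < n} {x : ℝ} (hG : Acyclic G) {s : State}
    (h : SearchState G hn x w s) {l : ℕ} (hl : capBase G ^ (4 * (w + 1) + 1) ≤ l) {T : ℕ}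
    (hT : ∀ l' ≤ l, Cmd.grow.cost l' ≤ T ∧ Cmd.search.cost l' ≤ T) :
    Runs searchBody s (2 * T + 100) (SearchState G hn x (w + 1)) := by
  obtain ⟨M, V, τ, ρ, r, I⟩ := h
  have hB : 1 ≤ capBase G := by have := (capBase_bounds G hn).2.1; omega
  have c₁ : M.cap ≤ l := I.cap_le.trans ((Nat.pow_le_pow_right hB (by omega)).trans hl)
  have c₂ : (capBase G ^ (w + 1)) ^ 4 ≤ l := by
    rw [← pow_mul]
    exact (Nat.pow_le_pow_right hB (by omega)).trans hl
  refine (Runs.seq (Cmd.runs_compile _ _ _ _ _ _ r) (T' := 100 + T) ?_).mono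
    (by have := (hT _ c₁).1; omega) fun _ => id
  rintro s₁ ⟨τ₁, ρ₁, r₁⟩
  refine Runs.seq (Q := fun s' => Rep n { M with cap := (capBase G ^ (w + 1)) ^ 4 }
    (Cmd.grow.run (M, V)).2 τ₁ ρ₁ s') ((Runs.setNat ?_).mono
      (by simp [NExp.cost, natRef]) fun _ => id) ?_
  · rw [r₁.eval_natRef]
    have h30 : (Cmd.grow.run (M, V)).2 30 = capBase G ^ (w + 1) := by
      simp [Cmd.grow, Cmd.run, I.growth, I.power, pow_succ]
    have e : (NExp.mul (.mul (.mul (getVar 30) (getVar 30)) (getVar 30)) (getVar 30)).eval s₁ =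
        (capBase G ^ (w + 1)) ^ 4 := by
      simp only [NExp.eval.eq_5, r₁.eval_getVar, h30]
      ring
    rw [e]
    exact r₁.setCap _
  · intro s₂ r₂
    refine (Cmd.runs_compile _ _ _ _ _ _ r₂).mono (hT _ c₂).2 ?_
    rintro s₃ ⟨τ₃, ρ₃, r₃⟩
    exact ⟨_, _, _, _, r₃, I.step hG⟩

theorem exists_widthSuffices (hn : 0 < n) : ∃ w, 0 < w ∧ WidthSuffices G hn w :=
  ⟨_, Nat.succ_pos _, widthSuffices_of_treewidth_le hn le_rfl⟩

/-- Variable `31` stays zero until the first sufficient positive width, so the number of iterations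
is that width, and the largest cap is the last one. -/
theorem runs_while {hn : 0 < n} {x : ℝ} (hG : Acyclic G) {s : State}
    (h : SearchState G hn x 0 s) {k : ℕ} (hk : 0 < k ∧ WidthSuffices G hn k)
    (hmin : ∀ w < k, ¬ (0 < w ∧ WidthSuffices G hn w)) {T : ℕ}
    (hT : ∀ l' ≤ capBase G ^ (4 * k + 1), Cmd.grow.cost l' ≤ T ∧ Cmd.search.cost l' ≤ T) :
    Runs (.while searchTest searchBody) s (k * (50 + (2 * T + 100)) + 50)
      (SearchState G hn x k) := by
  have hB : 1 ≤ capBase G := by have := (capBase_bounds G hn).2.1; omega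
  have hc : searchTest.cost ≤ 50 := by simp [searchTest, BExp.cost, NExp.cost, natRef]
  refine (Runs.while (T := 2 * T + 100) (I := SearchState G hn x) (fun w hw s hs => ⟨?_, runs_searchBody hG hs
    (Nat.pow_le_pow_right hB (by omega)) hT⟩) ?_ h).mono (by gcongr) fun _ => id
  · obtain ⟨M, V, τ, ρ, r, I⟩ := hs
    rw [searchTest, BExp.eval, r.eval_getVar, I.found, ind_false (hmin w hw)]
    rfl
  · rintro s ⟨M, V, τ, ρ, r, I⟩
    rw [searchTest, BExp.eval, r.eval_getVar, I.found, ind_true hk]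
    exact one_ne_zero

theorem runs_outputProg {τ : ℕ → ℕ} {ρ : ℕ → ℝ} {s : State} {y : ℝ} (r : Rep n M V τ ρ s)
    (h0 : M.arg < 0 → y = 0) (h1 : 0 ≤ M.arg → M.real 4 0 = y) :
    Runs outputProg s 50 fun s' => s'.output = y := by
  have hr : (realRef 5 (.lit 0)).eval s = realAddr (1 + (4 : Fin 16)) 0 := eval_realRef _ _
  refine (Runs.ite (T := 20) (fun hx => (Runs.setReal ?_).mono ?_ fun _ => id)
    fun hx => (Runs.setReal ?_).mono ?_ fun _ => id).mono ?_ fun _ => id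
  · simp only [BExp.eval, RExp.eval, NExp.eval, r.arg] at hx
    simp [State.output, NExp.eval, RExp.eval, h0 (by simpa using hx)]
  · simp [NExp.cost, RExp.cost]
  · simp only [BExp.eval, RExp.eval, NExp.eval, r.arg] at hx
    simp only [State.output, NExp.eval, RExp.eval, Function.update_self]
    rw [hr, r.rtab, h1 (by simpa using hx)]
  · simp [NExp.cost, RExp.cost, realRef]
  · simp [BExp.cost, NExp.cost, RExp.cost]

/-- The program halts with the value of the distribution function. -/
theorem runs_mainProg [Fintype (edgeSet G)] (hn : 0 < n) (hG : Acyclic G) (x : ℝ) {k : ℕ}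
    (hk : 0 < k ∧ WidthSuffices G hn k) (hmin : ∀ w < k, ¬ (0 < w ∧ WidthSuffices G hn w)) {T : ℕ}
    (hT : ∀ l ≤ capBase G ^ (4 * k + 1), Cmd.init.cost l ≤ T ∧ Cmd.grow.cost l ≤ T ∧
      Cmd.search.cost l ≤ T ∧ Cmd.finish.cost l ≤ T) :
    Runs mainProg (input G x) ((k + 1) * (2 * T + 500)) fun s => s.output = cdfValue G x := by
  have r₀ := rep_input G x
  have hB : 1 ≤ capBase G := by have := (capBase_bounds G hn).2.1; omega
  refine (Runs.seq (T := 50) (T' := T + ((k * (50 + (2 * T + 100)) + 50) + (T + 50)))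
    (Q := fun s => Rep n ⟨(input G x).nat, x, n, fun _ _ => 0, fun _ _ => 0⟩ (fun _ => 0)
      (fun _ => 0) (fun _ => 0) s)
    ((Runs.setNat ?_).mono (by simp [NExp.cost, natRef]) fun _ => id) ?_).mono (by ring_nf; omega) fun _ => id
  · rw [r₀.eval_natRef, show NExp.eval (input G x) (.cell (.lit 0)) = n from r₀.size]
    exact r₀.setCap _
  · intro s₁ r₁
    have I₀ := LoopInv.init (G := G) (M := ⟨(input G x).nat, x, n, fun _ _ => 0, fun _ _ => 0⟩)
      hn x rfl rfl rfl
    have hcap : n ≤ capBase G ^ (4 * k + 1) := by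
      have h1 := I₀.cap_le
      rw [Cmd.run_cap] at h1
      exact h1.trans (Nat.pow_le_pow_right hB (by omega))
    refine Runs.seq ((Cmd.runs_compile _ _ _ _ _ _ r₁).mono (hT n hcap).1 fun _ => id) ?_
    rintro s₂ ⟨τ₂, ρ₂, r₂⟩
    refine Runs.seq (runs_while hG ⟨_, _, _, _, r₂, I₀⟩ hk hmin
      fun l hl => ⟨(hT l hl).2.1, (hT l hl).2.2.1⟩) ?_
    rintro s₃ ⟨M, V, τ, ρ, r, I⟩
    refine Runs.seq ((Cmd.runs_compile _ _ _ _ _ _ r).mono (hT _ I.cap_le).2.2.2 fun _ => id) ?_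
    rintro s₄ ⟨τ₄, ρ₄, r₄⟩
    obtain ⟨hS, hR, hF⟩ := I.tables hk.1
    obtain ⟨e₁, e₂⟩ := hS.finish_run hG hR hF hk.2
    rw [I.arg] at e₁ e₂
    refine runs_outputProg r₄ (fun hx => ?_) fun hx => e₂ (by rwa [← e₁])
    rw [e₁] at hx
    exact if_pos hx

/-- Let `X` be the base on the right. Then `4 n (m + 2) ^ 3 ≤ X ^ 3` because `X ≥ 10 m n`, and `3 *
(4 * k' + 1) ≤ 27 * k` because `k' ≤ k + 1` and `k ≥ 1`; the summand two raises this to `28 * k`.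
The number of rounds costs one factor `X` and the constants cost `X ^ 3`, which together is the `4`
in the exponent. -/
theorem steps_le {m k k' c : ℕ} (hn : 0 < n) (hm : 0 < m) (hk : 0 < k) (hk' : k' ≤ k + 1) :
    (k' + 1) * (2 * ((4 * n * ((m + 2) * ((m + 2) * (m + 2)))) ^ (4 * k' + 1) + 2) ^ c + 500) ≤
      ((6 * k + 4) * m * n) ^ ((28 * c + 4) * k) := by
  obtain ⟨X, hX⟩ : ∃ X, (6 * k + 4) * m * n = X := ⟨_, rfl⟩
  have hmn : 1 ≤ m * n := Nat.mul_pos hm hn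
  have hX1 : 6 * k + 4 ≤ X := by
    rw [← hX, mul_assoc]; exact Nat.le_mul_of_pos_right _ hmn
  have hX10 : 10 * (m * n) ≤ X := by
    rw [← hX, mul_assoc]; exact Nat.mul_le_mul_right _ (by omega)
  have hX0 : 10 ≤ X := by omega
  have hXp : 1 ≤ X := by omega
  have hB : 4 * n * ((m + 2) * ((m + 2) * (m + 2))) ≤ X ^ 3 := by
    calc 4 * n * ((m + 2) * ((m + 2) * (m + 2)))
        ≤ 4 * n * ((3 * m) * ((3 * m) * (3 * m))) := by gcongr <;> omega
      _ = 108 * m ^ 3 * n := by ring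
      _ ≤ 1000 * m ^ 3 * n ^ 3 := by
        gcongr
        · norm_num
        · exact Nat.le_self_pow (by decide) _
      _ = (10 * (m * n)) ^ 3 := by ring
      _ ≤ _ := Nat.pow_le_pow_left hX10 _
  rw [hX]
  have h1 : (4 * n * ((m + 2) * ((m + 2) * (m + 2)))) ^ (4 * k' + 1) + 2 ≤ X ^ (28 * k) := by
    calc _ ≤ (X ^ 3) ^ (4 * k' + 1) + 2 := by gcongr
      _ = X ^ (3 * (4 * k' + 1)) + 2 := by rw [← pow_mul]
      _ ≤ X ^ (27 * k) + 2 :=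
        Nat.add_le_add_right (Nat.pow_le_pow_right hXp (by omega)) 2
      _ ≤ X ^ (27 * k) * X := by
        have : 1 ≤ X ^ (27 * k) := Nat.pow_pos hXp
        nlinarith
      _ = X ^ (27 * k + 1) := (pow_succ _ _).symm
      _ ≤ _ := Nat.pow_le_pow_right hXp (by omega)
  calc _ ≤ X * (2 * (X ^ (28 * k)) ^ c + 500) := by
        gcongr
        omega
    _ ≤ X * (1000 * (X ^ (28 * k)) ^ c) := by
        have : 1 ≤ (X ^ (28 * k)) ^ c := Nat.pow_pos (Nat.pow_pos hXp)
        gcongr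
        omega
    _ ≤ X * (X ^ 3 * (X ^ (28 * k)) ^ c) := by
        gcongr
        exact (by norm_num : 1000 = 10 ^ 3).le.trans (Nat.pow_le_pow_left hX0 3)
    _ = X ^ (28 * c * k + 4) := by ring
    _ ≤ _ := Nat.pow_le_pow_right hXp (by nlinarith)

end

end RealRAM

theorem mainTheorem4 :
    ∃ (P : RealRAM.Program) (C : ℕ),
      ∀ (n : ℕ) (G : Digraph (Fin n)) (x : ℝ), 0 < n → LongestPath.Acyclic G →
        ∃ (t : ℕ) (s : RealRAM.State), RealRAM.Exec P (RealRAM.input G x) t s ∧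
          (∀ (Ω : Type*) [MeasurableSpace Ω] (μ : Measure Ω) [IsProbabilityMeasure μ]
              (Y : Fin n × Fin n → Ω → ℝ),
            (∀ e ∈ LongestPath.edgeSet G, HasLaw (Y e) (expMeasure 1) μ) →
            iIndepFun (fun e : LongestPath.edgeSet G => Y e) μ →
            s.output = μ.real {ω | LongestPath.longestPathLength G (fun e => Y e ω) ≤ x}) ∧
          ∀ k : ℕ, treewidth G.toSimpleGraphInclusive ≤ k →
            0 < (LongestPath.edgeSet G).ncard →
            t ≤ ((6 * k + 4) * (LongestPath.edgeSet G).ncard * n) ^ (C * k) := by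
  classical
  -- The costs of a sequence add up, so the exponent for the sequence bounds each of the four
  -- commands.
  obtain ⟨c, hc⟩ := (RealRAM.Cmd.seq .init (.seq .grow (.seq .search .finish))).exists_cost_le
  refine ⟨RealRAM.mainProg, 28 * c + 4, fun n G x hn hG => ?_⟩
  have : Fintype (LongestPath.edgeSet G) := Fintype.ofFinite _
  have hex := RealRAM.exists_widthSuffices (G := G) hn
  obtain ⟨t, s, hs, ht, ho⟩ := RealRAM.runs_mainProg hn hG x (Nat.find_spec hex)
    (fun _ => Nat.find_min hex) (T := (RealRAM.capBase G ^ (4 * Nat.find hex + 1) + 2) ^ c)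
    fun l hl => by
      have h1 := (hc l).trans (Nat.pow_le_pow_left (Nat.add_le_add_right hl 2) c)
      simp only [RealRAM.Cmd.cost] at h1
      refine ⟨?_, ?_, ?_, ?_⟩ <;> omega
  refine ⟨t, s, hs, fun Ω _ μ _ Y hY hI => ?_, fun k hk hm => ht.trans ?_⟩
  · rw [LongestPath.real_longestPathLength_le hn hG x μ Y hY hI]
    exact ho
  · obtain ⟨e, he⟩ := Set.nonempty_of_ncard_ne_zero hm.ne'
    have hadj : G.toSimpleGraphInclusive.Adj e.1 e.2 := by
      rw [Digraph.toSimpleGraphInclusive, SimpleGraph.fromRel_adj]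
      exact ⟨fun h => hG e.1 (.single (h.symm.subst (motive := G.Adj e.1) he)), .inl he⟩
    -- The search stops at the least sufficient width, which is at most `k + 1`.
    exact RealRAM.steps_le hn hm (PairwiseSum.pos_of_treewidth_le hk hadj)
      (Nat.find_min' hex ⟨Nat.succ_pos _, RealRAM.widthSuffices_of_treewidth_le hn hk⟩)
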